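/- **Setting.** Let $T>0$ and let $\Gamma_0\subset\mathbb R^3$ be a nonempty compact embedded $C^2$ hypersurface without boundary, transported by the flow $\Phi^s_t$ ($s,t\in[0,T]$) of a $C^2$ velocity field $V:\mathbb R^3\times[0,T]\to\mathbb R^3$; put $\Gamma(t)=\Phi^0_t(\Gamma_0)$. For some $r>0$ let the signed distance function $d(\cdot,t)$ of $\Gamma(t)$ be of class $C^{2,1}$ on the space-time tube $\{(x,t):t\in[0,T],\ \mathrm{dist}(x,\Gamma(t))<r\}$, and let $a_t(x)=x-d(x,t)\nabla d(x,t)$ be the normal projection onto $\Gamma(t)$. Let $\Gamma^h(0)$ be a conforming triangulated surface with nodes $X_j(0)\in\Gamma_0$, $1\le j\le m_h$, and maximal triangle diameter $h$. Let $X_j(t)=\Phi^0_t(X_j(0))$, and let $\Gamma^h(t)$ be the surface with the same connectivity and nodes $X_j(t)$. Assume that for all $t\in[0,T]$ it is a conforming nondegenerate triangulation lying in the tube, that all angles of its triangles are at least $\theta>0$, and that $a_t$ is a homeomorphism from $\Gamma^h(t)$ onto $\Gamma(t)$. Let $V_h(t)$ be the space of continuous piecewise linear functions on $\Gamma^h(t)$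 with nodal basis $\varphi_j(t)$; let $\Phi^s_{t,h}:\Gamma^h(s)\to\Gamma^h(t)$ be the map that is affine on each triangle and takes $X_j(s)$ to $X_j(t)$, and $\phi^s_{t,h}v=v\circ\Phi^s_{t,h}$. Let $H^1_{V_h}=\{\sum_j\bar y_j(t)\varphi_j(t):\bar y_j\in H^1([0,T])\}$ with material derivative $\dot y=\sum_j\bar y_j'\varphi_j$. Let $L^2_{L^2(\Gamma)}$ be the space of families $f(t):\Gamma(t)\to\mathbb R$ with $f(t)\circ\Phi^0_t\in L^2((0,T),L^2(\Gamma_0))$, with norm $\|f\|_{L^2_{L^2(\Gamma)}}=(\int_0^T\|f(t)\|^2_{L^2(\Gamma(t))}dt)^{1/2}$, define $\|\cdot\|_{L^2_{L^2(\Gamma^h)}}$ in the same way, and put $f_l(t)=f(t)\circ a_t$ on $\Gamma^h(t)$. Let $\lambda$ be a function on $\bigcup_{t\in[0,T]}\Gamma^h(t)\times\{t\}$ with $1\le\lambda\le\Lambda$ and Lipschitz constant $L$, and put $\mathfrak a(t;\psi,\varphi)=\int_{\Gamma^h(t)}\nabla_{\Gamma^h}\psi\cdot\nabla_{\Gamma^h}\varphi+\lambda\psi\varphi$.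 *Semidiscrete problem.* Given $y_0^h\in V_h(0)$ and $f\in L^2_{L^2(\Gamma)}$, $y_h\in H^1_{V_h}$ satisfies $y_h(0)=y_0^h$ and, for all $\varphi\in H^1_{V_h}$ and a.e. $t\in(0,T)$, $$\frac{d}{dt}\int_{\Gamma^h(t)}y_h\varphi+\mathfrak a(t;y_h,\varphi)=\langle\dot\varphi,y_h\rangle_{L^2(\Gamma^h(t))}+\langle f_l,\varphi\rangle_{L^2(\Gamma^h(t))}.$$ *Fully discrete scheme (implicit Euler, discontinuous Galerkin with piecewise constants).* Let $N\ge1$, $k=T/N$, $t_n=nk$, $I_n=(t_{n-1},t_n]$, $\langle\cdot,\cdot\rangle_n=\langle\cdot,\cdot\rangle_{L^2(\Gamma^h(t_n))}$. Let $\mathfrak a_n=\mathfrak a(t_n;\cdot,\cdot)+\mathfrak r_n$, where the $\mathfrak r_n$ are bilinear forms on $V_h(t_n)$ with $|\mathfrak r_n(\psi,\varphi)|\le C_{\mathfrak r}k\|\psi\|_{H^1(\Gamma^h(t_n))}\|\varphi\|_{H^1(\Gamma^h(t_n))}$ for a constant $C_{\mathfrak r}\ge 0$. The functions $y^n\in V_h(t_n)$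 satisfy $y^0=y_0^h$ and, for $1\le n\le N$ and all $\varphi\in V_h(t_n)$, $$\langle y^n,\varphi\rangle_n-\langle y^{n-1},\phi^{t_{n-1}}_{t_n,h}\varphi\rangle_{n-1}+k\,\mathfrak a_n(y^n,\varphi)=\int_{I_n}\langle\phi^{t_n}_{t,h}f_l(t),\varphi\rangle_n\,dt,$$ and $y_{h,k}(t)=\phi^t_{t_n,h}y^n$ for $t\in I_n$. **Theorem.** There are constants $C>0$ and $h_0>0$, depending only on the evolving surface (that is, on $T,\Gamma_0,V,r,d$) and on $\theta,\Lambda,L,C_{\mathfrak r}$, such that for every triangulation as above with $h\le h_0$, every such $\lambda$, every $N\ge 1$ with $C_{\mathfrak r}k\le\frac12$, all such $\mathfrak r_n$, all $f\in L^2_{L^2(\Gamma)}$ and $y_0^h\in V_h(0)$, and all solutions $y_h$ and $y_{h,k}$ of the two problems, $$\|y_h-y_{h,k}\|_{L^2_{L^2(\Gamma^h)}}\le Ck\left(\|\dot y_h\|_{L^2_{L^2(\Gamma^h)}}+\|f\|_{L^2_{L^2(\Gamma)}}+\|y_0^h\|_{L^2(\Gamma^h(0))}\right).$$ In particular $C$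 is independent of $h$, $k$, $f$ and $y_0^h$. -/

import Mathlib

open MeasureTheory Set
open scoped NNReal ENNReal

namespace EvolvingFEM

noncomputable section

/-- The ambient space `ℝ³`. -/
abbrev Space : Type := EuclideanSpace ℝ (Fin 3)

/-- Surface measure on `S ⊆ ℝ³`: the two-dimensional Hausdorff measure, normalised so as to agree
with Lebesgue measure on planes, restricted to `S`. -/
def surfaceMeasure (S : Set Space) : Measure Space := (μHE[2] : Measure Space).restrict S

/-- `S` is an embedded hypersurface of class `C²` without boundary: locally a regular level set of
a `C²` function. -/
def IsC2Hypersurface (S : Set Space) : Prop :=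
  ∀ p ∈ S, ∃ U : Set Space, IsOpen U ∧ p ∈ U ∧ ∃ g : Space → ℝ,
    ContDiffOn ℝ 2 g U ∧ (∀ x ∈ U, fderiv ℝ g x ≠ 0) ∧ S ∩ U = {x ∈ U | g x = 0}

/-- The space-time tube of all `(x, t)` with `t ∈ [0,T]` and `dist(x, Γ(t)) < r`. -/
def tubeAround (T r : ℝ) (Γ : ℝ → Set Space) : Set (Space × ℝ) :=
  {q | q.2 ∈ Icc 0 T ∧ Metric.infDist q.1 (Γ q.2) < r}

/-- A compact `C²` hypersurface `Γ₀ ⊆ ℝ³` transported over `[0,T]` by the flow of a `C²` velocity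
field; `flow s t x` is the position at time `t` of the particle that is at `x` at time `s`.
The surfaces `Γ(t) = flow 0 t '' Γ₀` have a signed distance function `d` of class `C^{2,1}` in a
tube of width `r`. -/
structure EvolvingSurface where
  T : ℝ
  T_pos : 0 < T
  initialSurface : Set Space
  initialSurface_nonempty : initialSurface.Nonempty
  isCompact_initialSurface : IsCompact initialSurface
  isC2_initialSurface : IsC2Hypersurface initialSurface
  velocity : Space × ℝ → Space
  contDiffOn_velocity : ContDiffOn ℝ 2 velocity (univ ×ˢ Icc 0 T)
  flow : ℝ → ℝ → Space → Space
  flow_self : ∀ s ∈ Icc 0 T, ∀ x, flow s s x = x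
  flow_deriv : ∀ s ∈ Icc 0 T, ∀ t ∈ Icc 0 T, ∀ x,
    HasDerivWithinAt (fun τ => flow s τ x) (velocity (flow s t x, t)) (Icc 0 T) t
  r : ℝ
  r_pos : 0 < r
  d : Space × ℝ → ℝ
  abs_d : ∀ q ∈ tubeAround T r (fun t => flow 0 t '' initialSurface),
    |d q| = Metric.infDist q.1 (flow 0 q.2 '' initialSurface)
  contDiffOn_d : ContDiffOn ℝ 2 d (tubeAround T r (fun t => flow 0 t '' initialSurface))
  lipschitz_d : ∃ K : ℝ≥0, LipschitzOnWith K
    (iteratedFDerivWithin ℝ 2 d (tubeAround T r (fun t => flow 0 t '' initialSurface)))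
    (tubeAround T r (fun t => flow 0 t '' initialSurface))

namespace EvolvingSurface

/-- The surface `Γ(t)`. -/
def surface (S : EvolvingSurface) (t : ℝ) : Set Space := S.flow 0 t '' S.initialSurface

/-- The normal projection `a_t(x) = x - d(x,t) ∇d(x,t)` onto `Γ(t)`. -/
def proj (S : EvolvingSurface) (t : ℝ) (x : Space) : Space :=
  x - S.d (x, t) • gradient (fun y => S.d (y, t)) x

/-- The space `L²_{L²(Γ)}`: the pull-back of `f` to the fixed domain `Γ₀` by the flow belongs to
`L²((0,T), L²(Γ₀)) = L²((0,T) × Γ₀)`. -/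
def MemL2 (S : EvolvingSurface) (f : ℝ → Space → ℝ) : Prop :=
  MemLp (fun q : ℝ × Space => f q.1 (S.flow 0 q.1 q.2)) 2
    ((volume.restrict (Icc 0 S.T)).prod (surfaceMeasure S.initialSurface))

end EvolvingSurface

/-- The norm `(∫₀ᵀ ‖u(t)‖²_{L²(Γ(t))} dt)^{1/2}` for a family `Γ(t)` of surfaces, with values in
`[0,∞]`. -/
def evolvingNorm (T : ℝ) (Γ : ℝ → Set Space) (u : ℝ → Space → ℝ) : ℝ≥0∞ :=
  (∫⁻ t in Icc 0 T, eLpNorm (u t) 2 (surfaceMeasure (Γ t)) ^ 2) ^ (1 / 2 : ℝ)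

/-- A triangulated surface: finitely many nodes at time `0`, and finitely many triangles, each
given by three nodes. -/
structure Mesh where
  numNodes : ℕ
  numTriangles : ℕ
  node : Fin numNodes → Space
  tri : Fin numTriangles → Fin 3 → Fin numNodes

namespace Mesh

variable (M : Mesh) (S : EvolvingSurface)

/-- The nodes `X_j(t)`, transported by the flow. -/
def nodeAt (t : ℝ) (j : Fin M.numNodes) : Space := S.flow 0 t (M.node j)

/-- The closed triangle `T_i(t)`. -/
def cell (t : ℝ) (i : Fin M.numTriangles) : Set Space :=
  convexHull ℝ (range fun a => M.nodeAt S t (M.tri i a))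

/-- The polyhedral surface `Γ^h(t)`. -/
def surface (t : ℝ) : Set Space := ⋃ i, M.cell S t i

/-- The mesh size `h`: the maximal diameter of the triangles of `Γ^h(0)`. -/
def meshSize : ℝ := ⨆ i, Metric.diam (M.cell S 0 i)

/-- The transported mesh is an admissible triangulation with nodes on `Γ(t)` for all `t ∈ [0,T]`
(any two triangles meet exactly in the simplex spanned by their common nodes), all angles stay
above `θ`, and the normal projection is a homeomorphism from `Γ^h(t)` onto `Γ(t)`. -/
structure IsAdmissible (θ : ℝ) : Prop where
  node_mem : ∀ j, M.node j ∈ S.initialSurface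
  node_injective : Function.Injective M.node
  node_used : ∀ j, ∃ i, j ∈ range (M.tri i)
  tri_distinct : ∀ i i', range (M.tri i) = range (M.tri i') → i = i'
  affineIndependent : ∀ t ∈ Icc 0 S.T, ∀ i,
    AffineIndependent ℝ (fun a => M.nodeAt S t (M.tri i a))
  conforming : ∀ t ∈ Icc 0 S.T, ∀ i i', M.cell S t i ∩ M.cell S t i' =
    convexHull ℝ (M.nodeAt S t '' (range (M.tri i) ∩ range (M.tri i')))
  angle_ge : ∀ t ∈ Icc 0 S.T, ∀ i, ∀ a b c : Fin 3, a ≠ b → b ≠ c → a ≠ c →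
    θ ≤ EuclideanGeometry.angle (M.nodeAt S t (M.tri i a)) (M.nodeAt S t (M.tri i b))
      (M.nodeAt S t (M.tri i c))
  mem_tube : ∀ t ∈ Icc 0 S.T, ∀ x ∈ M.surface S t, Metric.infDist x (S.surface t) < S.r
  proj_homeomorph : ∀ t ∈ Icc 0 S.T, ∃ e : M.surface S t ≃ₜ S.surface t,
    ∀ x : M.surface S t, (e x : Space) = S.proj t x

/-- `w` lists the barycentric coordinates of `x` in a triangle of `Γ^h(t)`, extended by zero to
all nodes. -/
def IsBary (t : ℝ) (x : Space) (w : Fin M.numNodes → ℝ) : Prop :=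
  (∀ j, 0 ≤ w j) ∧ ∑ j, w j = 1 ∧ ∑ j, w j • M.nodeAt S t j = x ∧
    ∃ i, ∀ j, j ∉ range (M.tri i) → w j = 0

open Classical in
/-- The nodal basis functions: `basisFun t x j` is the value at `x ∈ Γ^h(t)` of the continuous,
piecewise linear function `φ_j(t)` that is one at `X_j(t)` and zero at all other nodes, that is,
the barycentric coordinate of `x` belonging to `X_j(t)`. -/
def basisFun (t : ℝ) (x : Space) : Fin M.numNodes → ℝ :=
  if h : ∃ w, M.IsBary S t x w then h.choose else 0

/-- Weights carried by one nondegenerate triangle are determined by their sum and barycentre. -/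
theorem weights_unique {t : ℝ} {i : Fin M.numTriangles}
    (h : AffineIndependent ℝ (fun a => M.nodeAt S t (M.tri i a))) {w w' : Fin M.numNodes → ℝ}
    (hw : ∀ j, j ∉ range (M.tri i) → w j = 0) (hw' : ∀ j, j ∉ range (M.tri i) → w' j = 0)
    (h1 : ∑ j, w j = ∑ j, w' j)
    (h2 : ∑ j, w j • M.nodeAt S t j = ∑ j, w' j • M.nodeAt S t j) : w = w' := by
  have hinj : Function.Injective (M.tri i) := fun a b hab => h.injective (by simp [hab])
  have key := (affineIndependent_iff (k := ℝ)).1 h Finset.univ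
    (fun a => w (M.tri i a) - w' (M.tri i a))
  have e1 : ∑ a, (w (M.tri i a) - w' (M.tri i a)) = ∑ j, (w j - w' j) :=
    Fintype.sum_of_injective _ hinj _ _ (fun j hj => by simp [hw j hj, hw' j hj]) (fun _ => rfl)
  have e2 : ∑ a, (w (M.tri i a) - w' (M.tri i a)) • M.nodeAt S t (M.tri i a) =
      ∑ j, (w j - w' j) • M.nodeAt S t j :=
    Fintype.sum_of_injective _ hinj _ _ (fun j hj => by simp [hw j hj, hw' j hj]) (fun _ => rfl)
  rw [e1, e2] at key
  have key' := key (by simp [Finset.sum_sub_distrib, h1])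
    (by simp [sub_smul, Finset.sum_sub_distrib, h2])
  funext j
  by_cases hj : j ∈ range (M.tri i)
  · obtain ⟨a, rfl⟩ := hj
    exact sub_eq_zero.1 (key' a (Finset.mem_univ a))
  · rw [hw j hj, hw' j hj]

/-- The barycentric coordinates are unique, so that `basisFun` does not depend on a choice. -/
theorem IsBary.unique {M : Mesh} {S : EvolvingSurface} {θ : ℝ} (hM : M.IsAdmissible S θ) {t : ℝ}
    (ht : t ∈ Icc 0 S.T) {x : Space} {w w' : Fin M.numNodes → ℝ} (hw : M.IsBary S t x w)
    (hw' : M.IsBary S t x w') : w = w' := by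
  obtain ⟨hn, hs, hx, i, hi⟩ := hw
  obtain ⟨hn', hs', hx', i', hi'⟩ := hw'
  have mem : ∀ (u : Fin M.numNodes → ℝ) (l : Fin M.numTriangles), (∀ j, 0 ≤ u j) →
      ∑ j, u j = 1 → ∑ j, u j • M.nodeAt S t j = x → (∀ j, j ∉ range (M.tri l) → u j = 0) →
      x ∈ M.cell S t l := by
    intro u l h0 h1 h2 h3
    have hinj : Function.Injective (M.tri l) :=
      fun a b hab => (hM.affineIndependent t ht l).injective (by simp [hab])
    have e1 : ∑ a, u (M.tri l a) = ∑ j, u j :=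
      Fintype.sum_of_injective _ hinj _ _ (fun j hj => h3 j hj) (fun _ => rfl)
    have e2 : ∑ a, u (M.tri l a) • M.nodeAt S t (M.tri l a) = ∑ j, u j • M.nodeAt S t j :=
      Fintype.sum_of_injective _ hinj _ _ (fun j hj => by simp [h3 j hj]) (fun _ => rfl)
    rw [← h2, ← e2]
    exact (convex_convexHull ℝ _).sum_mem (fun a _ => h0 _) (e1.trans h1)
      (fun a _ => subset_convexHull ℝ _ (mem_range_self a))
  have hmem : x ∈ M.cell S t i ∩ M.cell S t i' :=
    ⟨mem w i hn hs hx hi, mem w' i' hn' hs' hx' hi'⟩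
  rw [hM.conforming t ht i i'] at hmem
  obtain ⟨u, hu, hu1, hux⟩ : ∃ u : Fin M.numNodes → ℝ,
      (∀ j, j ∉ range (M.tri i) ∩ range (M.tri i') → u j = 0) ∧ ∑ j, u j = 1 ∧
        ∑ j, u j • M.nodeAt S t j = x := by
    classical
    have hco : Convex ℝ {z : Space | ∃ u : Fin M.numNodes → ℝ,
        (∀ j, j ∉ range (M.tri i) ∩ range (M.tri i') → u j = 0) ∧ ∑ j, u j = 1 ∧
          ∑ j, u j • M.nodeAt S t j = z} := by
      rintro z ⟨u, h1, h2, h3⟩ z' ⟨u', h1', h2', h3'⟩ α β - - hαβ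
      refine ⟨α • u + β • u', fun j hj => by simp [h1 j hj, h1' j hj], ?_, ?_⟩
      · simp [Finset.sum_add_distrib, ← Finset.mul_sum, h2, h2', hαβ]
      · simp [add_smul, Finset.sum_add_distrib, mul_smul, ← Finset.smul_sum, h3, h3']
    refine convexHull_min ?_ hco hmem
    rintro _ ⟨j, hj, rfl⟩
    refine ⟨Pi.single j 1, fun l hl => ?_, by simp, by simp [Pi.single_apply]⟩
    rw [Pi.single_apply, if_neg]
    rintro rfl
    exact hl hj
  have a1 := M.weights_unique S (hM.affineIndependent t ht i) hi
    (fun j hj => hu j (fun h => hj h.1)) (hs.trans hu1.symm) (hx.trans hux.symm)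
  have a2 := M.weights_unique S (hM.affineIndependent t ht i') hi'
    (fun j hj => hu j (fun h => hj h.2)) (hs'.trans hu1.symm) (hx'.trans hux.symm)
  exact a1.trans a2.symm

/-- The finite element function `∑ v_j φ_j(t)` with nodal values `v`, an element of `V_h(t)`.
As the `φ_j` are transported by the discrete flow, pulling back an element of `V_h(t)` to
`Γ^h(s)` leaves its nodal values unchanged. -/
def feFun (t : ℝ) (v : Fin M.numNodes → ℝ) (x : Space) : ℝ := ∑ j, v j * M.basisFun S t x j

/-- The discrete flow `Φ^s_{t,h} : Γ^h(s) → Γ^h(t)`, affine on each triangle. -/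
def flowH (s t : ℝ) (x : Space) : Space := ∑ j, M.basisFun S s x j • M.nodeAt S t j

/-- The edge vectors of the `i`-th triangle at time `t` that start from its first node. -/
def edge (t : ℝ) (i : Fin M.numTriangles) (b : Fin 2) : Space :=
  M.nodeAt S t (M.tri i b.succ) - M.nodeAt S t (M.tri i 0)

/-- The surface gradient of `∑ v_j φ_j(t)` on the `i`-th triangle: the tangential vector whose
inner products with the edge vectors are the differences of the nodal values. -/
def cellGrad (t : ℝ) (i : Fin M.numTriangles) (v : Fin M.numNodes → ℝ) : Space :=
  ∑ b, ((Matrix.gram ℝ (M.edge S t i))⁻¹.mulVec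
    (fun b' : Fin 2 => v (M.tri i b'.succ) - v (M.tri i 0))) b • M.edge S t i b

theorem inner_edge_cellGrad {t : ℝ} {i : Fin M.numTriangles}
    (h : AffineIndependent ℝ (fun a => M.nodeAt S t (M.tri i a))) (v : Fin M.numNodes → ℝ)
    (b : Fin 2) :
    inner ℝ (M.edge S t i b) (M.cellGrad S t i v) = v (M.tri i b.succ) - v (M.tri i 0) := by
  have hli : LinearIndependent ℝ (M.edge S t i) := by
    have h' := (affineIndependent_iff_linearIndependent_vsub ℝ _ (0 : Fin 3)).1 h
    exact h'.comp (fun b : Fin 2 => (⟨b.succ, Fin.succ_ne_zero b⟩ : {a : Fin 3 // a ≠ 0}))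
      (fun b b' hb => Fin.succ_injective _ (congrArg Subtype.val hb))
  have hdet : IsUnit (Matrix.gram ℝ (M.edge S t i)).det :=
    isUnit_iff_ne_zero.2 (Matrix.det_gram_ne_zero_iff_linearIndependent.2 hli)
  set g : Fin 2 → ℝ := fun b' => v (M.tri i b'.succ) - v (M.tri i 0) with hg
  have e : (Matrix.gram ℝ (M.edge S t i)).mulVec
      ((Matrix.gram ℝ (M.edge S t i))⁻¹.mulVec g) = g := by
    rw [Matrix.mulVec_mulVec, Matrix.mul_nonsing_inv _ hdet, Matrix.one_mulVec]
  have e' := congrFun e b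
  rw [cellGrad, inner_sum]
  simp only [real_inner_smul_right]
  refine Eq.trans ?_ e'
  simp only [Matrix.mulVec, dotProduct, Matrix.gram_apply]
  exact Finset.sum_congr rfl fun _ _ => mul_comm _ _

/-- The inner product of `L²(Γ^h(t))` on `V_h(t)`. -/
def massForm (t : ℝ) (u v : Fin M.numNodes → ℝ) : ℝ :=
  ∫ x, M.feFun S t u x * M.feFun S t v x ∂surfaceMeasure (M.surface S t)

/-- The form `𝔞(t; u, v) = ∫_{Γ^h(t)} ∇u · ∇v + lam u v`. -/
def energyForm (lam : Space × ℝ → ℝ) (t : ℝ) (u v : Fin M.numNodes → ℝ) : ℝ :=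
  ∑ i, ∫ x, (inner ℝ (M.cellGrad S t i u) (M.cellGrad S t i v) +
    lam (x, t) * M.feFun S t u x * M.feFun S t v x) ∂surfaceMeasure (M.cell S t i)

/-- The norm of `H¹(Γ^h(t))` on `V_h(t)`. -/
def h1Norm (t : ℝ) (v : Fin M.numNodes → ℝ) : ℝ := √(M.energyForm S (fun _ => 1) t v v)

/-- The set of all `(x, t)` with `t ∈ [0,T]` and `x ∈ Γ^h(t)`. -/
def spaceTime : Set (Space × ℝ) := {q | q.2 ∈ Icc 0 S.T ∧ q.1 ∈ M.surface S q.2}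

/-- The inverse lift `f_l(t) = f(t) ∘ a_t` of a function on the surfaces `Γ(t)`. -/
def invLift (f : ℝ → Space → ℝ) (t : ℝ) (x : Space) : ℝ := f t (S.proj t x)

/-- `∑ y_j(t) φ_j(t)` lies in `H¹_{V_h}`, with material derivative `∑ y'_j(t) φ_j(t)`: the
coefficients are the continuous representatives of elements of `H¹([0,T])`, with weak
derivatives `y'_j ∈ L²(0,T)`. -/
def IsH1 (y y' : ℝ → Fin M.numNodes → ℝ) : Prop :=
  ∀ j, MemLp (fun t => y' t j) 2 (volume.restrict (Icc 0 S.T)) ∧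
    ∀ t ∈ Icc 0 S.T, y t j = y 0 j + ∫ τ in (0 : ℝ)..t, y' τ j

/-- `y` (with material derivative `y'`) solves the semidiscrete problem with potential `lam`,
right-hand side `f` on the surfaces `Γ^h(t)`, and initial value `y₀ ∈ V_h(0)`. -/
def SolvesSemidiscrete (lam : Space × ℝ → ℝ) (f : ℝ → Space → ℝ) (y₀ : Fin M.numNodes → ℝ)
    (y y' : ℝ → Fin M.numNodes → ℝ) : Prop :=
  M.IsH1 S y y' ∧ y 0 = y₀ ∧
    ∀ φ φ' : ℝ → Fin M.numNodes → ℝ, M.IsH1 S φ φ' → ∀ᵐ t ∂volume.restrict (Ioo 0 S.T),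
      ∃ D : ℝ, HasDerivAt (fun τ => M.massForm S τ (y τ) (φ τ)) D t ∧
        D + M.energyForm S lam t (y t) (φ t) = M.massForm S t (φ' t) (y t) +
          ∫ x, f t x * M.feFun S t (φ t) x ∂surfaceMeasure (M.surface S t)

/-- The time step `k = T / N`. -/
def timeStep (N : ℕ) : ℝ := S.T / N

/-- `(Y n)` solves the fully discrete scheme on the time grid `t_n = n k`, `k = T / N`, with
`𝔞_n = 𝔞(t_n; ·, ·) + rem n`. -/
def SolvesFullyDiscrete (lam : Space × ℝ → ℝ) (f : ℝ → Space → ℝ) (y₀ : Fin M.numNodes → ℝ)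
    (N : ℕ) (rem : ℕ → (Fin M.numNodes → ℝ) →ₗ[ℝ] (Fin M.numNodes → ℝ) →ₗ[ℝ] ℝ)
    (Y : ℕ → Fin M.numNodes → ℝ) : Prop :=
  Y 0 = y₀ ∧ ∀ n < N, ∀ φ : Fin M.numNodes → ℝ,
    M.massForm S ((n + 1) * timeStep S N) (Y (n + 1)) φ - M.massForm S (n * timeStep S N) (Y n) φ +
      timeStep S N * (M.energyForm S lam ((n + 1) * timeStep S N) (Y (n + 1)) φ +
        rem (n + 1) (Y (n + 1)) φ) =
    ∫ t in (n * timeStep S N)..((n + 1) * timeStep S N),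
      ∫ x, f t (M.flowH S ((n + 1) * timeStep S N) t x) *
        M.feFun S ((n + 1) * timeStep S N) φ x
          ∂surfaceMeasure (M.surface S ((n + 1) * timeStep S N))

/-- The function in `W_k^h` with the nodal values `Y n` on `I_n = (t_{n-1}, t_n]`. -/
def stepFun (N : ℕ) (Y : ℕ → Fin M.numNodes → ℝ) (t : ℝ) (x : Space) : ℝ :=
  M.feFun S t (Y ⌈t / timeStep S N⌉₊) x

end Mesh

end

end EvolvingFEM

/-!
The discrete flow leaves nodal values unchanged, so both problems live on the fixed space of nodal
values, and the mass form `m t` and the energy form `a t` become families of symmetric forms on it.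
As the angles of the triangles are bounded below, an affine image of a triangle under the motion of
its nodes is distorted at most by a factor `exp (c |t - s|)`. Hence areas, gradients and the
potential grow at most exponentially in time, and so do `m` and `a` (`EvolvingForm`), with a rate
that does not depend on the mesh. Everything else about the time stepping is abstract
(`euler_error`).

The error estimate is a duality argument. The obvious test function, the error
`e = y(t_n) - Y n`, would bring in the energy of `y(t) - y(t_n)`, that is, the gradient of the
material derivative, which the right-hand side of the theorem does not contain. Instead one tests
with `ψ_n`, where `a(ψ_n, ·) = m(e, ·)`: then `a(y(t) - y(t_n), ψ_n) = m(y(t) - y(t_n), e)` is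
controlled by the mass norm of the material derivative alone, and the scheme gives a recursion for
`a(ψ_n, ψ_n)` that sums up to the bound for `∑ k m(e, e)` (`euler_error_step`). The variation in
time of the forms, the perturbations `rem n` and the evaluation of the load on the wrong surface
contribute `O(k)`, multiplied by the energies of the two solutions. These are bounded by the data
(`IsSemidiscreteSolution.integral_energy_le`, `euler_energy_le`). Multiplication by `exp (c k)` in
one step is absorbed in a telescoping sum, so that no smallness of `k` against `c` is needed.

The geometry enters in three places. Trajectories from `Γ₀` have uniform bounds
(`EvolvingSurface.exists_flowBounds`), from which `Mesh.exists_transportBounds` derives those for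
the triangles. The normal projection is expanding up to a factor two on each triangle of a fine mesh
(`EvolvingSurface.exists_proj_expanding`); comparison of Hausdorff measures then bounds the norm of
the lifted data on the polyhedral surface by that on `Γ(t)`
(`Mesh.TransportBounds.lintegral_proj_le`). Finally the lifted data are measurable in space-time
(`Mesh.TransportBounds.aestronglyMeasurable_data`), which is not immediate because membership in
`L²_{L²(Γ)}` only speaks of the pull-back to `Γ₀`.
-/

namespace EvolvingFEM

/-! ### Symmetric bilinear forms -/

/-- A bilinear form on the space of nodal values. -/
abbrev NodalForm (ι : Type*) : Type _ := (ι → ℝ) →ₗ[ℝ] (ι → ℝ) →ₗ[ℝ] ℝ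

section Forms

variable {V : Type*} [AddCommGroup V] [Module ℝ V]

theorem abs_apply_le_of_symm {B D : V →ₗ[ℝ] V →ₗ[ℝ] ℝ} {ε : ℝ} (hε : 0 ≤ ε)
    (hD : ∀ u v, D u v = D v u) (hB : ∀ u, 0 ≤ B u u) (h : ∀ u, |D u u| ≤ ε * B u u) (u v : V) :
    |D u v| ≤ ε * (√(B u u) * √(B v v)) := by
  have key : ∀ r : ℝ, 0 ≤ (ε * B u u) * (r * r) + (-(2 * D u v)) * r + ε * B v v := by
    intro r
    -- polarisation of `D`, and the parallelogram identity for `B`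
    have h1 := (abs_le.1 (h (r • u + v))).2
    have h2 := (abs_le.1 (h (r • u - v))).1
    have e1 : B (r • u + v) (r • u + v) + B (r • u - v) (r • u - v) =
        2 * (r * r * B u u + B v v) := by
      simp only [map_add, map_sub, map_smul, LinearMap.add_apply, LinearMap.sub_apply,
        LinearMap.smul_apply, smul_eq_mul]
      ring
    have e2 : D (r • u + v) (r • u + v) - D (r • u - v) (r • u - v) = 4 * (r * D u v) := by
      simp only [map_add, map_sub, map_smul, LinearMap.add_apply, LinearMap.sub_apply,
        LinearMap.smul_apply, smul_eq_mul, hD v u]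
      ring
    have e3 : ε * (B (r • u + v) (r • u + v)) + ε * B (r • u - v) (r • u - v) =
        2 * (ε * (r * r * B u u + B v v)) := by rw [← mul_add, e1]; ring
    nlinarith
  have hd := discrim_le_zero key
  rw [discrim] at hd
  have hs : (D u v) ^ 2 ≤ (ε * (√(B u u) * √(B v v))) ^ 2 := by
    rw [mul_pow, mul_pow, Real.sq_sqrt (hB u), Real.sq_sqrt (hB v)]
    nlinarith
  exact abs_le_of_sq_le_sq hs (by positivity)

theorem abs_apply_le_sqrt_mul_sqrt {B : V →ₗ[ℝ] V →ₗ[ℝ] ℝ} (hs : ∀ u v, B u v = B v u)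
    (hB : ∀ u, 0 ≤ B u u) (u v : V) : |B u v| ≤ √(B u u) * √(B v v) := by
  simpa using abs_apply_le_of_symm zero_le_one hs hB
    (fun u => by rw [abs_of_nonneg (hB u), one_mul])
    u v

theorem apply_sub_self_le {B : V →ₗ[ℝ] V →ₗ[ℝ] ℝ} (hB : ∀ u, 0 ≤ B u u) (u v w : V) :
    B (u - w) (u - w) ≤ 2 * B (u - v) (u - v) + 2 * B (v - w) (v - w) := by
  have h := hB ((u - v) - (v - w))
  have e : u - w = (u - v) + (v - w) := by abel
  rw [e]
  generalize u - v = p at *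
  generalize v - w = q at *
  simp only [map_add, map_sub, LinearMap.add_apply, LinearMap.sub_apply] at *
  linarith

/-- Solvability of `a(ψ, ·) = g` for a semidefinite symmetric form `a` in finite dimensions: it
suffices that `g` vanishes where `a` does. -/
theorem exists_apply_eq_of_symm [FiniteDimensional ℝ V] {a : V →ₗ[ℝ] V →ₗ[ℝ] ℝ}
    (g : V →ₗ[ℝ] ℝ) (hg : ∀ u, a u u = 0 → g u = 0) : ∃ ψ, ∀ u, a ψ u = g u := by
  have hmem : g ∈ LinearMap.range a := by
    rw [← Subspace.dualCoannihilator_dualAnnihilator_eq (W := LinearMap.range a)]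
    refine (Submodule.mem_dualAnnihilator _).2 fun u hu => hg u ?_
    exact (Submodule.mem_dualCoannihilator _).1 hu _ (LinearMap.mem_range_self a u)
  obtain ⟨ψ, hψ⟩ := hmem
  exact ⟨ψ, fun u => by rw [hψ]⟩

end Forms

section Coordinates

variable {ι : Type*} [Fintype ι]

open Classical in
theorem NodalForm.apply_eq_sum_left (B : NodalForm ι) (u v : ι → ℝ) :
    B u v = ∑ i, u i * B (Pi.single i 1) v := by
  conv_lhs => rw [LinearMap.pi_apply_eq_sum_univ B u, LinearMap.sum_apply]
  refine Finset.sum_congr rfl fun i _ => ?_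
  rw [LinearMap.smul_apply, smul_eq_mul]
  congr 3
  funext j
  simp [Pi.single_apply, eq_comm]

open Classical in
theorem NodalForm.apply_eq_sum (B : NodalForm ι) (u v : ι → ℝ) :
    B u v = ∑ i, ∑ j, u i * v j * B (Pi.single i 1) (Pi.single j 1) := by
  rw [NodalForm.apply_eq_sum_left]
  refine Finset.sum_congr rfl fun i _ => ?_
  rw [LinearMap.pi_apply_eq_sum_univ (B _) v, Finset.mul_sum]
  refine Finset.sum_congr rfl fun j _ => ?_
  rw [smul_eq_mul, ← mul_assoc]
  congr 2
  funext l
  simp [Pi.single_apply, eq_comm]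

/-- Jensen's inequality for a semidefinite form: `B(∫v, ∫v) ≤ (b - a) ∫ B(v, v)`. -/
theorem NodalForm.integral_integral_le {B : NodalForm ι} (hs : ∀ u v, B u v = B v u)
    (hB : ∀ u, 0 ≤ B u u) {a b : ℝ} (hab : a ≤ b) {v : ℝ → ι → ℝ}
    (hv : ∀ i, IntervalIntegrable (fun τ => v τ i) volume a b)
    (hvv : IntervalIntegrable (fun τ => B (v τ) (v τ)) volume a b) :
    B (fun i => ∫ τ in a..b, v τ i) (fun i => ∫ τ in a..b, v τ i) ≤
      (b - a) * ∫ τ in a..b, B (v τ) (v τ) := by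
  rcases hab.eq_or_lt with rfl | hab
  · simp only [intervalIntegral.integral_same, sub_self, zero_mul]
    have : (fun _ : ι => (0 : ℝ)) = 0 := rfl
    simp [this]
  set w : ι → ℝ := fun i => ∫ τ in a..b, v τ i with hw
  classical
  have hlin := fun τ => NodalForm.apply_eq_sum_left B (v τ) w
  have hvw : IntervalIntegrable (fun τ => B (v τ) w) volume a b := by
    simp only [hlin]
    rw [← Finset.sum_fn]
    exact IntervalIntegrable.sum _ fun i _ => (hv i).mul_const _
  have e1 : ∫ τ in a..b, B (v τ) w = B w w := by
    simp only [hlin]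
    rw [intervalIntegral.integral_finsetSum fun i _ => (hv i).mul_const _]
    simp only [intervalIntegral.integral_mul_const]
    exact (NodalForm.apply_eq_sum_left B w w).symm
  have h0 : 0 ≤ ∫ τ in a..b, B ((b - a) • v τ - w) ((b - a) • v τ - w) :=
    intervalIntegral.integral_nonneg hab.le fun τ _ => hB _
  have e2 : ∀ τ, B ((b - a) • v τ - w) ((b - a) • v τ - w) =
      (b - a) ^ 2 * B (v τ) (v τ) - 2 * (b - a) * B (v τ) w + B w w := by
    intro τ
    simp only [map_sub, map_smul, LinearMap.sub_apply, LinearMap.smul_apply, smul_eq_mul,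
      hs w (v τ)]
    ring
  simp only [e2] at h0
  rw [intervalIntegral.integral_add ((hvv.const_mul _).sub (hvw.const_mul _)) (by simp),
    intervalIntegral.integral_sub (hvv.const_mul _) (hvw.const_mul _),
    intervalIntegral.integral_const_mul, intervalIntegral.integral_const_mul, e1,
    intervalIntegral.integral_const, smul_eq_mul] at h0
  have hpos : 0 < b - a := sub_pos.2 hab
  have : 0 ≤ (b - a) * ((b - a) * (∫ τ in a..b, B (v τ) (v τ)) - B w w) := by linarith
  have := nonneg_of_mul_nonneg_right this hpos
  linarith

end Coordinates

/-! ### Absolutely continuous functions -/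

theorem _root_.AbsolutelyContinuousOnInterval.congr_eqOn {f g : ℝ → ℝ} {a b : ℝ}
    (hf : AbsolutelyContinuousOnInterval f a b) (h : EqOn f g (uIcc a b)) :
    AbsolutelyContinuousOnInterval g a b := by
  rw [absolutelyContinuousOnInterval_iff] at hf ⊢
  intro ε hε
  obtain ⟨δ, hδ, H⟩ := hf ε hε
  refine ⟨δ, hδ, fun E hE hlt => ?_⟩
  convert H E hE hlt using 1
  refine Finset.sum_congr rfl fun i hi => ?_
  obtain ⟨h1, h2⟩ := hE.1 i hi
  rw [h h1, h h2]

theorem absolutelyContinuousOnInterval_const (x a b : ℝ) :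
    AbsolutelyContinuousOnInterval (fun _ => x) a b :=
  ((LipschitzWith.const x).lipschitzOnWith (s := uIcc a b)).absolutelyContinuousOnInterval

theorem absolutelyContinuousOnInterval_sum {ι : Type*} (s : Finset ι) {f : ι → ℝ → ℝ} {a b : ℝ}
    (h : ∀ i ∈ s, AbsolutelyContinuousOnInterval (f i) a b) :
    AbsolutelyContinuousOnInterval (fun t => ∑ i ∈ s, f i t) a b := by
  classical
  induction s using Finset.induction_on with
  | empty => simpa using absolutelyContinuousOnInterval_const 0 a b
  | insert i s hi ih =>
    simp only [Finset.sum_insert hi]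
    exact (h i (Finset.mem_insert_self i s)).fun_add
      (ih fun j hj => h j (Finset.mem_insert_of_mem hj))

theorem ae_Ioo_iff_uIoc {a b : ℝ} (hab : a ≤ b) {p : ℝ → Prop} :
    (∀ᵐ t ∂volume.restrict (Ioo a b), p t) ↔ ∀ᵐ t, t ∈ uIoc a b → p t := by
  rw [uIoc_of_le hab, Measure.restrict_congr_set (Ioo_ae_eq_Ioc (μ := volume) (a := a) (b := b)),
    ae_restrict_iff' measurableSet_Ioc]

/-- The fundamental theorem of calculus for an absolutely continuous function whose derivative is
known almost everywhere, on a subinterval. -/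
theorem _root_.AbsolutelyContinuousOnInterval.integral_eq_sub_of_ae_hasDerivAt {f g : ℝ → ℝ}
    {a b s t : ℝ} (hf : AbsolutelyContinuousOnInterval f a b)
    (hg : ∀ᵐ τ ∂volume.restrict (Ioo a b), HasDerivAt f (g τ) τ)
    (hs : s ∈ Icc a b) (ht : t ∈ Icc a b) (hst : s ≤ t) :
    IntervalIntegrable g volume s t ∧ ∫ τ in s..t, g τ = f t - f s := by
  have hab : a ≤ b := hs.1.trans hs.2
  have hsub : uIcc s t ⊆ uIcc a b := by
    rw [uIcc_of_le hst, uIcc_of_le hab]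
    exact Icc_subset_Icc hs.1 ht.2
  have hf' := hf.mono hsub
  rw [ae_Ioo_iff_uIoc hab] at hg
  have hae : ∀ᵐ τ, τ ∈ uIoc s t → deriv f τ = g τ := by
    filter_upwards [hg] with τ h hτ
    refine (h ?_).deriv
    rw [uIoc_of_le hab]
    rw [uIoc_of_le hst] at hτ
    exact ⟨hs.1.trans_lt hτ.1, hτ.2.trans ht.2⟩
  refine ⟨?_, ?_⟩
  · refine hf'.intervalIntegrable_deriv.congr_ae ?_
    exact (ae_restrict_iff' measurableSet_uIoc).2 hae
  · rw [← hf'.integral_deriv_eq_sub]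
    exact (intervalIntegral.integral_congr_ae hae).symm

/-- If `f` lies above `g` to the right of `t` and touches it at `t`, then `g'(t) ≤ f'(t)`. -/
theorem hasDerivAt_le_of_le_right {f g : ℝ → ℝ} {f' g' t : ℝ} (hf : HasDerivAt f f' t)
    (hg : HasDerivAt g g' t) (h : ∀ᶠ τ in nhdsWithin t (Ioi t), g τ ≤ f τ) (heq : f t = g t) :
    g' ≤ f' := by
  have h1 := (hasDerivWithinAt_iff_tendsto_slope' (notMem_Ioi.2 le_rfl)).1
    (hf.hasDerivWithinAt (s := Ioi t))
  have h2 := (hasDerivWithinAt_iff_tendsto_slope' (notMem_Ioi.2 le_rfl)).1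
    (hg.hasDerivWithinAt (s := Ioi t))
  refine le_of_tendsto_of_tendsto h2 h1 ?_
  filter_upwards [h, self_mem_nhdsWithin] with τ hτ (hτt : t < τ)
  simp only [slope_def_field]
  have : 0 < τ - t := sub_pos.2 hτt
  gcongr
  exact heq.le

/-- A weighted telescoping sum, in place of a discrete Gronwall inequality. -/
theorem sum_le_of_recursion {N : ℕ} {ρ : ℝ} (hρ : 1 ≤ ρ) {x p q : ℕ → ℝ}
    (hx : ∀ n ≤ N, 0 ≤ x n) (hp : ∀ n < N, 0 ≤ p n) (hq : ∀ n < N, 0 ≤ q n)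
    (h : ∀ n < N, x (n + 1) + p n ≤ ρ * x n + q n) :
    ∑ n ∈ Finset.range N, p n ≤ ρ ^ N * (x 0 + ∑ n ∈ Finset.range N, q n) := by
  suffices H : ∀ m ≤ N, x m + ∑ n ∈ Finset.range m, p n ≤
      ρ ^ m * (x 0 + ∑ n ∈ Finset.range m, q n) by
    have := H N le_rfl
    have := hx N le_rfl
    linarith
  intro m
  induction m with
  | zero => intro _; simp
  | succ m ih =>
    intro hm
    have h1 := ih (by omega)
    have h2 := h m (by omega)
    have hP : 0 ≤ ∑ n ∈ Finset.range m, p n :=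
      Finset.sum_nonneg fun n hn => hp n (by have := Finset.mem_range.1 hn; omega)
    have hqm := hq m (by omega)
    rw [Finset.sum_range_succ, Finset.sum_range_succ, pow_succ']
    have h3 : ρ * (x m + ∑ n ∈ Finset.range m, p n) ≤
        ρ * (ρ ^ m * (x 0 + ∑ n ∈ Finset.range m, q n)) := by gcongr
    have h4 : q m ≤ ρ * ρ ^ m * q m := by
      have : 1 ≤ ρ * ρ ^ m := by rw [← pow_succ']; exact one_le_pow₀ hρ
      nlinarith
    nlinarith

/-! ### Evolving forms -/

theorem exp_sub_one_le_mul_exp (x : ℝ) : Real.exp x - 1 ≤ x * Real.exp x := by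
  have h := Real.add_one_le_exp (-x)
  have h2 : Real.exp (-x) * Real.exp x = 1 := by rw [← Real.exp_add]; simp
  nlinarith [Real.exp_pos x]

theorem abs_sub_le_of_exp_growth {p q x : ℝ} (hq : 0 ≤ q)
    (h1 : p ≤ Real.exp x * q) (h2 : q ≤ Real.exp x * p) :
    |p - q| ≤ (Real.exp x - 1) * q := by
  have e2 : Real.exp (-x) * Real.exp x = 1 := by rw [← Real.exp_add]; simp
  have h3 := Real.exp_pos x
  have h4 := Real.exp_pos (-x)
  rw [abs_le]
  constructor
  · have : Real.exp (-x) * q ≤ p := by nlinarith [mul_le_mul_of_nonneg_left h2 h4.le]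
    nlinarith [mul_nonneg (mul_nonneg hq h4.le) (sq_nonneg (Real.exp x - 1))]
  · linarith

/-- A family of semidefinite symmetric forms on nodal values, indexed by the times `t ∈ [0,T]`,
that grows at most exponentially in time (forwards and backwards) with rate `c`. -/
structure EvolvingForm {ι : Type*} (T c : ℝ) (B : ℝ → NodalForm ι) : Prop where
  T_pos : 0 < T
  c_nonneg : 0 ≤ c
  symm : ∀ t ∈ Icc 0 T, ∀ u v, B t u v = B t v u
  nonneg : ∀ t ∈ Icc 0 T, ∀ u, 0 ≤ B t u u
  growth : ∀ s ∈ Icc 0 T, ∀ t ∈ Icc 0 T, ∀ u, B t u u ≤ Real.exp (c * |t - s|) * B s u u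

namespace EvolvingForm

variable {ι : Type*} {T c : ℝ} {B : ℝ → NodalForm ι}

section

variable (P : EvolvingForm T c B)
include P

theorem one_le_exp : 1 ≤ Real.exp (c * T) :=
  Real.one_le_exp (mul_nonneg P.c_nonneg P.T_pos.le)

theorem exp_mul_le {s t : ℝ} (hs : s ∈ Icc 0 T) (ht : t ∈ Icc 0 T) :
    Real.exp (c * |t - s|) ≤ Real.exp (c * T) := by
  refine Real.exp_le_exp.2 (mul_le_mul_of_nonneg_left ?_ P.c_nonneg)
  rw [abs_le]
  constructor <;> linarith [hs.1, hs.2, ht.1, ht.2]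

theorem exp_sub_one_le {s t : ℝ} (hs : s ∈ Icc 0 T) (ht : t ∈ Icc 0 T) :
    Real.exp (c * |t - s|) - 1 ≤ c * |t - s| * Real.exp (c * T) :=
  (exp_sub_one_le_mul_exp _).trans (mul_le_mul_of_nonneg_left (P.exp_mul_le hs ht)
    (mul_nonneg P.c_nonneg (abs_nonneg _)))

theorem apply_le {s t : ℝ} (hs : s ∈ Icc 0 T) (ht : t ∈ Icc 0 T) (u : ι → ℝ) :
    B t u u ≤ Real.exp (c * T) * B s u u :=
  (P.growth s hs t ht u).trans
    (mul_le_mul_of_nonneg_right (P.exp_mul_le hs ht) (P.nonneg s hs u))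

theorem abs_apply_le {t : ℝ} (ht : t ∈ Icc 0 T) (u v : ι → ℝ) :
    |B t u v| ≤ √(B t u u) * √(B t v v) :=
  abs_apply_le_sqrt_mul_sqrt (P.symm t ht) (P.nonneg t ht) u v

theorem abs_sub_le {s t : ℝ} (hs : s ∈ Icc 0 T) (ht : t ∈ Icc 0 T) (u v : ι → ℝ) :
    |B t u v - B s u v| ≤ (Real.exp (c * |t - s|) - 1) * (√(B s u u) * √(B s v v)) := by
  have h := abs_apply_le_of_symm (B := B s) (D := B t - B s) (ε := Real.exp (c * |t - s|) - 1)
    (sub_nonneg.2 (Real.one_le_exp (mul_nonneg P.c_nonneg (abs_nonneg _))))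
    (fun u v => by simp [P.symm t ht u v, P.symm s hs u v]) (P.nonneg s hs)
    (fun u => abs_sub_le_of_exp_growth (P.nonneg s hs u) (P.growth s hs t ht u)
      (by simpa only [abs_sub_comm t s] using P.growth t ht s hs u)) u v
  simpa using h

theorem lipschitzOn (u v : ι → ℝ) : ∃ K, LipschitzOnWith K (fun t => B t u v) (Icc 0 T) := by
  have h0 : (0 : ℝ) ∈ Icc 0 T := ⟨le_rfl, P.T_pos.le⟩
  refine ⟨Real.toNNReal (c * Real.exp (c * T) *
      (√(Real.exp (c * T) * B 0 u u) * √(Real.exp (c * T) * B 0 v v))),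
    LipschitzOnWith.of_dist_le' fun t ht s hs => ?_⟩
  rw [Real.dist_eq, Real.dist_eq]
  refine (P.abs_sub_le hs ht u v).trans ?_
  have h1 := P.exp_sub_one_le hs ht
  have h2 := Real.sqrt_le_sqrt (P.apply_le h0 hs u)
  have h3 := Real.sqrt_le_sqrt (P.apply_le h0 hs v)
  have hc := P.c_nonneg
  calc _ ≤ (c * |t - s| * Real.exp (c * T)) *
        (√(Real.exp (c * T) * B 0 u u) * √(Real.exp (c * T) * B 0 v v)) := by gcongr
    _ = _ := by ring

theorem continuousOn_apply [Fintype ι] {u v : ℝ → ι → ℝ}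
    (hu : ∀ i, ContinuousOn (fun t => u t i) (Icc 0 T))
    (hv : ∀ i, ContinuousOn (fun t => v t i) (Icc 0 T)) :
    ContinuousOn (fun t => B t (u t) (v t)) (Icc 0 T) := by
  classical
  simp only [fun t => NodalForm.apply_eq_sum (B t) (u t) (v t)]
  refine continuousOn_finsetSum _ fun i _ => continuousOn_finsetSum _ fun j _ => ?_
  obtain ⟨K, hK⟩ := P.lipschitzOn (Pi.single i 1) (Pi.single j 1)
  exact ((hu i).mul (hv j)).mul hK.continuousOn

theorem absolutelyContinuous_apply [Fintype ι] {u v : ℝ → ι → ℝ}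
    (hu : ∀ i, AbsolutelyContinuousOnInterval (fun t => u t i) 0 T)
    (hv : ∀ i, AbsolutelyContinuousOnInterval (fun t => v t i) 0 T) :
    AbsolutelyContinuousOnInterval (fun t => B t (u t) (v t)) 0 T := by
  classical
  simp only [fun t => NodalForm.apply_eq_sum (B t) (u t) (v t)]
  refine absolutelyContinuousOnInterval_sum _ fun i _ =>
    absolutelyContinuousOnInterval_sum _ fun j _ => ?_
  obtain ⟨K, hK⟩ := P.lipschitzOn (Pi.single i 1) (Pi.single j 1)
  refine ((hu i).fun_mul (hv j)).fun_mul
    (LipschitzOnWith.absolutelyContinuousOnInterval (K := K) ?_)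
  rwa [uIcc_of_le P.T_pos.le]

theorem integrableOn_apply [Fintype ι] {v : ℝ → ι → ℝ}
    (hv : ∀ i, MemLp (fun t => v t i) 2 (volume.restrict (Icc 0 T))) :
    IntegrableOn (fun t => B t (v t) (v t)) (Icc 0 T) := by
  classical
  simp only [fun t => NodalForm.apply_eq_sum (B t) (v t) (v t)]
  refine integrable_finsetSum _ fun i _ => integrable_finsetSum _ fun j _ => ?_
  obtain ⟨K, hK⟩ := P.lipschitzOn (Pi.single i 1) (Pi.single j 1)
  exact IntegrableOn.mul_continuousOn ((hv i).integrable_mul (hv j)) hK.continuousOn isCompact_Icc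

end

end EvolvingForm

/-! ### Stability of the semidiscrete problem -/

/-- A right-hand side for the abstract problems: `G s t φ` is the load at time `t`, tested with the
function of nodal values `φ` on the surface at time `s`. It is dominated by `β t`, the norm of the
load, and depends on `s` in a Lipschitz way. -/
structure EvolvingLoad {ι : Type*} (T c : ℝ) (m : ℝ → NodalForm ι) (G : ℝ → ℝ → (ι → ℝ) → ℝ)
    (β : ℝ → ℝ) : Prop where
  nonneg : ∀ t, 0 ≤ β t
  integrable_sq : IntegrableOn (fun t => β t ^ 2) (Icc 0 T)
  integrable : ∀ s ∈ Icc 0 T, ∀ φ, IntegrableOn (fun t => G s t φ) (Icc 0 T)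
  integrable_diag : ∀ φ, IntegrableOn (fun t => G t t φ) (Icc 0 T)
  bound : ∀ᵐ t ∂volume.restrict (Icc 0 T), ∀ φ, |G t t φ| ≤ β t * √(m t φ φ)
  bound_sub : ∀ᵐ t ∂volume.restrict (Icc 0 T), ∀ s ∈ Icc 0 T, ∀ φ,
    |G s t φ - G t t φ| ≤ (Real.exp (c * |t - s|) - 1) * (β t * √(m t φ φ))

/-- `y` solves the semidiscrete problem with mass form `m`, energy form `a` and load `G`. The field
`energy` is the equation tested with `y` itself. -/
structure IsSemidiscreteSolution {ι : Type*} (T : ℝ) (m a : ℝ → NodalForm ι)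
    (G : ℝ → ℝ → (ι → ℝ) → ℝ) (y y' : ℝ → ι → ℝ) : Prop where
  memLp : ∀ i, MemLp (fun t => y' t i) 2 (volume.restrict (Icc 0 T))
  eq_add_integral : ∀ i, ∀ t ∈ Icc 0 T, y t i = y 0 i + ∫ τ in (0 : ℝ)..t, y' τ i
  test : ∀ φ, ∀ᵐ t ∂volume.restrict (Ioo 0 T),
    HasDerivAt (fun τ => m τ (y τ) φ) (G t t φ - a t (y t) φ) t
  energy : ∀ᵐ t ∂volume.restrict (Ioo 0 T), ∃ D : ℝ,
    HasDerivAt (fun τ => m τ (y τ) (y τ)) D t ∧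
      D + a t (y t) (y t) = m t (y' t) (y t) + G t t (y t)

theorem intervalIntegrable_of_integrableOn_Icc {T s t : ℝ} {g : ℝ → ℝ}
    (h : IntegrableOn g (Icc 0 T)) (hs : s ∈ Icc 0 T) (ht : t ∈ Icc 0 T) :
    IntervalIntegrable g volume s t :=
  (h.mono_set (uIcc_subset_Icc hs ht)).intervalIntegrable

namespace IsSemidiscreteSolution

variable {ι : Type*} {T c : ℝ} {m a : ℝ → NodalForm ι}
  {G : ℝ → ℝ → (ι → ℝ) → ℝ} {β : ℝ → ℝ} {y y' : ℝ → ι → ℝ}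

theorem integrable_deriv (hy : IsSemidiscreteSolution T m a G y y') (i : ι) :
    IntegrableOn (fun t => y' t i) (Icc 0 T) :=
  (hy.memLp i).integrable (by norm_num)

theorem absolutelyContinuous (hy : IsSemidiscreteSolution T m a G y y') (hT : 0 < T) (i : ι) :
    AbsolutelyContinuousOnInterval (fun t => y t i) 0 T := by
  have h0 : (0 : ℝ) ∈ Icc 0 T := ⟨le_rfl, hT.le⟩
  have hI := intervalIntegrable_of_integrableOn_Icc (hy.integrable_deriv i) h0
    (⟨hT.le, le_rfl⟩ : T ∈ Icc 0 T)
  refine ((absolutelyContinuousOnInterval_const (y 0 i) 0 T).fun_add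
    (hI.absolutelyContinuousOnInterval_intervalIntegral left_mem_uIcc)).congr_eqOn ?_
  intro t ht
  rw [uIcc_of_le hT.le] at ht
  exact (hy.eq_add_integral i t ht).symm

theorem continuousOn (hy : IsSemidiscreteSolution T m a G y y') (hT : 0 < T) (i : ι) :
    ContinuousOn (fun t => y t i) (Icc 0 T) := by
  have := (hy.absolutelyContinuous hT i).continuousOn
  rwa [uIcc_of_le hT.le] at this

theorem sub_eq_integral (hy : IsSemidiscreteSolution T m a G y y') {s t : ℝ}
    (hs : s ∈ Icc 0 T) (ht : t ∈ Icc 0 T) :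
    y t - y s = fun i => ∫ τ in s..t, y' τ i := by
  have h0 : (0 : ℝ) ∈ Icc 0 T := ⟨le_rfl, hs.1.trans hs.2⟩
  funext i
  have hi := hy.integrable_deriv i
  rw [Pi.sub_apply, hy.eq_add_integral i t ht, hy.eq_add_integral i s hs,
    ← intervalIntegral.integral_interval_sub_left (intervalIntegrable_of_integrableOn_Icc hi h0 ht)
      (intervalIntegrable_of_integrableOn_Icc hi h0 hs)]
  ring

theorem ae_hasDerivAt (hy : IsSemidiscreteSolution T m a G y y') (hT : 0 < T) (i : ι) :
    ∀ᵐ t ∂volume.restrict (Ioo 0 T), HasDerivAt (fun τ => y τ i) (y' t i) t := by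
  have h0 : (0 : ℝ) ∈ Icc 0 T := ⟨le_rfl, hT.le⟩
  have hI := intervalIntegrable_of_integrableOn_Icc (hy.integrable_deriv i) h0
    (⟨hT.le, le_rfl⟩ : T ∈ Icc 0 T)
  rw [ae_restrict_iff' measurableSet_Ioo]
  filter_upwards [hI.ae_hasDerivAt_integral] with t ht htT
  have hmem : t ∈ uIcc 0 T := by rw [uIcc_of_le hT.le]; exact Ioo_subset_Icc_self htT
  refine ((ht hmem 0 left_mem_uIcc).const_add (y 0 i)).congr_of_eventuallyEq ?_
  filter_upwards [Ioo_mem_nhds htT.1 htT.2] with τ hτ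
  exact hy.eq_add_integral i τ (Ioo_subset_Icc_self hτ)

variable [Fintype ι]

theorem energy_deriv_ge (hy : IsSemidiscreteSolution T m a G y y') (hm : EvolvingForm T c m) :
    ∀ᵐ t ∂volume.restrict (Ioo 0 T), ∀ D, HasDerivAt (fun τ => m τ (y τ) (y τ)) D t →
      2 * m t (y' t) (y t) - c * m t (y t) (y t) ≤ D := by
  classical
  have h1 : ∀ᵐ t ∂volume.restrict (Ioo 0 T), ∀ i, HasDerivAt (fun τ => y τ i) (y' t i) t :=
    ae_all_iff.2 fun i => hy.ae_hasDerivAt hm.T_pos i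
  filter_upwards [h1, ae_restrict_mem measurableSet_Ioo] with t ht htT D hD
  have htI := Ioo_subset_Icc_self htT
  have hq : HasDerivAt (fun τ => m t (y τ) (y τ)) (2 * m t (y' t) (y t)) t := by
    simp only [fun τ => NodalForm.apply_eq_sum (m t) (y τ) (y τ)]
    have h2 := HasDerivAt.fun_sum (u := Finset.univ) fun i (_ : i ∈ Finset.univ) =>
      HasDerivAt.fun_sum (u := Finset.univ) fun j (_ : j ∈ Finset.univ) =>
        (((ht i).mul (ht j)).mul_const (m t (Pi.single i 1) (Pi.single j 1)))
    refine h2.congr_deriv ?_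
    have e1 := NodalForm.apply_eq_sum (m t) (y' t) (y t)
    have e2 := NodalForm.apply_eq_sum (m t) (y t) (y' t)
    rw [two_mul]
    nth_rewrite 2 [hm.symm t htI]
    rw [e1, e2, ← Finset.sum_add_distrib]
    refine Finset.sum_congr rfl fun i _ => ?_
    rw [← Finset.sum_add_distrib]
    exact Finset.sum_congr rfl fun j _ => by ring
  have he : HasDerivAt (fun τ => Real.exp (-(c * (τ - t)))) (-c) t := by
    have := ((((hasDerivAt_id t).sub_const t).const_mul c).neg).exp
    simpa using this
  have hg := he.mul hq
  simp only [sub_self, mul_zero, neg_zero, Real.exp_zero, one_mul] at hg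
  have := hasDerivAt_le_of_le_right hD hg ?_ (by simp)
  · linarith
  · have hmem : Ioo t T ∈ nhdsWithin t (Ioi t) := Ioo_mem_nhdsGT htT.2
    filter_upwards [hmem] with τ hτ
    have hτI : τ ∈ Icc 0 T := ⟨(htT.1.trans hτ.1).le, hτ.2.le⟩
    have h3 := hm.growth τ hτI t htI (y τ)
    rw [abs_sub_comm, abs_of_pos (sub_pos.2 hτ.1)] at h3
    rw [Pi.mul_apply, Real.exp_neg, inv_mul_le_iff₀ (Real.exp_pos _)]
    exact h3

/-- The energy estimate for the semidiscrete problem. -/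
theorem integral_energy_le (hy : IsSemidiscreteSolution T m a G y y') (hm : EvolvingForm T c m)
    (ha : EvolvingForm T c a) (hma : ∀ t ∈ Icc 0 T, ∀ u, m t u u ≤ a t u u)
    (hG : EvolvingLoad T c m G β) :
    ∫ t in (0 : ℝ)..T, a t (y t) (y t) ≤
      Real.exp (c * T) * (m 0 (y 0) (y 0) + ∫ t in (0 : ℝ)..T, β t ^ 2) := by
  have hT := hm.T_pos
  have h0 : (0 : ℝ) ∈ Icc 0 T := ⟨le_rfl, hT.le⟩
  have hT' : T ∈ Icc 0 T := ⟨hT.le, le_rfl⟩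
  set E : ℝ → ℝ := fun t => m t (y t) (y t) with hE
  have hEac : AbsolutelyContinuousOnInterval E 0 T :=
    hm.absolutelyContinuous_apply (fun i => hy.absolutelyContinuous hT i)
      (fun i => hy.absolutelyContinuous hT i)
  set w : ℝ → ℝ := fun t => Real.exp (-(c * t)) with hw
  have hwd : ∀ t, HasDerivAt w (w t * -c) t := fun t => by
    have := (((hasDerivAt_id t).const_mul c).neg).exp
    simpa [hw] using this
  have hwac : AbsolutelyContinuousOnInterval w 0 T := by
    refine ContDiffOn.absolutelyContinuousOnInterval (ContDiff.contDiffOn ?_)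
    simp only [hw]
    fun_prop
  have hwc : Continuous w := by simp only [hw]; fun_prop
  have hac := hwac.fun_mul hEac
  have hder : ∀ᵐ t ∂volume.restrict (Ioo 0 T),
      HasDerivAt (fun t => w t * E t) (deriv (fun t => w t * E t) t) t ∧
      deriv (fun t => w t * E t) t ≤ w t * (β t ^ 2 - a t (y t) (y t)) := by
    have hb : ∀ᵐ t ∂volume.restrict (Ioo 0 T), ∀ φ, |G t t φ| ≤ β t * √(m t φ φ) :=
      ae_restrict_of_ae_restrict_of_subset Ioo_subset_Icc_self hG.bound
    filter_upwards [hy.energy, hy.energy_deriv_ge hm, hb, ae_restrict_mem measurableSet_Ioo]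
      with t ⟨D, hD, hDe⟩ hge hbt htT
    have htI := Ioo_subset_Icc_self htT
    have hd := (hwd t).mul hD
    have hd' : HasDerivAt (fun t => w t * E t) (w t * -c * E t + w t * D) t := hd
    rw [hd'.deriv]
    refine ⟨hd', ?_⟩
    have h1 := hge D hD
    have h2 := (abs_le.1 (hbt (y t))).2
    have h3 : 2 * (β t * √(m t (y t) (y t))) ≤ β t ^ 2 + m t (y t) (y t) := by
      have := two_mul_le_add_sq (β t) (√(m t (y t) (y t)))
      rw [Real.sq_sqrt (hm.nonneg t htI _)] at this
      linarith
    have h4 := hma t htI (y t)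
    have h5 : D ≤ c * E t + (β t ^ 2 - a t (y t) (y t)) := by
      simp only [hE]
      linarith
    have h6 : 0 < w t := Real.exp_pos _
    nlinarith
  have hac' : IntegrableOn (fun t => a t (y t) (y t)) (Icc 0 T) :=
    (ha.continuousOn_apply (fun i => hy.continuousOn hT i)
      (fun i => hy.continuousOn hT i)).integrableOn_Icc
  obtain ⟨hi1, hi2⟩ := hac.integral_eq_sub_of_ae_hasDerivAt (hder.mono fun t h => h.1) h0 hT' hT.le
  have hiβ := intervalIntegrable_of_integrableOn_Icc hG.integrable_sq h0 hT'
  have hia := intervalIntegrable_of_integrableOn_Icc hac' h0 hT'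
  have hmono := intervalIntegral.integral_mono_ae_restrict hT.le hi1
    ((hiβ.sub hia).continuousOn_mul hwc.continuousOn)
    (by
      rw [Filter.EventuallyLE, ← Measure.restrict_congr_set (Ioo_ae_eq_Icc (μ := volume))]
      exact hder.mono fun t h => h.2)
  have hET : 0 ≤ w T * E T := mul_nonneg (Real.exp_pos _).le (hm.nonneg T hT' _)
  have hw0 : w 0 = 1 := by simp [hw]
  rw [hi2, hw0, one_mul] at hmono
  have hwle : ∀ t ∈ Icc 0 T, w t ≤ 1 := fun t ht => by
    simp only [hw]
    exact Real.exp_le_one_iff.2 (neg_nonpos.2 (mul_nonneg hm.c_nonneg ht.1))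
  have hwge : ∀ t ∈ Icc 0 T, 1 ≤ Real.exp (c * T) * w t := fun t ht => by
    simp only [hw]
    rw [← Real.exp_add]
    refine Real.one_le_exp ?_
    have := mul_le_mul_of_nonneg_left ht.2 hm.c_nonneg
    linarith
  have hs : ∫ t in (0 : ℝ)..T, w t * (β t ^ 2 - a t (y t) (y t)) =
      (∫ t in (0 : ℝ)..T, w t * β t ^ 2) - ∫ t in (0 : ℝ)..T, w t * a t (y t) (y t) := by
    rw [← intervalIntegral.integral_sub (hiβ.continuousOn_mul hwc.continuousOn)
      (hia.continuousOn_mul hwc.continuousOn)]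
    exact intervalIntegral.integral_congr fun t _ => by ring
  have hβ' : ∫ t in (0 : ℝ)..T, w t * β t ^ 2 ≤ ∫ t in (0 : ℝ)..T, β t ^ 2 :=
    intervalIntegral.integral_mono_on hT.le (hiβ.continuousOn_mul hwc.continuousOn) hiβ
      fun t ht => by nlinarith [hwle t ht, sq_nonneg (β t)]
  have hA : ∫ t in (0 : ℝ)..T, a t (y t) (y t) ≤
      ∫ t in (0 : ℝ)..T, Real.exp (c * T) * (w t * a t (y t) (y t)) :=
    intervalIntegral.integral_mono_on hT.le hia
      ((hia.continuousOn_mul hwc.continuousOn).const_mul _)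
      fun t ht => by nlinarith [hwge t ht, ha.nonneg t ht (y t)]
  rw [intervalIntegral.integral_const_mul] at hA
  refine hA.trans (mul_le_mul_of_nonneg_left ?_ (Real.exp_pos _).le)
  linarith

end IsSemidiscreteSolution

/-! ### Stability of the implicit Euler scheme -/

/-- `Y` solves the implicit Euler scheme with `N` steps of length `k` for the mass form `m`, the
perturbed energy form `a + rem` and the load `G`. -/
def IsEulerSolution {ι : Type*} (k : ℝ) (N : ℕ) (m a : ℝ → NodalForm ι)
    (rem : ℕ → (ι → ℝ) → (ι → ℝ) → ℝ) (G : ℝ → ℝ → (ι → ℝ) → ℝ) (Y : ℕ → ι → ℝ) : Prop :=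
  ∀ n < N, ∀ φ : ι → ℝ,
    m ((n + 1 : ℕ) * k) (Y (n + 1)) φ - m (n * k) (Y n) φ +
      k * (a ((n + 1 : ℕ) * k) (Y (n + 1)) φ + rem (n + 1) (Y (n + 1)) φ) =
    ∫ t in (n * k)..((n + 1 : ℕ) * k), G ((n + 1 : ℕ) * k) t φ

theorem EvolvingForm.sqrt_apply_le {ι : Type*} {T c : ℝ} {B : ℝ → NodalForm ι}
    (P : EvolvingForm T c B) {s t : ℝ} (hs : s ∈ Icc 0 T) (ht : t ∈ Icc 0 T) (u : ι → ℝ) :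
    √(B t u u) ≤ Real.exp (c * T) * √(B s u u) := by
  refine (Real.sqrt_le_sqrt (P.apply_le hs ht u)).trans ?_
  rw [Real.sqrt_mul (Real.exp_pos _).le]
  refine mul_le_mul_of_nonneg_right ?_ (Real.sqrt_nonneg _)
  rw [Real.sqrt_le_left (Real.exp_pos _).le]
  nlinarith [P.one_le_exp]

theorem EvolvingForm.apply_le_half_add {ι : Type*} {T c : ℝ} {B : ℝ → NodalForm ι}
    (P : EvolvingForm T c B) {s t : ℝ} (hs : s ∈ Icc 0 T) (ht : t ∈ Icc 0 T) (hst : s ≤ t)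
    (u v : ι → ℝ) :
    B s u v ≤ (Real.exp (c * (t - s)) * B s u u + B t v v) / 2 := by
  have h1 := (abs_le.1 (P.abs_apply_le hs u v)).2
  have h2 := P.growth t ht s hs v
  rw [abs_sub_comm, abs_of_nonneg (sub_nonneg.2 hst)] at h2
  set x := Real.exp (c * (t - s))
  have hx : 0 ≤ x := (Real.exp_pos _).le
  have h3 : √(B s u u) * √(B s v v) ≤ √(x * B s u u) * √(B t v v) := by
    rw [← Real.sqrt_mul (P.nonneg s hs u), ← Real.sqrt_mul (mul_nonneg hx (P.nonneg s hs u))]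
    refine Real.sqrt_le_sqrt ?_
    have := mul_le_mul_of_nonneg_left h2 (P.nonneg s hs u)
    linarith
  have h4 := two_mul_le_add_sq (√(x * B s u u)) (√(B t v v))
  rw [Real.sq_sqrt (mul_nonneg hx (P.nonneg s hs u)), Real.sq_sqrt (P.nonneg t ht v)] at h4
  linarith

theorem EvolvingLoad.abs_le {ι : Type*} {T c : ℝ} {m : ℝ → NodalForm ι}
    {G : ℝ → ℝ → (ι → ℝ) → ℝ} {β : ℝ → ℝ} (hG : EvolvingLoad T c m G β)
    (hm : EvolvingForm T c m) :
    ∀ᵐ t ∂volume.restrict (Icc 0 T), ∀ s ∈ Icc 0 T, ∀ φ,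
      |G s t φ| ≤ Real.exp (c * T) ^ 2 * (β t * √(m s φ φ)) := by
  filter_upwards [hG.bound, hG.bound_sub, ae_restrict_mem measurableSet_Icc] with t h1 h2 ht s hs φ
  have h3 := (abs_add_le (G s t φ - G t t φ) (G t t φ)).trans (add_le_add (h2 s hs φ) (h1 φ))
  rw [sub_add_cancel] at h3
  have h4 := hm.sqrt_apply_le hs ht φ
  have h5 := hm.exp_mul_le hs ht
  have hβ := hG.nonneg t
  calc _ ≤ Real.exp (c * |t - s|) * (β t * √(m t φ φ)) := by linarith
    _ ≤ Real.exp (c * T) * (β t * (Real.exp (c * T) * √(m s φ φ))) := by gcongr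
    _ = _ := by ring

section Euler

variable {ι : Type*} {T c k cr : ℝ} {N : ℕ} {m a : ℝ → NodalForm ι}
  {rem : ℕ → (ι → ℝ) → (ι → ℝ) → ℝ} {G : ℝ → ℝ → (ι → ℝ) → ℝ} {β : ℝ → ℝ}
  {Y : ℕ → ι → ℝ}

theorem grid_mem (hk : 0 ≤ k) (hNk : N * k = T) {n : ℕ} (hn : n ≤ N) :
    (n : ℝ) * k ∈ Icc 0 T := by
  refine ⟨by positivity, ?_⟩
  rw [← hNk]
  gcongr

theorem grid_le (hk : 0 ≤ k) (n : ℕ) : (n : ℝ) * k ≤ ((n + 1 : ℕ) : ℝ) * k := by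
  gcongr
  simp

theorem grid_sub (n : ℕ) : ((n + 1 : ℕ) : ℝ) * k - n * k = k := by push_cast; ring

theorem sum_integral_grid (hk : 0 ≤ k) (hNk : N * k = T) {g : ℝ → ℝ}
    (hg : IntegrableOn g (Icc 0 T)) :
    ∑ n ∈ Finset.range N, ∫ t in (n * k)..((n + 1 : ℕ) * k), g t = ∫ t in (0 : ℝ)..T, g t := by
  have := intervalIntegral.sum_integral_adjacent_intervals (f := g) (μ := volume)
    (a := fun n : ℕ => (n : ℝ) * k) (n := N) fun n hn =>
      intervalIntegrable_of_integrableOn_Icc hg (grid_mem hk hNk hn.le) (grid_mem hk hNk hn)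
  simpa [hNk] using this

theorem ae_grid (hk : 0 ≤ k) (hNk : N * k = T) {n : ℕ} (hn : n < N) {p : ℝ → Prop}
    (h : ∀ᵐ t ∂volume.restrict (Icc 0 T), p t) :
    ∀ᵐ t ∂volume.restrict (Icc ((n : ℝ) * k) ((n + 1 : ℕ) * k)), p t :=
  ae_restrict_of_ae_restrict_of_subset
    (Icc_subset_Icc (grid_mem hk hNk hn.le).1 (grid_mem hk hNk hn).2) h

theorem exp_mul_pow (hNk : N * k = T) : Real.exp (c * k) ^ N = Real.exp (c * T) := by
  rw [← Real.exp_nat_mul, ← hNk]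
  ring_nf

theorem euler_energy_step (hm : EvolvingForm T c m) (ha : EvolvingForm T c a)
    (hma : ∀ t ∈ Icc 0 T, ∀ u, m t u u ≤ a t u u) (hG : EvolvingLoad T c m G β)
    (hk : 0 < k) (hNk : N * k = T) (hkr : cr * k ≤ 1 / 2)
    (hrem : ∀ n, 1 ≤ n → n ≤ N → ∀ ψ φ, |rem n ψ φ| ≤
      cr * k * √(a (n * k) ψ ψ) * √(a (n * k) φ φ))
    (hY : IsEulerSolution k N m a rem G Y) {n : ℕ} (hn : n < N) :
    m ((n + 1 : ℕ) * k) (Y (n + 1)) (Y (n + 1)) +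
      k / 2 * a ((n + 1 : ℕ) * k) (Y (n + 1)) (Y (n + 1)) ≤
    Real.exp (c * k) * m (n * k) (Y n) (Y n) +
      2 * Real.exp (c * T) ^ 4 * ∫ t in (n * k)..((n + 1 : ℕ) * k), β t ^ 2 := by
  have h := hY n hn (Y (n + 1))
  have hs := grid_mem hk.le hNk hn.le
  have ht := grid_mem hk.le hNk (Nat.succ_le_of_lt hn)
  have hle := grid_le hk.le n
  have hsub := grid_sub (k := k) n
  set s : ℝ := (n : ℝ) * k
  set t : ℝ := ((n + 1 : ℕ) : ℝ) * k with htdef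
  set u := Y (n + 1)
  set K := Real.exp (c * T)
  have hann := ha.nonneg t ht u
  have h1 := hm.apply_le_half_add hs ht hle (Y n) u
  rw [hsub] at h1
  have h2 := (abs_le.1 (hrem (n + 1) (by omega) hn u u)).1
  rw [mul_assoc, Real.mul_self_sqrt hann] at h2
  have h3 : cr * k * a t u u ≤ 1 / 2 * a t u u := by gcongr
  have hi1 := intervalIntegrable_of_integrableOn_Icc (hG.integrable t ht u) hs ht
  have hi2 := intervalIntegrable_of_integrableOn_Icc hG.integrable_sq hs ht
  have h4 : ∫ τ in s..t, G t τ u ≤ ∫ τ in s..t, (K ^ 4 * β τ ^ 2 + 1 / 4 * a t u u) := by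
    refine intervalIntegral.integral_mono_ae_restrict hle hi1
      ((hi2.const_mul _).add (by simp)) ?_
    filter_upwards [ae_grid hk.le hNk hn (hG.abs_le hm)] with τ hτ
    have h5 := (abs_le.1 (hτ t ht u)).2
    have h6 := two_mul_le_add_sq (K ^ 2 * β τ) (1 / 2 * √(m t u u))
    rw [mul_pow, mul_pow, Real.sq_sqrt (hm.nonneg t ht u)] at h6
    have := hma t ht u
    nlinarith
  rw [intervalIntegral.integral_add (hi2.const_mul _) (by simp),
    intervalIntegral.integral_const_mul, intervalIntegral.integral_const, hsub, smul_eq_mul] at h4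
  have h7 : k * (-(1 / 2 * a t u u)) ≤ k * rem (n + 1) u u := by
    refine mul_le_mul_of_nonneg_left ?_ hk.le
    linarith
  nlinarith

/-- The energy estimate for the implicit Euler scheme; the step size need not be small against the
growth rate of the forms. -/
theorem euler_energy_le (hm : EvolvingForm T c m) (ha : EvolvingForm T c a)
    (hma : ∀ t ∈ Icc 0 T, ∀ u, m t u u ≤ a t u u) (hG : EvolvingLoad T c m G β)
    (hk : 0 < k) (hNk : N * k = T) (hkr : cr * k ≤ 1 / 2)
    (hrem : ∀ n, 1 ≤ n → n ≤ N → ∀ ψ φ, |rem n ψ φ| ≤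
      cr * k * √(a (n * k) ψ ψ) * √(a (n * k) φ φ))
    (hY : IsEulerSolution k N m a rem G Y) :
    ∑ n ∈ Finset.range N, k * a ((n + 1 : ℕ) * k) (Y (n + 1)) (Y (n + 1)) ≤
      2 * Real.exp (c * T) * (m 0 (Y 0) (Y 0) +
        2 * Real.exp (c * T) ^ 4 * ∫ t in (0 : ℝ)..T, β t ^ 2) := by
  have h := sum_le_of_recursion (N := N) (ρ := Real.exp (c * k))
    (Real.one_le_exp (mul_nonneg hm.c_nonneg hk.le))
    (x := fun n => m (n * k) (Y n) (Y n))
    (p := fun n => k / 2 * a ((n + 1 : ℕ) * k) (Y (n + 1)) (Y (n + 1)))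
    (q := fun n => 2 * Real.exp (c * T) ^ 4 * ∫ t in (n * k)..((n + 1 : ℕ) * k), β t ^ 2)
    (fun n hn => hm.nonneg _ (grid_mem hk.le hNk hn) _)
    (fun n hn => mul_nonneg (by linarith) (ha.nonneg _ (grid_mem hk.le hNk hn) _))
    (fun n hn => mul_nonneg (by positivity)
      (intervalIntegral.integral_nonneg (grid_le hk.le n) fun t _ => sq_nonneg _))
    (fun n hn => euler_energy_step hm ha hma hG hk hNk hkr hrem hY hn)
  rw [exp_mul_pow hNk, ← Finset.mul_sum, ← Finset.mul_sum,
    sum_integral_grid hk.le hNk hG.integrable_sq] at h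
  rw [← Finset.mul_sum]
  simp only [Nat.cast_zero, zero_mul] at h
  linarith

variable [Fintype ι] {y y' : ℝ → ι → ℝ}

/-- The increment of the semidiscrete solution over a time step. -/
theorem apply_sub_grid_le (hm : EvolvingForm T c m) (hk : 0 ≤ k) (hNk : N * k = T)
    (hy : IsSemidiscreteSolution T m a G y y') {n : ℕ} (hn : n < N) {t : ℝ}
    (ht : t ∈ Icc ((n : ℝ) * k) ((n + 1 : ℕ) * k)) {s : ℝ} (hs : s ∈ Icc 0 T) :
    m s (y ((n + 1 : ℕ) * k) - y t) (y ((n + 1 : ℕ) * k) - y t) ≤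
      Real.exp (c * T) * k * ∫ τ in (n * k)..((n + 1 : ℕ) * k), m τ (y' τ) (y' τ) := by
  have h1 := grid_mem hk hNk hn.le
  have h2 := grid_mem hk hNk (Nat.succ_le_of_lt hn)
  have hsub := grid_sub (k := k) n
  have hle := grid_le hk n
  set p : ℝ := (n : ℝ) * k
  set q : ℝ := ((n + 1 : ℕ) : ℝ) * k
  have htI : t ∈ Icc 0 T := ⟨h1.1.trans ht.1, ht.2.trans h2.2⟩
  rw [hy.sub_eq_integral htI h2]
  have hint : IntegrableOn (fun τ => m τ (y' τ) (y' τ)) (Icc 0 T) := hm.integrableOn_apply hy.memLp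
  have hints : IntegrableOn (fun τ => m s (y' τ) (y' τ)) (Icc 0 T) :=
    EvolvingForm.integrableOn_apply (B := fun _ => m s) (c := c)
      ⟨hm.T_pos, hm.c_nonneg, fun _ _ => hm.symm s hs, fun _ _ => hm.nonneg s hs,
        fun r _ r' _ u => le_mul_of_one_le_left (hm.nonneg s hs u)
          (Real.one_le_exp (mul_nonneg hm.c_nonneg (abs_nonneg _)))⟩ hy.memLp
  have hi : ∀ {r r' : ℝ}, r ∈ Icc 0 T → r' ∈ Icc 0 T →
      IntervalIntegrable (fun τ => m τ (y' τ) (y' τ)) volume r r' :=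
    fun hr hr' => intervalIntegrable_of_integrableOn_Icc hint hr hr'
  refine (NodalForm.integral_integral_le (hm.symm s hs) (hm.nonneg s hs) ht.2
    (fun i => intervalIntegrable_of_integrableOn_Icc (hy.integrable_deriv i) htI h2)
    (intervalIntegrable_of_integrableOn_Icc hints htI h2)).trans ?_
  have h3 : ∫ τ in t..q, m s (y' τ) (y' τ) ≤
      ∫ τ in t..q, Real.exp (c * T) * m τ (y' τ) (y' τ) := by
    refine intervalIntegral.integral_mono_on ht.2
      (intervalIntegrable_of_integrableOn_Icc hints htI h2) ((hi htI h2).const_mul _) fun τ hτ => ?_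
    exact hm.apply_le ⟨htI.1.trans hτ.1, hτ.2.trans h2.2⟩ hs _
  rw [intervalIntegral.integral_const_mul] at h3
  have h4 : ∫ τ in t..q, m τ (y' τ) (y' τ) ≤ ∫ τ in p..q, m τ (y' τ) (y' τ) := by
    refine intervalIntegral.integral_mono_interval ht.1 ht.2 le_rfl ?_ (hi h1 h2)
    rw [Filter.EventuallyLE, ae_restrict_iff' measurableSet_Ioc]
    exact Filter.Eventually.of_forall fun τ hτ =>
      hm.nonneg τ ⟨h1.1.trans hτ.1.le, hτ.2.trans h2.2⟩ _
  have h5 : 0 ≤ ∫ τ in t..q, m s (y' τ) (y' τ) :=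
    intervalIntegral.integral_nonneg ht.2 fun τ _ => hm.nonneg s hs _
  have h6 : q - t ≤ k := by linarith [ht.1]
  have h7 : 0 ≤ q - t := sub_nonneg.2 ht.2
  calc _ ≤ k * (Real.exp (c * T) * ∫ τ in p..q, m τ (y' τ) (y' τ)) := by
        refine mul_le_mul h6 (h3.trans ?_) h5 hk
        gcongr
    _ = _ := by ring

/-- The semidiscrete equation, integrated over a time step. -/
theorem semidiscrete_step (hm : EvolvingForm T c m) (hk : 0 ≤ k) (hNk : N * k = T)
    (hy : IsSemidiscreteSolution T m a G y y') {n : ℕ} (hn : n < N) (φ : ι → ℝ) :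
    m ((n + 1 : ℕ) * k) (y ((n + 1 : ℕ) * k)) φ - m (n * k) (y (n * k)) φ =
      ∫ t in (n * k)..((n + 1 : ℕ) * k), (G t t φ - a t (y t) φ) :=
  (((hm.absolutelyContinuous_apply (fun i => hy.absolutelyContinuous hm.T_pos i)
    (v := fun _ => φ) (fun i => absolutelyContinuousOnInterval_const (φ i) 0 T)
    ).integral_eq_sub_of_ae_hasDerivAt (hy.test φ) (grid_mem hk hNk hn.le)
      (grid_mem hk hNk hn) (grid_le hk n)).2).symm

end Euler

/-! ### Error of the implicit Euler scheme -/

section Euler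

variable {ι : Type*} {T c k cr : ℝ} {N : ℕ} {m a : ℝ → NodalForm ι}
  {rem : ℕ → (ι → ℝ) → (ι → ℝ) → ℝ} {G : ℝ → ℝ → (ι → ℝ) → ℝ} {β : ℝ → ℝ}
  {Y : ℕ → ι → ℝ} [Fintype ι] {y y' : ℝ → ι → ℝ}

theorem mul_le_eighth_sq_add (p x : ℝ) : p * x ≤ 1 / 8 * x ^ 2 + 2 * p ^ 2 := by
  nlinarith [sq_nonneg (1 / 2 * x - 2 * p)]

/-- One step of the error estimate, in the dual norm: the error equation is tested with `φ`, where
`a(φ, ·) = m(e, ·)` for the new error `e`. Testing with `φ` turns the energy of the increment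
`y(t_{n+1}) - y(t)`, which is not under control, into its mass norm. -/
theorem euler_error_step (hm : EvolvingForm T c m) (ha : EvolvingForm T c a)
    (hma : ∀ t ∈ Icc 0 T, ∀ u, m t u u ≤ a t u u) (hG : EvolvingLoad T c m G β)
    (hk : 0 < k) (hNk : N * k = T) (hcr : 0 ≤ cr)
    (hrem : ∀ n, 1 ≤ n → n ≤ N → ∀ ψ φ, |rem n ψ φ| ≤
      cr * k * √(a (n * k) ψ ψ) * √(a (n * k) φ φ))
    (hY : IsEulerSolution k N m a rem G Y) (hy : IsSemidiscreteSolution T m a G y y')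
    {n : ℕ} (hn : n < N) {χ φ : ι → ℝ}
    (hχ : ∀ u, a (n * k) χ u = m (n * k) (y (n * k) - Y n) u)
    (hφ : ∀ u, a ((n + 1 : ℕ) * k) φ u =
      m ((n + 1 : ℕ) * k) (y ((n + 1 : ℕ) * k) - Y (n + 1)) u) :
    a ((n + 1 : ℕ) * k) φ φ + k * m ((n + 1 : ℕ) * k) (y ((n + 1 : ℕ) * k) - Y (n + 1))
        (y ((n + 1 : ℕ) * k) - Y (n + 1)) ≤
      Real.exp (c * k) * a (n * k) χ χ + 4 * k ^ 2 * (
        Real.exp (c * T) * (∫ τ in (n * k)..((n + 1 : ℕ) * k), m τ (y' τ) (y' τ)) +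
        c ^ 2 * Real.exp (c * T) ^ 4 * ((∫ τ in (n * k)..((n + 1 : ℕ) * k), β τ ^ 2) +
          ∫ τ in (n * k)..((n + 1 : ℕ) * k), a τ (y τ) (y τ)) +
        cr ^ 2 * (k * a ((n + 1 : ℕ) * k) (Y (n + 1)) (Y (n + 1)))) := by
  have hstepY := hY n hn φ
  have hstepy := semidiscrete_step hm hk.le hNk hy hn φ
  have hinc := fun {t : ℝ} => apply_sub_grid_le (t := t) hm hk.le hNk hy hn
  have hs := grid_mem hk.le hNk hn.le
  have ht := grid_mem hk.le hNk (Nat.succ_le_of_lt hn)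
  have hle := grid_le hk.le n
  have hsub := grid_sub (k := k) n
  have hremφ := hrem (n + 1) (by omega) hn (Y (n + 1)) φ
  have hae1 := ae_grid hk.le hNk hn hG.bound_sub
  have hhalf := ha.apply_le_half_add hs ht hle χ φ
  set s : ℝ := (n : ℝ) * k
  set t : ℝ := ((n + 1 : ℕ) : ℝ) * k with htdef
  rw [hsub] at hhalf
  set u := Y (n + 1)
  set e := y t - u with he
  set K := Real.exp (c * T) with hK
  set ζ := ∫ τ in s..t, m τ (y' τ) (y' τ)
  have hK1 : 1 ≤ K := hm.one_le_exp
  have hc := hm.c_nonneg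
  have hcontI : ∀ i, ContinuousOn (fun τ => y τ i) (Icc 0 T) := hy.continuousOn hm.T_pos
  have hX := ha.nonneg t ht φ
  have hε := hm.nonneg t ht e
  -- the dual norm of the error is bounded by its mass norm
  have hXε : √(a t φ φ) ≤ √(m t e e) := by
    have h1 := (abs_le.1 (hm.abs_apply_le ht e φ)).2
    rw [← hφ] at h1
    have h2 : √(m t φ φ) ≤ √(a t φ φ) := Real.sqrt_le_sqrt (hma t ht φ)
    have h3 : a t φ φ = √(a t φ φ) * √(a t φ φ) := (Real.mul_self_sqrt hX).symm
    by_contra hlt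
    push Not at hlt
    have h4 := Real.sqrt_nonneg (m t e e)
    nlinarith [Real.sqrt_nonneg (m t φ φ)]
  have hSsq : √(m t e e) ^ 2 = m t e e := Real.sq_sqrt hε
  set S := √(m t e e)
  have hS : 0 ≤ S := Real.sqrt_nonneg _
  -- the consistency error, split into the three contributions estimated below
  have hGi := intervalIntegrable_of_integrableOn_Icc (hG.integrable_diag φ) hs ht
  have hGi' := intervalIntegrable_of_integrableOn_Icc (hG.integrable t ht φ) hs ht
  have hai : IntervalIntegrable (fun τ => a τ (y τ) φ) volume s t :=
    intervalIntegrable_of_integrableOn_Icc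
      (ha.continuousOn_apply hcontI (v := fun _ => φ) fun i => continuousOn_const).integrableOn_Icc
      hs ht
  have hbi := intervalIntegrable_of_integrableOn_Icc hG.integrable_sq hs ht
  have hαi := intervalIntegrable_of_integrableOn_Icc
    (ha.continuousOn_apply hcontI hcontI).integrableOn_Icc hs ht
  have hident : a t φ φ - a s χ φ + k * m t e e =
      (∫ τ in s..t, ((G τ τ φ - a τ (y τ) φ) - G t τ φ + a t (y t) φ)) + k * rem (n + 1) u φ := by
    rw [intervalIntegral.integral_add ((hGi.sub hai).sub hGi') (by simp),
      intervalIntegral.integral_sub (hGi.sub hai) hGi', ← hstepy, ← hstepY,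
      intervalIntegral.integral_const, hsub, smul_eq_mul, hφ φ, hχ φ]
    have h1 : a t e φ = m t e e := by rw [ha.symm t ht, hφ]
    have h2 : a t e φ = a t (y t) φ - a t u φ := by rw [he, map_sub, LinearMap.sub_apply]
    have h3 : m t e φ = m t (y t) φ - m t u φ := by rw [he, map_sub, LinearMap.sub_apply]
    have h4 : m s (y s - Y n) φ = m s (y s) φ - m s (Y n) φ := by
      rw [map_sub, LinearMap.sub_apply]
    rw [← h1, h2, h3, h4]
    ring
  have hR : ∫ τ in s..t, ((G τ τ φ - a τ (y τ) φ) - G t τ φ + a t (y t) φ) ≤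
      ∫ τ in s..t, ((3 / 8 * m t e e + 2 * (K * k * ζ)) + 2 * c ^ 2 * k ^ 2 * K ^ 4 * β τ ^ 2 +
        2 * c ^ 2 * k ^ 2 * K ^ 4 * a τ (y τ) (y τ)) := by
    refine intervalIntegral.integral_mono_ae_restrict hle
      (((hGi.sub hai).sub hGi').add (by simp))
      (((by simp : IntervalIntegrable (fun _ => 3 / 8 * m t e e + 2 * (K * k * ζ)) volume s t).add
        (hbi.const_mul _)).add (hαi.const_mul _)) ?_
    filter_upwards [hae1, ae_restrict_mem measurableSet_Icc] with τ hτ1 hτ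
    have hτI : τ ∈ Icc 0 T := ⟨hs.1.trans hτ.1, hτ.2.trans ht.2⟩
    have hδ : Real.exp (c * |t - τ|) - 1 ≤ c * k * K := by
      refine (hm.exp_sub_one_le hτI ht).trans ?_
      have : |t - τ| ≤ k := by rw [abs_of_nonneg (sub_nonneg.2 hτ.2)]; linarith [hτ.1]
      gcongr
    have hδ' : Real.exp (c * |τ - t|) - 1 ≤ c * k * K := by rwa [abs_sub_comm]
    have hδ0 : 0 ≤ Real.exp (c * |t - τ|) - 1 :=
      sub_nonneg.2 (Real.one_le_exp (mul_nonneg hc (abs_nonneg _)))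
    have hβ := hG.nonneg τ
    have haφ : √(a τ φ φ) ≤ K * S :=
      (ha.sqrt_apply_le ht hτI φ).trans (mul_le_mul_of_nonneg_left hXε (by positivity))
    have hmφ : √(m τ φ φ) ≤ K * S := (Real.sqrt_le_sqrt (hma τ hτI φ)).trans haφ
    have b1 : G τ τ φ - G t τ φ ≤ 1 / 8 * S ^ 2 + 2 * (c * k * K ^ 2 * β τ) ^ 2 := by
      have h1 := (abs_le.1 (hτ1 t ht φ)).1
      rw [abs_sub_comm] at hδ'
      have h2 : (Real.exp (c * |τ - t|) - 1) * (β τ * √(m τ φ φ)) ≤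
          (c * k * K) * (β τ * (K * S)) := by
        rw [abs_sub_comm]
        gcongr
      have h3 := mul_le_eighth_sq_add (c * k * K ^ 2 * β τ) S
      have h4 : c * k * K * (β τ * (K * S)) = c * k * K ^ 2 * β τ * S := by ring
      linarith
    have b2 : a t (y τ) φ - a τ (y τ) φ ≤
        1 / 8 * S ^ 2 + 2 * (c * k * K ^ 2 * √(a τ (y τ) (y τ))) ^ 2 := by
      have h1 := (abs_le.1 (ha.abs_sub_le hτI ht (y τ) φ)).2
      have h2 : (Real.exp (c * |t - τ|) - 1) * (√(a τ (y τ) (y τ)) * √(a τ φ φ)) ≤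
          (c * k * K) * (√(a τ (y τ) (y τ)) * (K * S)) := by gcongr
      have h3 := mul_le_eighth_sq_add (c * k * K ^ 2 * √(a τ (y τ) (y τ))) S
      have h4 : c * k * K * (√(a τ (y τ) (y τ)) * (K * S)) =
          c * k * K ^ 2 * √(a τ (y τ) (y τ)) * S := by ring
      linarith
    have b3 : a t (y t) φ - a t (y τ) φ ≤ 1 / 8 * S ^ 2 + 2 * (K * k * ζ) := by
      have h1 : a t (y t) φ - a t (y τ) φ = m t e (y t - y τ) := by
        rw [← LinearMap.sub_apply, ← map_sub, ha.symm t ht, hφ]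
      have h2 := (abs_le.1 (hm.abs_apply_le ht e (y t - y τ))).2
      have h3 := hinc hτ ht
      have h4 := mul_le_eighth_sq_add (√(m t (y t - y τ) (y t - y τ))) S
      rw [Real.sq_sqrt (hm.nonneg t ht (y t - y τ))] at h4
      have h5 : √(m t e e) * √(m t (y t - y τ) (y t - y τ)) =
          √(m t (y t - y τ) (y t - y τ)) * S := mul_comm _ _
      linarith
    rw [mul_pow, Real.sq_sqrt (ha.nonneg τ hτI _)] at b2
    rw [hSsq] at b1 b2 b3
    have e1 : 2 * (c * k * K ^ 2 * β τ) ^ 2 = 2 * c ^ 2 * k ^ 2 * K ^ 4 * β τ ^ 2 := by ring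
    have e2 : 2 * ((c * k * K ^ 2) ^ 2 * a τ (y τ) (y τ)) =
        2 * c ^ 2 * k ^ 2 * K ^ 4 * a τ (y τ) (y τ) := by ring
    linarith
  rw [intervalIntegral.integral_add ((by simp :
      IntervalIntegrable (fun _ => 3 / 8 * m t e e + 2 * (K * k * ζ)) volume s t).add
        (hbi.const_mul _)) (hαi.const_mul _),
    intervalIntegral.integral_add (by simp) (hbi.const_mul _), intervalIntegral.integral_const,
    intervalIntegral.integral_const_mul, intervalIntegral.integral_const_mul, hsub,
    smul_eq_mul] at hR
  have hrem' : rem (n + 1) u φ ≤ 1 / 8 * m t e e + 2 * cr ^ 2 * k ^ 2 * a t u u := by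
    have h1 : cr * k * √(a t u u) * √(a t φ φ) ≤ cr * k * √(a t u u) * S := by gcongr
    have h2 := mul_le_eighth_sq_add (cr * k * √(a t u u)) S
    rw [hSsq, mul_pow, mul_pow, Real.sq_sqrt (ha.nonneg t ht u)] at h2
    have h4 := (abs_le.1 hremφ).2
    linarith
  have hrem'' := mul_le_mul_of_nonneg_left hrem' hk.le
  linarith

/-- The constant of `euler_error`: it collects the increments of the semidiscrete solution, the
variation of the forms at the rate `c`, and the perturbations of size `cr`. -/
noncomputable def eulerConst (T c cr : ℝ) : ℝ :=
  2 * Real.exp (c * T) + 8 * Real.exp (c * T) ^ 2 * (Real.exp (c * T) +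
    c ^ 2 * Real.exp (c * T) ^ 4 * (1 + Real.exp (c * T)) +
    2 * cr ^ 2 * Real.exp (c * T) * (1 + 2 * Real.exp (c * T) ^ 4))

theorem eulerConst_pos (T c cr : ℝ) : 0 < eulerConst T c cr := by
  unfold eulerConst
  positivity

/-- The error of the implicit Euler scheme is of first order in the mass norm, with the data and
the material derivative of the semidiscrete solution measured in mass norms only. -/
theorem euler_error (hm : EvolvingForm T c m) (ha : EvolvingForm T c a)
    (hma : ∀ t ∈ Icc 0 T, ∀ u, m t u u ≤ a t u u) (hG : EvolvingLoad T c m G β)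
    (hk : 0 < k) (hNk : N * k = T) (hcr : 0 ≤ cr) (hkr : cr * k ≤ 1 / 2)
    (hrem : ∀ n, 1 ≤ n → n ≤ N → ∀ ψ φ, |rem n ψ φ| ≤
      cr * k * √(a (n * k) ψ ψ) * √(a (n * k) φ φ))
    (hY : IsEulerSolution k N m a rem G Y) (hy : IsSemidiscreteSolution T m a G y y')
    (h0 : Y 0 = y 0) :
    ∃ δ : ℕ → ℝ, (∀ n < N, 0 ≤ δ n) ∧
      (∀ n < N, ∀ t ∈ Icc ((n : ℝ) * k) ((n + 1 : ℕ) * k),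
        m t (y t - Y (n + 1)) (y t - Y (n + 1)) ≤ δ n) ∧
      ∑ n ∈ Finset.range N, k * δ n ≤ eulerConst T c cr * k ^ 2 *
        ((∫ t in (0 : ℝ)..T, m t (y' t) (y' t)) + (∫ t in (0 : ℝ)..T, β t ^ 2) +
          m 0 (y 0) (y 0)) := by
  have hψ : ∀ n ≤ N, ∃ ψ, ∀ u, a (n * k) ψ u = m (n * k) (y (n * k) - Y n) u := by
    intro n hn
    have ht := grid_mem hk.le hNk hn
    refine exists_apply_eq_of_symm _ fun u hu => ?_
    have h1 : m (n * k) u u = 0 := le_antisymm (hu ▸ hma _ ht u) (hm.nonneg _ ht u)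
    have h2 := hm.abs_apply_le ht (y (n * k) - Y n) u
    rw [h1, Real.sqrt_zero, mul_zero] at h2
    exact abs_nonpos_iff.1 h2
  choose! ψ hψ using hψ
  have hmy : IntegrableOn (fun t => m t (y' t) (y' t)) (Icc 0 T) := hm.integrableOn_apply hy.memLp
  have hcontI : ∀ i, ContinuousOn (fun τ => y τ i) (Icc 0 T) := hy.continuousOn hm.T_pos
  have hay : IntegrableOn (fun t => a t (y t) (y t)) (Icc 0 T) :=
    (ha.continuousOn_apply hcontI hcontI).integrableOn_Icc
  set K := Real.exp (c * T) with hKdef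
  have hK : 0 < K := Real.exp_pos _
  set ζ : ℕ → ℝ := fun n => ∫ τ in (n * k)..((n + 1 : ℕ) * k), m τ (y' τ) (y' τ) with hζ
  set ε : ℕ → ℝ := fun n => m ((n + 1 : ℕ) * k) (y ((n + 1 : ℕ) * k) - Y (n + 1))
    (y ((n + 1 : ℕ) * k) - Y (n + 1)) with hε
  have hζ0 : ∀ n < N, 0 ≤ ζ n := fun n hn => intervalIntegral.integral_nonneg (grid_le hk.le n)
    fun τ hτ => hm.nonneg τ ⟨(grid_mem hk.le hNk hn.le).1.trans hτ.1,
      hτ.2.trans (grid_mem hk.le hNk hn).2⟩ _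
  have hα0 : ∀ n < N, 0 ≤ ∫ τ in (n * k)..((n + 1 : ℕ) * k), a τ (y τ) (y τ) := fun n hn =>
    intervalIntegral.integral_nonneg (grid_le hk.le n)
      fun τ hτ => ha.nonneg τ ⟨(grid_mem hk.le hNk hn.le).1.trans hτ.1,
        hτ.2.trans (grid_mem hk.le hNk hn).2⟩ _
  have hb0 : ∀ n : ℕ, 0 ≤ ∫ τ in (n * k)..((n + 1 : ℕ) * k), β τ ^ 2 := fun n =>
    intervalIntegral.integral_nonneg (grid_le hk.le n) fun τ _ => sq_nonneg _
  have hε0 : ∀ n < N, 0 ≤ ε n := fun n hn => hm.nonneg _ (grid_mem hk.le hNk hn) _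
  have hsum := sum_le_of_recursion (N := N) (ρ := Real.exp (c * k))
    (Real.one_le_exp (mul_nonneg hm.c_nonneg hk.le))
    (x := fun n => a (n * k) (ψ n) (ψ n)) (p := fun n => k * ε n)
    (q := fun n => 4 * k ^ 2 * (K * ζ n +
        c ^ 2 * K ^ 4 * ((∫ τ in (n * k)..((n + 1 : ℕ) * k), β τ ^ 2) +
          ∫ τ in (n * k)..((n + 1 : ℕ) * k), a τ (y τ) (y τ)) +
        cr ^ 2 * (k * a ((n + 1 : ℕ) * k) (Y (n + 1)) (Y (n + 1)))))
    (fun n hn => ha.nonneg _ (grid_mem hk.le hNk hn) _)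
    (fun n hn => mul_nonneg hk.le (hε0 n hn))
    (fun n hn => by
      have h1 := hζ0 n hn
      have h2 := hα0 n hn
      have h3 := hb0 n
      have h4 := ha.nonneg _ (grid_mem hk.le hNk hn) (Y (n + 1))
      positivity)
    (fun n hn => euler_error_step hm ha hma hG hk hNk hcr hrem hY hy hn (hψ n hn.le)
      (hψ (n + 1) hn))
  have hX0 : a ((0 : ℕ) * k) (ψ 0) (ψ 0) = 0 := by
    rw [hψ 0 (Nat.zero_le N)]
    simp [h0]
  simp only [hX0, exp_mul_pow hNk, ← hKdef] at hsum
  have hdist : ∀ (p q r w : ℕ → ℝ), ∑ n ∈ Finset.range N, 4 * k ^ 2 * (K * p n +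
      c ^ 2 * K ^ 4 * (q n + r n) + cr ^ 2 * w n) =
      4 * k ^ 2 * (K * ∑ n ∈ Finset.range N, p n + c ^ 2 * K ^ 4 * (∑ n ∈ Finset.range N, q n +
        ∑ n ∈ Finset.range N, r n) + cr ^ 2 * ∑ n ∈ Finset.range N, w n) := by
    intro p q r w
    simp only [← Finset.mul_sum, Finset.sum_add_distrib]
  rw [hdist, sum_integral_grid hk.le hNk hG.integrable_sq,
    sum_integral_grid hk.le hNk hay, sum_integral_grid hk.le hNk hmy] at hsum
  have hsd := hy.integral_energy_le hm ha hma hG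
  have hfd := euler_energy_le hm ha hma hG hk hNk hkr hrem hY
  rw [h0] at hfd
  rw [← hKdef] at hsd hfd
  refine ⟨fun n => 2 * (K * k * ζ n) + 2 * (K * ε n), fun n hn => ?_, fun n hn t ht => ?_, ?_⟩
  · have h1 := hζ0 n hn
    have h2 := hε0 n hn
    positivity
  · have hs := grid_mem hk.le hNk hn
    have htI : t ∈ Icc 0 T := ⟨(grid_mem hk.le hNk hn.le).1.trans ht.1, ht.2.trans hs.2⟩
    refine (apply_sub_self_le (hm.nonneg t htI) (y t) (y ((n + 1 : ℕ) * k)) (Y (n + 1))).trans ?_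
    have h1 := apply_sub_grid_le hm hk.le hNk hy hn ht htI
    have h2 := hm.apply_le hs htI (y ((n + 1 : ℕ) * k) - Y (n + 1))
    rw [← neg_sub, map_neg, map_neg, LinearMap.neg_apply, neg_neg] at h1
    exact add_le_add (mul_le_mul_of_nonneg_left h1 zero_le_two)
      (mul_le_mul_of_nonneg_left h2 zero_le_two)
  · have e1 : ∑ n ∈ Finset.range N, k * (2 * (K * k * ζ n) + 2 * (K * ε n)) =
        2 * K * k ^ 2 * (∑ n ∈ Finset.range N, ζ n) +
          2 * K * ∑ n ∈ Finset.range N, k * ε n := by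
      rw [Finset.mul_sum, Finset.mul_sum, ← Finset.sum_add_distrib]
      exact Finset.sum_congr rfl fun n _ => by ring
    rw [e1, sum_integral_grid hk.le hNk hmy]
    have hZ : 0 ≤ ∫ t in (0 : ℝ)..T, m t (y' t) (y' t) :=
      intervalIntegral.integral_nonneg hm.T_pos.le fun t ht => hm.nonneg t ht _
    have hB : 0 ≤ ∫ t in (0 : ℝ)..T, β t ^ 2 :=
      intervalIntegral.integral_nonneg hm.T_pos.le fun t ht => sq_nonneg _
    have hE : 0 ≤ m 0 (y 0) (y 0) := hm.nonneg 0 ⟨le_rfl, hm.T_pos.le⟩ _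
    set Z := ∫ t in (0 : ℝ)..T, m t (y' t) (y' t)
    set B := ∫ t in (0 : ℝ)..T, β t ^ 2
    set E := m 0 (y 0) (y 0)
    have h1 : ∑ n ∈ Finset.range N, k * ε n ≤ K * (4 * k ^ 2 * (K * Z +
        c ^ 2 * K ^ 4 * (B + K * (E + B)) + cr ^ 2 * (2 * K * (E + 2 * K ^ 4 * B)))) := by
      refine hsum.trans ?_
      rw [zero_add]
      gcongr
    have h2 : 2 * K * k ^ 2 * Z + 2 * K * ∑ n ∈ Finset.range N, k * ε n ≤
        2 * K * k ^ 2 * Z + 2 * K * (K * (4 * k ^ 2 * (K * Z +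
          c ^ 2 * K ^ 4 * (B + K * (E + B)) + cr ^ 2 * (2 * K * (E + 2 * K ^ 4 * B))))) := by
      gcongr
    refine h2.trans ?_
    have h3 : 0 ≤ eulerConst T c cr * k ^ 2 * (Z + B + E) - (2 * K * k ^ 2 * Z + 2 * K * (K *
        (4 * k ^ 2 * (K * Z +
          c ^ 2 * K ^ 4 * (B + K * (E + B)) + cr ^ 2 * (2 * K * (E + 2 * K ^ 4 * B)))))) := by
      have e2 : eulerConst T c cr * k ^ 2 * (Z + B + E) - (2 * K * k ^ 2 * Z + 2 * K * (K *
        (4 * k ^ 2 * (K * Z +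
          c ^ 2 * K ^ 4 * (B + K * (E + B)) + cr ^ 2 * (2 * K * (E + 2 * K ^ 4 * B)))))) =
          k ^ 2 * (2 * K * (B + E) + 8 * K ^ 2 * (K * (B + E) +
            c ^ 2 * K ^ 4 * ((1 + K) * Z + E) +
            2 * cr ^ 2 * K * ((1 + 2 * K ^ 4) * Z + B + 2 * K ^ 4 * E))) := by
        simp only [eulerConst, ← hKdef]
        ring
      rw [e2]
      positivity
    linarith

end Euler

/-! ### Bounds for the flow -/

/-- A curve with `‖f'‖ ≤ K ‖f‖` grows and decays at most exponentially. -/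
theorem norm_le_exp_mul_norm {E : Type*} [NormedAddCommGroup E] [InnerProductSpace ℝ E]
    {f f' : ℝ → E} {p q K : ℝ} (hf : ContinuousOn f (Icc p q))
    (hd : ∀ t ∈ Ioo p q, HasDerivAt f (f' t) t) (hK : ∀ t ∈ Ioo p q, ‖f' t‖ ≤ K * ‖f t‖)
    {s t : ℝ} (hs : s ∈ Icc p q) (ht : t ∈ Icc p q) :
    ‖f t‖ ≤ Real.exp (K * |t - s|) * ‖f s‖ := by
  have hder : ∀ (κ : ℝ), ∀ τ ∈ Ioo p q, HasDerivAt (fun τ => Real.exp (κ * τ) * ‖f τ‖ ^ 2)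
      (Real.exp (κ * τ) * (κ * ‖f τ‖ ^ 2 + 2 * inner ℝ (f τ) (f' τ))) τ := by
    intro κ τ hτ
    have h1 := (((hasDerivAt_id τ).const_mul κ).exp).mul (hd τ hτ).norm_sq
    refine h1.congr_deriv ?_
    simp only [id_eq]
    ring
  have hcont : ∀ κ : ℝ, ContinuousOn (fun τ => Real.exp (κ * τ) * ‖f τ‖ ^ 2) (Icc p q) := fun κ =>
    (by fun_prop : Continuous fun τ => Real.exp (κ * τ)).continuousOn.mul (hf.norm.pow 2)
  have hin : ∀ τ ∈ Ioo p q, |inner ℝ (f τ) (f' τ)| ≤ K * ‖f τ‖ ^ 2 := fun τ hτ => by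
    refine (abs_real_inner_le_norm _ _).trans ?_
    nlinarith [hK τ hτ, norm_nonneg (f τ)]
  have hsq : ‖f t‖ ^ 2 ≤ (Real.exp (K * |t - s|) * ‖f s‖) ^ 2 := by
    rw [mul_pow, ← Real.exp_nat_mul]
    rcases le_total s t with hst | hst
    · have hanti : AntitoneOn (fun τ => Real.exp (-(2 * K) * τ) * ‖f τ‖ ^ 2) (Icc p q) := by
        refine antitoneOn_of_deriv_nonpos (convex_Icc p q) (hcont _)
          (fun τ hτ => ?_) fun τ hτ => ?_
        · rw [interior_Icc] at hτ
          exact (hder _ τ hτ).differentiableAt.differentiableWithinAt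
        · rw [interior_Icc] at hτ
          rw [(hder _ τ hτ).deriv]
          have := (abs_le.1 (hin τ hτ)).2
          refine mul_nonpos_of_nonneg_of_nonpos (Real.exp_pos _).le (by linarith)
      have h := hanti hs ht hst
      simp only at h
      rw [abs_of_nonneg (sub_nonneg.2 hst)]
      have h2 := mul_le_mul_of_nonneg_left h (Real.exp_pos (2 * K * t)).le
      rw [← mul_assoc, ← mul_assoc, ← Real.exp_add, ← Real.exp_add] at h2
      rw [show 2 * K * t + -(2 * K) * t = 0 by ring, Real.exp_zero, one_mul,
        show 2 * K * t + -(2 * K) * s = (2 : ℕ) * (K * (t - s)) by push_cast; ring] at h2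
      exact h2
    · have hmono : MonotoneOn (fun τ => Real.exp (2 * K * τ) * ‖f τ‖ ^ 2) (Icc p q) := by
        refine monotoneOn_of_deriv_nonneg (convex_Icc p q) (hcont _)
          (fun τ hτ => ?_) fun τ hτ => ?_
        · rw [interior_Icc] at hτ
          exact (hder _ τ hτ).differentiableAt.differentiableWithinAt
        · rw [interior_Icc] at hτ
          rw [(hder _ τ hτ).deriv]
          have := (abs_le.1 (hin τ hτ)).1
          refine mul_nonneg (Real.exp_pos _).le (by linarith)
      have h := hmono ht hs hst
      simp only at h
      rw [abs_sub_comm, abs_of_nonneg (sub_nonneg.2 hst)]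
      have h2 := mul_le_mul_of_nonneg_left h (Real.exp_pos (-(2 * K) * t)).le
      rw [← mul_assoc, ← mul_assoc, ← Real.exp_add, ← Real.exp_add] at h2
      rw [show -(2 * K) * t + 2 * K * t = 0 by ring, Real.exp_zero, one_mul,
        show -(2 * K) * t + 2 * K * s = (2 : ℕ) * (K * (s - t)) by push_cast; ring] at h2
      exact h2
  exact (sq_le_sq₀ (norm_nonneg _) (by positivity)).1 hsq

namespace EvolvingSurface

variable (S : EvolvingSurface)

theorem zero_mem : (0 : ℝ) ∈ Icc 0 S.T := ⟨le_rfl, S.T_pos.le⟩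

theorem flow_continuousOn (z : Space) : ContinuousOn (fun t => S.flow 0 t z) (Icc 0 S.T) :=
  fun t ht => (S.flow_deriv 0 S.zero_mem t ht z).continuousWithinAt

theorem flow_hasDerivAt (z : Space) {t : ℝ} (ht : t ∈ Ioo 0 S.T) :
    HasDerivAt (fun t => S.flow 0 t z) (S.velocity (S.flow 0 t z, t)) t :=
  (S.flow_deriv 0 S.zero_mem t (Ioo_subset_Icc_self ht) z).hasDerivAt (Icc_mem_nhds ht.1 ht.2)

theorem exists_velocity_bounds (R : ℝ) : ∃ K : ℝ, 0 ≤ K ∧ ∃ B : ℝ, 0 ≤ B ∧ ∀ t ∈ Icc 0 S.T,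
    ∀ x ∈ Metric.closedBall (0 : Space) R, ‖S.velocity (x, t)‖ ≤ B ∧
      ∀ y ∈ Metric.closedBall (0 : Space) R,
        ‖S.velocity (x, t) - S.velocity (y, t)‖ ≤ K * ‖x - y‖ := by
  have hc : IsCompact (Metric.closedBall (0 : Space) R ×ˢ Icc 0 S.T) :=
    (isCompact_closedBall _ _).prod isCompact_Icc
  have hd : ContDiffOn ℝ 2 S.velocity (Metric.closedBall (0 : Space) R ×ˢ Icc 0 S.T) :=
    S.contDiffOn_velocity.mono (prod_mono (subset_univ _) subset_rfl)
  obtain ⟨K, hK⟩ := hd.exists_lipschitzOnWith (by norm_num)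
    ((convex_closedBall _ _).prod (convex_Icc _ _)) hc
  obtain ⟨B, hB⟩ := hc.exists_bound_of_continuousOn hd.continuousOn
  refine ⟨K, K.2, max B 0, le_max_right _ _, fun t ht x hx => ⟨?_, fun y hy => ?_⟩⟩
  · exact (hB (x, t) ⟨hx, ht⟩).trans (le_max_left _ _)
  · have := hK.norm_sub_le (x := (x, t)) ⟨hx, ht⟩ (y := (y, t)) ⟨hy, ht⟩
    simpa [Prod.norm_def] using this

/-- Trajectories that start close to `z₀` stay within distance one of the trajectory of `z₀`. -/
theorem eventually_dist_flow_lt (z₀ : Space) :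
    ∃ δ > 0, ∀ z, ‖z - z₀‖ < δ → ∀ t ∈ Icc 0 S.T, ‖S.flow 0 t z - S.flow 0 t z₀‖ < 1 := by
  obtain ⟨R, hR⟩ := isCompact_Icc.exists_bound_of_continuousOn (S.flow_continuousOn z₀)
  obtain ⟨K, hK0, B, -, hV⟩ := S.exists_velocity_bounds (R + 1)
  refine ⟨Real.exp (-(K * S.T)), Real.exp_pos _, fun z hz => ?_⟩
  by_contra! hcon
  have hcont : ContinuousOn (fun t => S.flow 0 t z - S.flow 0 t z₀) (Icc 0 S.T) :=
    (S.flow_continuousOn z).sub (S.flow_continuousOn z₀)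
  -- the first time at which the distance reaches one
  have hA : IsCompact (Icc 0 S.T ∩ (fun t => ‖S.flow 0 t z - S.flow 0 t z₀‖) ⁻¹' Ici 1) :=
    isCompact_Icc.of_isClosed_subset
      (hcont.norm.preimage_isClosed_of_isClosed isClosed_Icc isClosed_Ici) inter_subset_left
  obtain ⟨t₁, ht₁, h1⟩ := hcon
  obtain ⟨q, ⟨hq, hq1⟩, hmin⟩ := hA.exists_isLeast ⟨t₁, ht₁, h1⟩
  have hlt : ∀ τ ∈ Ioo 0 q, ‖S.flow 0 τ z - S.flow 0 τ z₀‖ < 1 := fun τ hτ => by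
    by_contra! h
    exact absurd (hmin ⟨⟨hτ.1.le, hτ.2.le.trans hq.2⟩, h⟩) (not_le.2 hτ.2)
  have hb := norm_le_exp_mul_norm (K := K) (hcont.mono (Icc_subset_Icc le_rfl hq.2))
    (fun τ hτ => (S.flow_hasDerivAt z ⟨hτ.1, hτ.2.trans_le hq.2⟩).sub
      (S.flow_hasDerivAt z₀ ⟨hτ.1, hτ.2.trans_le hq.2⟩))
    (fun τ hτ => by
      have hτI : τ ∈ Icc 0 S.T := ⟨hτ.1.le, hτ.2.le.trans hq.2⟩
      have h2 := hR τ hτI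
      refine (hV τ hτI _ ?_).2 _ ?_
      · rw [mem_closedBall_zero_iff]
        have h3 := norm_sub_norm_le (S.flow 0 τ z) (S.flow 0 τ z₀)
        linarith [hlt τ hτ]
      · rw [mem_closedBall_zero_iff]
        linarith)
    (left_mem_Icc.2 hq.1) (right_mem_Icc.2 hq.1)
  rw [S.flow_self 0 S.zero_mem, S.flow_self 0 S.zero_mem, sub_zero, abs_of_nonneg hq.1] at hb
  have h4 : Real.exp (K * q) ≤ Real.exp (K * S.T) :=
    Real.exp_le_exp.2 (mul_le_mul_of_nonneg_left hq.2 hK0)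
  have h5 : Real.exp (K * S.T) * Real.exp (-(K * S.T)) = 1 := by rw [← Real.exp_add]; simp
  have h6 : Real.exp (K * q) * ‖z - z₀‖ < 1 := by
    calc _ ≤ Real.exp (K * S.T) * ‖z - z₀‖ := by gcongr
      _ < Real.exp (K * S.T) * Real.exp (-(K * S.T)) := by gcongr
      _ = 1 := h5
  have h7 : (1 : ℝ) ≤ ‖S.flow 0 q z - S.flow 0 q z₀‖ := hq1
  linarith

theorem exists_flow_bound :
    ∃ R : ℝ, ∀ z ∈ S.initialSurface, ∀ t ∈ Icc 0 S.T, ‖S.flow 0 t z‖ ≤ R := by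
  refine S.isCompact_initialSurface.induction_on
    (p := fun s => ∃ R : ℝ, ∀ z ∈ s, ∀ t ∈ Icc 0 S.T, ‖S.flow 0 t z‖ ≤ R) ?_ ?_ ?_ ?_
  · exact ⟨0, by simp⟩
  · rintro s t hst ⟨R, hR⟩
    exact ⟨R, fun z hz => hR z (hst hz)⟩
  · rintro s t ⟨R, hR⟩ ⟨R', hR'⟩
    refine ⟨max R R', fun z hz τ hτ => ?_⟩
    rcases hz with hz | hz
    · exact (hR z hz τ hτ).trans (le_max_left _ _)
    · exact (hR' z hz τ hτ).trans (le_max_right _ _)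
  · intro z₀ _
    obtain ⟨δ, hδ, h⟩ := S.eventually_dist_flow_lt z₀
    obtain ⟨R, hR⟩ := isCompact_Icc.exists_bound_of_continuousOn (S.flow_continuousOn z₀)
    refine ⟨Metric.ball z₀ δ, mem_nhdsWithin_of_mem_nhds (Metric.ball_mem_nhds z₀ hδ), R + 1,
      fun z hz t ht => ?_⟩
    have h1 := h z (by rwa [← dist_eq_norm]) t ht
    have h2 := norm_sub_norm_le (S.flow 0 t z) (S.flow 0 t z₀)
    have := hR t ht
    linarith

/-- Uniform bounds for the trajectories that start on the initial surface: they have speed at most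
`B`, and the difference of two of them grows and varies at the rate `K`. -/
structure FlowBounds (K B : ℝ) : Prop where
  K_nonneg : 0 ≤ K
  B_nonneg : 0 ≤ B
  speed : ∀ z ∈ S.initialSurface, ∀ s ∈ Icc 0 S.T, ∀ t ∈ Icc 0 S.T,
    ‖S.flow 0 t z - S.flow 0 s z‖ ≤ B * |t - s|
  growth : ∀ z ∈ S.initialSurface, ∀ z' ∈ S.initialSurface, ∀ s ∈ Icc 0 S.T, ∀ t ∈ Icc 0 S.T,
    ‖S.flow 0 t z - S.flow 0 t z'‖ ≤ Real.exp (K * |t - s|) * ‖S.flow 0 s z - S.flow 0 s z'‖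
  variation : ∀ z ∈ S.initialSurface, ∀ z' ∈ S.initialSurface, ∀ s ∈ Icc 0 S.T,
    ∀ t ∈ Icc 0 S.T, ‖(S.flow 0 t z - S.flow 0 t z') - (S.flow 0 s z - S.flow 0 s z')‖ ≤
      K * |t - s| * ‖S.flow 0 s z - S.flow 0 s z'‖

theorem exists_flowBounds : ∃ K B, S.FlowBounds K B := by
  obtain ⟨R, hR⟩ := S.exists_flow_bound
  obtain ⟨K, hK0, B, hB0, hV⟩ := S.exists_velocity_bounds R
  have hmem : ∀ z ∈ S.initialSurface, ∀ t ∈ Icc 0 S.T,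
      S.flow 0 t z ∈ Metric.closedBall (0 : Space) R := fun z hz t ht =>
    mem_closedBall_zero_iff.2 (hR z hz t ht)
  have hgrowth : ∀ z ∈ S.initialSurface, ∀ z' ∈ S.initialSurface, ∀ s ∈ Icc 0 S.T,
      ∀ t ∈ Icc 0 S.T, ‖S.flow 0 t z - S.flow 0 t z'‖ ≤
        Real.exp (K * |t - s|) * ‖S.flow 0 s z - S.flow 0 s z'‖ := by
    intro z hz z' hz' s hs t ht
    exact norm_le_exp_mul_norm ((S.flow_continuousOn z).sub (S.flow_continuousOn z'))
      (fun τ hτ => (S.flow_hasDerivAt z hτ).sub (S.flow_hasDerivAt z' hτ))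
      (fun τ hτ => (hV τ (Ioo_subset_Icc_self hτ) _ (hmem z hz τ (Ioo_subset_Icc_self hτ))).2 _
        (hmem z' hz' τ (Ioo_subset_Icc_self hτ))) hs ht
  have hE : 1 ≤ Real.exp (K * S.T) := Real.one_le_exp (mul_nonneg hK0 S.T_pos.le)
  have habs : ∀ s ∈ Icc 0 S.T, ∀ t ∈ Icc 0 S.T, |t - s| ≤ S.T := fun s hs t ht => by
    rw [abs_le]
    constructor <;> linarith [hs.1, hs.2, ht.1, ht.2]
  refine ⟨K * Real.exp (K * S.T), B, by positivity, hB0, fun z hz s hs t ht => ?_,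
    fun z hz z' hz' s hs t ht => ?_, fun z hz z' hz' s hs t ht => ?_⟩
  · exact (convex_Icc 0 S.T).norm_image_sub_le_of_norm_hasDerivWithin_le
      (fun τ hτ => S.flow_deriv 0 S.zero_mem τ hτ z) (fun τ hτ => (hV τ hτ _ (hmem z hz τ hτ)).1)
      hs ht
  · refine (hgrowth z hz z' hz' s hs t ht).trans ?_
    gcongr
    nlinarith
  · refine ((convex_Icc 0 S.T).norm_image_sub_le_of_norm_hasDerivWithin_le
      (f := fun τ => S.flow 0 τ z - S.flow 0 τ z')
      (C := K * (Real.exp (K * S.T) * ‖S.flow 0 s z - S.flow 0 s z'‖))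
      (fun τ hτ => (S.flow_deriv 0 S.zero_mem τ hτ z).sub (S.flow_deriv 0 S.zero_mem τ hτ z'))
      (fun τ hτ => ?_) hs ht).trans (le_of_eq ?_)
    · refine ((hV τ hτ _ (hmem z hz τ hτ)).2 _ (hmem z' hz' τ hτ)).trans ?_
      refine mul_le_mul_of_nonneg_left ((hgrowth z hz z' hz' s hs τ hτ).trans ?_) hK0
      gcongr
      exact habs s hs τ hτ
    · rw [Real.norm_eq_abs]
      ring

end EvolvingSurface

/-! ### The normal projection on triangles -/

namespace EvolvingSurface

variable (S : EvolvingSurface)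

theorem surface_nonempty (t : ℝ) : (S.surface t).Nonempty := S.initialSurface_nonempty.image _

/-- The space-time tube of width `r` about the moving surface. -/
abbrev tube : Set (Space × ℝ) := tubeAround S.T S.r (fun t => S.flow 0 t '' S.initialSurface)

theorem continuousOn_infDist :
    ContinuousOn (fun q : Space × ℝ => Metric.infDist q.1 (S.surface q.2)) (univ ×ˢ Icc 0 S.T) := by
  obtain ⟨K, B, hF⟩ := S.exists_flowBounds
  have key : ∀ p ∈ univ ×ˢ Icc 0 S.T, ∀ q ∈ (univ : Set Space) ×ˢ Icc 0 S.T,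
      Metric.infDist p.1 (S.surface p.2) ≤
        Metric.infDist q.1 (S.surface q.2) + (1 + B) * dist p q := by
    intro p hp q hq
    rw [← sub_le_iff_le_add, Metric.le_infDist (S.surface_nonempty _)]
    rintro _ ⟨z, hz, rfl⟩
    have h1 : Metric.infDist p.1 (S.surface p.2) ≤ dist p.1 (S.flow 0 p.2 z) :=
      Metric.infDist_le_dist_of_mem ⟨z, hz, rfl⟩
    have h2 := dist_triangle4 p.1 q.1 (S.flow 0 q.2 z) (S.flow 0 p.2 z)
    have h3 := hF.speed z hz p.2 hp.2 q.2 hq.2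
    rw [← dist_eq_norm, abs_sub_comm, ← Real.dist_eq] at h3
    have h4 : dist p.1 q.1 ≤ dist p q := le_max_left _ _
    have h5 : dist p.2 q.2 ≤ dist p q := le_max_right _ _
    have h6 := mul_le_mul_of_nonneg_left h5 hF.B_nonneg
    linarith
  refine (LipschitzOnWith.of_dist_le' (K := 1 + B) fun p hp q hq => ?_).continuousOn
  rw [Real.dist_eq, abs_le]
  have h1 := key p hp q hq
  have h2 := key q hq p hp
  rw [dist_comm q p] at h2
  constructor <;> linarith

theorem exists_isOpen_tube : ∃ O : Set (Space × ℝ), IsOpen O ∧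
    S.tube = (univ ×ˢ Icc 0 S.T) ∩ O := by
  obtain ⟨O, hO, h⟩ := continuousOn_iff'.1 S.continuousOn_infDist (Iio S.r) isOpen_Iio
  refine ⟨O, hO, ?_⟩
  rw [inter_comm _ O, ← h]
  ext q
  simp only [tube, tubeAround, mem_ofPred_eq, mem_inter_iff, mem_preimage, mem_Iio, mem_prod,
    mem_univ, true_and]
  exact and_comm

theorem uniqueDiffOn_tube : UniqueDiffOn ℝ S.tube := by
  obtain ⟨O, hO, h⟩ := S.exists_isOpen_tube
  rw [h]
  exact (uniqueDiffOn_univ.prod (uniqueDiffOn_Icc S.T_pos)).inter hO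

/-- The spatial derivative of the signed distance, as a function on the space-time tube. -/
noncomputable def spatialDeriv (q : Space × ℝ) : Space →L[ℝ] ℝ :=
  (fderivWithin ℝ S.d S.tube q).comp (ContinuousLinearMap.inl ℝ Space ℝ)

theorem hasFDerivAt_d {x : Space} {t : ℝ} (h : (x, t) ∈ S.tube) :
    HasFDerivAt (fun y => S.d (y, t)) (S.spatialDeriv (x, t)) x := by
  obtain ⟨O, hO, hOeq⟩ := S.exists_isOpen_tube
  have h1 := ((S.contDiffOn_d.differentiableOn (by norm_num)) (x, t) h).hasFDerivWithinAt
  have h2 : HasFDerivWithinAt (fun y : Space => (y, t)) (ContinuousLinearMap.inl ℝ Space ℝ)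
      ((fun y : Space => (y, t)) ⁻¹' O) x :=
    (hasFDerivAt_prodMk_left x t).hasFDerivWithinAt
  have hx : (x, t) ∈ O := by
    have := h; rw [hOeq] at this; exact this.2
  refine (h1.comp x h2 fun y hy => ?_).hasFDerivAt ?_
  · change (y, t) ∈ S.tube
    rw [hOeq]
    exact ⟨⟨mem_univ _, h.1⟩, hy⟩
  · exact (hO.preimage (by fun_prop)).mem_nhds hx

theorem fderiv_d {x : Space} {t : ℝ} (h : (x, t) ∈ S.tube) :
    fderiv ℝ (fun y => S.d (y, t)) x = S.spatialDeriv (x, t) :=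
  (S.hasFDerivAt_d h).fderiv

theorem proj_eq {x : Space} {t : ℝ} (h : (x, t) ∈ S.tube) :
    S.proj t x = x - S.d (x, t) •
      (InnerProductSpace.toDual ℝ Space).symm (S.spatialDeriv (x, t)) := by
  rw [proj, gradient, S.fderiv_d h]

theorem contDiffOn_spatialDeriv : ContDiffOn ℝ 1 S.spatialDeriv S.tube :=
  (S.contDiffOn_d.fderivWithin S.uniqueDiffOn_tube (by norm_num)).clm_comp contDiffOn_const

/-- The closed tube of half the width. -/
def halfTube : Set (Space × ℝ) :=
  {q | q.2 ∈ Icc 0 S.T ∧ Metric.infDist q.1 (S.surface q.2) ≤ S.r / 2}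

theorem halfTube_subset : S.halfTube ⊆ S.tube := fun _ hq =>
  ⟨hq.1, hq.2.trans_lt (half_lt_self S.r_pos)⟩

theorem isCompact_halfTube : IsCompact S.halfTube := by
  obtain ⟨R, hR⟩ := S.exists_flow_bound
  have hcl : IsClosed S.halfTube := by
    have := S.continuousOn_infDist.preimage_isClosed_of_isClosed
      (isClosed_univ.prod isClosed_Icc) (isClosed_Iic (a := S.r / 2))
    convert this using 1
    ext q
    simp [halfTube]
  refine ((isCompact_closedBall (0 : Space) (R + S.r)).prod
    (isCompact_Icc (a := (0 : ℝ)) (b := S.T))).of_isClosed_subset hcl fun q hq => ⟨?_, hq.1⟩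
  obtain ⟨_, ⟨z, hz, rfl⟩, hlt⟩ := (Metric.infDist_lt_iff (S.surface_nonempty q.2)).1
    (hq.2.trans_lt (half_lt_self S.r_pos))
  rw [mem_closedBall_zero_iff]
  have h1 := norm_sub_norm_le q.1 (S.flow 0 q.2 z)
  rw [← dist_eq_norm] at h1
  have h2 := hR z hz q.2 hq.1
  linarith

theorem exists_spatialDeriv_bounds : ∃ L B : ℝ, 0 ≤ L ∧ 0 ≤ B ∧ ∀ p ∈ S.halfTube,
    ‖S.spatialDeriv p‖ ≤ B ∧
      ∀ q ∈ S.halfTube, ‖S.spatialDeriv p - S.spatialDeriv q‖ ≤ L * ‖p - q‖ := by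
  have hloc : LocallyLipschitzOn S.halfTube S.spatialDeriv := by
    obtain ⟨O, hO, hOeq⟩ := S.exists_isOpen_tube
    intro q hq
    have hq' := S.halfTube_subset hq
    have h1 := S.contDiffOn_spatialDeriv q hq'
    rw [hOeq] at h1 hq'
    rw [contDiffWithinAt_inter (hO.mem_nhds hq'.2)] at h1
    obtain ⟨K, t, ht, hK⟩ := h1.exists_lipschitzOnWith (convex_univ.prod (convex_Icc 0 S.T))
    have hsub : S.halfTube ⊆ univ ×ˢ Icc 0 S.T := fun p hp => ⟨mem_univ _, hp.1⟩
    exact ⟨K, t, nhdsWithin_mono _ hsub ht, hK⟩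
  obtain ⟨L, hL⟩ := hloc.exists_lipschitzOnWith_of_compact S.isCompact_halfTube
  obtain ⟨B, hB⟩ := S.isCompact_halfTube.exists_bound_of_continuousOn hL.continuousOn
  exact ⟨L, max B 0, L.2, le_max_right _ _, fun p hp => ⟨(hB p hp).trans (le_max_left _ _),
    fun q hq => hL.norm_sub_le hp hq⟩⟩

/-- On a small shape regular triangle with nodes on `Γ(t)` the normal projection is expanding up to
a factor two. The distance `d` is small on the triangle, and as it vanishes at the nodes its
derivatives in the directions of the edges are small as well, so that `x ↦ d ∇d` has a small
Lipschitz constant. -/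
theorem exists_proj_expanding (κ : ℝ) (hκ : 0 ≤ κ) : ∃ h₁ > 0, ∀ t ∈ Icc 0 S.T,
    ∀ (C : Set Space) (p : Fin 3 → Space), Convex ℝ C → (∀ j, p j ∈ C) →
      (∀ j, p j ∈ S.surface t) → (∀ x ∈ C, ∀ y ∈ C, ‖x - y‖ ≤ h₁) →
      (∀ x ∈ C, ∀ y ∈ C, ∃ w : Fin 2 → ℝ, x - y = ∑ b, w b • (p b.succ - p 0) ∧
        ∑ b, |w b| * ‖p b.succ - p 0‖ ≤ κ * ‖x - y‖) →
      ∀ x ∈ C, ∀ y ∈ C, ‖x - y‖ ≤ 2 * ‖S.proj t x - S.proj t y‖ := by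
  obtain ⟨L, B, hL0, hB0, hLB⟩ := S.exists_spatialDeriv_bounds
  set A : ℝ := L * ((1 + κ) * B + 1) with hA
  have hA0 : 0 ≤ A := by positivity
  refine ⟨min (S.r / 2) (1 / (2 * (A + 1))), lt_min (half_pos S.r_pos) (by positivity), ?_⟩
  intro t ht C p hC hpC hpS hdiam hw x hx y hy
  set h := min (S.r / 2) (1 / (2 * (A + 1)))
  have hh0 : 0 ≤ h := le_min (half_pos S.r_pos).le (by positivity)
  have hr : h ≤ S.r / 2 := min_le_left _ _
  have hAh : A * h ≤ 1 / 2 := by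
    have h1 : h ≤ 1 / (2 * (A + 1)) := min_le_right _ _
    rw [le_div_iff₀ (by positivity)] at h1
    nlinarith
  have hdist : ∀ z ∈ C, Metric.infDist z (S.surface t) ≤ h := fun z hz =>
    (Metric.infDist_le_dist_of_mem (hpS 0)).trans (by
      rw [dist_eq_norm]; exact hdiam z hz _ (hpC 0))
  have hmem : ∀ z ∈ C, (z, t) ∈ S.halfTube := fun z hz => ⟨ht, (hdist z hz).trans hr⟩
  have hdabs : ∀ z ∈ C, |S.d (z, t)| ≤ h := fun z hz => by
    rw [S.abs_d (z, t) (S.halfTube_subset (hmem z hz))]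
    exact hdist z hz
  have hdp : ∀ j, S.d (p j, t) = 0 := fun j => by
    rw [← abs_eq_zero, S.abs_d (p j, t) (S.halfTube_subset (hmem _ (hpC j)))]
    exact Metric.infDist_zero_of_mem (hpS j)
  set D : Space → (Space →L[ℝ] ℝ) := fun z => S.spatialDeriv (z, t) with hD
  have hDB : ∀ z ∈ C, ‖D z‖ ≤ B := fun z hz => (hLB _ (hmem z hz)).1
  have hDL : ∀ z ∈ C, ∀ z' ∈ C, ‖D z - D z'‖ ≤ L * ‖z - z'‖ := fun z hz z' hz' => by
    have := (hLB _ (hmem z hz)).2 _ (hmem z' hz')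
    simpa [Prod.norm_def] using this
  -- Taylor expansion about the first node
  have hmean : ∀ z ∈ C, ∀ z' ∈ C,
      |S.d (z', t) - S.d (z, t) - D (p 0) (z' - z)| ≤ L * h * ‖z' - z‖ := by
    intro z hz z' hz'
    exact hC.norm_image_sub_le_of_norm_hasFDerivWithin_le' (f := fun y => S.d (y, t))
      (fun q hq => (S.hasFDerivAt_d (S.halfTube_subset (hmem q hq))).hasFDerivWithinAt)
      (fun q hq => (hDL q hq _ (hpC 0)).trans (by gcongr; exact hdiam q hq _ (hpC 0))) hz hz'
  have hedge : ∀ b : Fin 2, |D (p 0) (p b.succ - p 0)| ≤ L * h * ‖p b.succ - p 0‖ := fun b => by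
    have := hmean _ (hpC 0) _ (hpC b.succ)
    rwa [hdp, hdp, sub_zero, zero_sub, abs_neg] at this
  have htang : |D (p 0) (x - y)| ≤ L * h * (κ * ‖x - y‖) := by
    obtain ⟨w, hw1, hw2⟩ := hw x hx y hy
    refine le_trans ?_ (mul_le_mul_of_nonneg_left hw2 (by positivity))
    rw [hw1, map_sum, Finset.mul_sum]
    refine (Finset.abs_sum_le_sum_abs _ _).trans (Finset.sum_le_sum fun b _ => ?_)
    rw [map_smul, smul_eq_mul, abs_mul]
    have := mul_le_mul_of_nonneg_left (hedge b) (abs_nonneg (w b))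
    linarith
  have hdd : |S.d (x, t) - S.d (y, t)| ≤ L * h * (1 + κ) * ‖x - y‖ := by
    have h1 := hmean y hy x hx
    have h2 := abs_add_le (S.d (x, t) - S.d (y, t) - D (p 0) (x - y)) (D (p 0) (x - y))
    rw [sub_add_cancel] at h2
    linarith
  set g : Space → Space := fun z => (InnerProductSpace.toDual ℝ Space).symm (D z) with hg
  have hgx : ‖g x‖ ≤ B := by
    rw [hg]; simpa using hDB x hx
  have hgxy : ‖g x - g y‖ ≤ L * ‖x - y‖ := by
    rw [hg]
    simp only
    rw [← map_sub, LinearIsometryEquiv.norm_map]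
    exact hDL x hx y hy
  have hproj : S.proj t x - S.proj t y =
      (x - y) - ((S.d (x, t) - S.d (y, t)) • g x + S.d (y, t) • (g x - g y)) := by
    rw [S.proj_eq (S.halfTube_subset (hmem x hx)), S.proj_eq (S.halfTube_subset (hmem y hy))]
    change x - S.d (x, t) • g x - (y - S.d (y, t) • g y) = _
    rw [sub_smul, smul_sub]
    abel
  have hbr : ‖(S.d (x, t) - S.d (y, t)) • g x + S.d (y, t) • (g x - g y)‖ ≤
      1 / 2 * ‖x - y‖ := by
    refine (norm_add_le _ _).trans ?_
    rw [norm_smul, norm_smul, Real.norm_eq_abs, Real.norm_eq_abs]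
    calc _ ≤ (L * h * (1 + κ) * ‖x - y‖) * B + h * (L * ‖x - y‖) := by
          gcongr
          exact hdabs y hy
      _ = A * h * ‖x - y‖ := by rw [hA]; ring
      _ ≤ _ := by gcongr
  have h3 := norm_sub_norm_le (x - y)
    ((S.d (x, t) - S.d (y, t)) • g x + S.d (y, t) • (g x - g y))
  rw [← hproj] at h3
  linarith

end EvolvingSurface

/-! ### Comparison of Hausdorff measures -/

/-- Hausdorff measures of two images of `A` are compared if the distances of image points are: on
`A`, the map `f` factors through `g` by a Lipschitz map. -/
theorem euclideanHausdorffMeasure_image_le_of_dist_le {α X Y : Type*} [MetricSpace X]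
    [MeasurableSpace X] [BorelSpace X] [MetricSpace Y] [MeasurableSpace Y] [BorelSpace Y]
    {f : α → X} {g : α → Y} {A : Set α} {C : ℝ} (d : ℕ)
    (h : ∀ x ∈ A, ∀ y ∈ A, dist (f x) (f y) ≤ C * dist (g x) (g y)) :
    μHE[d] (f '' A) ≤ ENNReal.ofReal C ^ d * μHE[d] (g '' A) := by
  rcases A.eq_empty_or_nonempty with rfl | ⟨x₀, -⟩
  · simp
  have : Nonempty α := ⟨x₀⟩
  set φ : Y → X := fun z => f (Function.invFunOn g A z) with hφ
  have hmem : ∀ z ∈ g '' A, Function.invFunOn g A z ∈ A ∧ g (Function.invFunOn g A z) = z :=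
    fun z hz => ⟨Function.invFunOn_mem hz, Function.invFunOn_eq hz⟩
  have hlip : LipschitzOnWith C.toNNReal φ (g '' A) := by
    refine LipschitzOnWith.of_dist_le' fun z hz z' hz' => ?_
    have := h _ (hmem z hz).1 _ (hmem z' hz').1
    rwa [(hmem z hz).2, (hmem z' hz').2] at this
  have himg : φ '' (g '' A) = f '' A := by
    rw [image_image]
    refine image_congr fun x hx => ?_
    have h1 := hmem (g x) (mem_image_of_mem g hx)
    have h2 := h _ h1.1 x hx
    rw [h1.2, dist_self, mul_zero] at h2
    exact dist_le_zero.1 h2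
  have hle := hlip.hausdorffMeasure_image_le (d := d) (by positivity)
  rw [himg] at hle
  simp only [Measure.euclideanHausdorffMeasure_def, Measure.smul_apply, ENNReal.smul_def,
    smul_eq_mul]
  rw [ENNReal.rpow_natCast] at hle
  rw [mul_left_comm]
  gcongr
  exact hle

/-! ### Triangles -/

/-- The plane of the parameters of a triangle. -/
abbrev Plane : Type := EuclideanSpace ℝ (Fin 2)

/-- The reference triangle, whose vertices are the origin and the two unit vectors. -/
def refTriangle : Set Plane := {w | (∀ b, 0 ≤ w b) ∧ ∑ b, w b ≤ 1}

theorem isCompact_refTriangle : IsCompact refTriangle := by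
  have hcl : IsClosed refTriangle := by
    have h1 : IsClosed {w : Plane | ∀ b, 0 ≤ w b} := by
      simp only [ofPred_forall]
      exact isClosed_iInter fun b => isClosed_le continuous_const (by fun_prop)
    exact h1.inter (isClosed_le (f := fun w : Plane => ∑ b, w b) (by fun_prop) continuous_const)
  refine (isCompact_closedBall (0 : Plane) 2).of_isClosed_subset hcl fun w hw => ?_
  rw [mem_closedBall_zero_iff, EuclideanSpace.norm_eq]
  have h0 := hw.1 0
  have h1 := hw.1 1
  have h2 := hw.2
  rw [Fin.sum_univ_two] at h2
  rw [Real.sqrt_le_left (by norm_num), Fin.sum_univ_two]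
  simp only [Real.norm_eq_abs, sq_abs]
  nlinarith

theorem volume_refTriangle_ne_top : volume refTriangle ≠ ⊤ :=
  isCompact_refTriangle.measure_lt_top.ne

/-- In a triangle with angles in `[θ, π - θ]` the edges at a node are uniformly transversal. -/
theorem norm_add_norm_le_of_angle {E : Type*} [NormedAddCommGroup E] [InnerProductSpace ℝ E]
    {e f : E} {θ : ℝ} (hθ : 0 < θ) (h1 : θ ≤ InnerProductGeometry.angle e f)
    (h2 : InnerProductGeometry.angle e f ≤ Real.pi - θ) (α β : ℝ) :
    |α| * ‖e‖ + |β| * ‖f‖ ≤ √(2 / (1 - Real.cos θ)) * ‖α • e + β • f‖ := by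
  have hpi : θ ≤ Real.pi := h1.trans (InnerProductGeometry.angle_le_pi e f)
  have hc1 : Real.cos θ < 1 := by
    have := Real.cos_lt_cos_of_nonneg_of_le_pi le_rfl hpi hθ
    rwa [Real.cos_zero] at this
  have hcm : -1 ≤ Real.cos θ := Real.neg_one_le_cos θ
  have hγ1 : Real.cos (InnerProductGeometry.angle e f) ≤ Real.cos θ :=
    Real.cos_le_cos_of_nonneg_of_le_pi hθ.le (InnerProductGeometry.angle_le_pi e f) h1
  have hγ2 : -Real.cos θ ≤ Real.cos (InnerProductGeometry.angle e f) := by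
    rw [← Real.cos_pi_sub]
    exact Real.cos_le_cos_of_nonneg_of_le_pi (InnerProductGeometry.angle_nonneg e f)
      (by linarith) h2
  have hin := InnerProductGeometry.cos_angle_mul_norm_mul_norm e f
  set γ := Real.cos (InnerProductGeometry.angle e f)
  set c := Real.cos θ
  have hsq : (1 - c) * (|α| * ‖e‖ + |β| * ‖f‖) ^ 2 ≤ 2 * ‖α • e + β • f‖ ^ 2 := by
    rw [norm_add_sq_real, norm_smul, norm_smul, real_inner_smul_left, real_inner_smul_right, ← hin,
      Real.norm_eq_abs, Real.norm_eq_abs]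
    have hcross : -(c * ((|α| * ‖e‖) * (|β| * ‖f‖))) ≤ α * (β * (γ * (‖e‖ * ‖f‖))) := by
      have hγ : |γ| ≤ c := abs_le.2 ⟨hγ2, hγ1⟩
      have e1 : |α * (β * (γ * (‖e‖ * ‖f‖)))| = |γ| * ((|α| * ‖e‖) * (|β| * ‖f‖)) := by
        simp only [abs_mul, abs_norm]
        ring
      have h3 : |γ| * ((|α| * ‖e‖) * (|β| * ‖f‖)) ≤ c * ((|α| * ‖e‖) * (|β| * ‖f‖)) := by gcongr
      have h4 := neg_abs_le (α * (β * (γ * (‖e‖ * ‖f‖))))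
      linarith
    have hpq : 0 ≤ (1 + c) * (|α| * ‖e‖ - |β| * ‖f‖) ^ 2 := by
      have : 0 ≤ 1 + c := by linarith
      positivity
    nlinarith
  have hpos : 0 < 1 - c := by linarith
  refine le_trans (Real.le_sqrt_of_sq_le (y := 2 / (1 - c) * ‖α • e + β • f‖ ^ 2) ?_) ?_
  · rw [div_mul_eq_mul_div, le_div_iff₀ hpos]
    linarith
  · rw [Real.sqrt_mul (by positivity), Real.sqrt_sq (norm_nonneg _)]

namespace Mesh

variable (M : Mesh) (S : EvolvingSurface)

/-- The linear part of the affine parametrisation of the `i`-th triangle at time `t`. -/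
noncomputable def edgeMap (t : ℝ) (i : Fin M.numTriangles) : Plane →ₗ[ℝ] Space :=
  (Fintype.linearCombination ℝ (M.edge S t i)) ∘ₗ (WithLp.linearEquiv 2 ℝ (Fin 2 → ℝ)).toLinearMap

/-- The affine parametrisation of the `i`-th triangle at time `t`. -/
noncomputable def chart (t : ℝ) (i : Fin M.numTriangles) (w : Plane) : Space :=
  M.nodeAt S t (M.tri i 0) + M.edgeMap S t i w

/-- The ratio of the area of the `i`-th triangle at time `t` to that of the reference triangle. -/
noncomputable def jac (t : ℝ) (i : Fin M.numTriangles) : ℝ := (M.edgeMap S t i).normDet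

theorem jac_nonneg (t : ℝ) (i : Fin M.numTriangles) : 0 ≤ M.jac S t i :=
  LinearMap.normDet_nonneg _

theorem edgeMap_apply (t : ℝ) (i : Fin M.numTriangles) (w : Plane) :
    M.edgeMap S t i w = ∑ b, w b • M.edge S t i b := by
  simp [edgeMap, Fintype.linearCombination_apply]

theorem chart_sub_chart (t : ℝ) (i : Fin M.numTriangles) (w w' : Plane) :
    M.chart S t i w - M.chart S t i w' = M.edgeMap S t i (w - w') := by
  rw [chart, chart, map_sub]
  abel

theorem continuous_chart (t : ℝ) (i : Fin M.numTriangles) : Continuous (M.chart S t i) :=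
  continuous_const.add (M.edgeMap S t i).continuous_of_finiteDimensional

/-- The barycentric weights of the point with parameter `w` of the `i`-th triangle, extended by
zero to all nodes. -/
noncomputable def weights (i : Fin M.numTriangles) (w : Plane) (j : Fin M.numNodes) : ℝ :=
  ∑ a : Fin 3, if M.tri i a = j then (Fin.cons (1 - ∑ b, w b) w : Fin 3 → ℝ) a else 0

theorem sum_weights_mul (i : Fin M.numTriangles) (w : Plane) (v : Fin M.numNodes → ℝ) :
    ∑ j, v j * M.weights i w j =
      v (M.tri i 0) + ∑ b : Fin 2, w b * (v (M.tri i b.succ) - v (M.tri i 0)) := by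
  simp only [weights, Finset.mul_sum]
  rw [Finset.sum_comm]
  simp only [mul_ite, mul_zero, Finset.sum_ite_eq, Finset.mem_univ, if_true]
  simp [Fin.sum_univ_succ]
  ring

theorem sum_weights_smul (i : Fin M.numTriangles) (w : Plane) (v : Fin M.numNodes → Space) :
    ∑ j, M.weights i w j • v j =
      v (M.tri i 0) + ∑ b : Fin 2, w b • (v (M.tri i b.succ) - v (M.tri i 0)) := by
  simp only [weights, Finset.sum_smul]
  rw [Finset.sum_comm]
  simp only [ite_smul, zero_smul, Finset.sum_ite_eq, Finset.mem_univ, if_true]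
  simp [Fin.sum_univ_succ, smul_sub, sub_smul, add_smul]
  abel

theorem isBary_chart (t : ℝ) (i : Fin M.numTriangles) {w : Plane} (hw : w ∈ refTriangle) :
    M.IsBary S t (M.chart S t i w) (M.weights i w) := by
  refine ⟨fun j => Finset.sum_nonneg fun a _ => ?_, ?_, ?_, i, fun j hj => ?_⟩
  · split_ifs
    · refine Fin.cases ?_ (fun b => ?_) a
      · simpa using hw.2
      · simpa using hw.1 b
    · exact le_rfl
  · have := M.sum_weights_mul i w (fun _ => 1)
    simpa using this
  · rw [M.sum_weights_smul i w (M.nodeAt S t), chart, edgeMap_apply]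
    rfl
  · refine Finset.sum_eq_zero fun a _ => if_neg fun h => hj ⟨a, h⟩

theorem cell_eq_image (t : ℝ) (i : Fin M.numTriangles) :
    M.cell S t i = M.chart S t i '' refTriangle := by
  apply Subset.antisymm
  · have hconv : Convex ℝ refTriangle := by
      intro w hw w' hw' α β hα hβ hαβ
      refine ⟨fun b => ?_, ?_⟩
      · have h1 := hw.1 b
        have h2 := hw'.1 b
        simp only [PiLp.add_apply, PiLp.smul_apply, smul_eq_mul]
        positivity
      · have h1 := mul_le_mul_of_nonneg_left hw.2 hα
        have h2 := mul_le_mul_of_nonneg_left hw'.2 hβ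
        simp only [PiLp.add_apply, PiLp.smul_apply, smul_eq_mul, Finset.sum_add_distrib,
          ← Finset.mul_sum]
        linarith
    have himg : Convex ℝ (M.chart S t i '' refTriangle) := by
      have h1 := (hconv.linear_image (M.edgeMap S t i)).translate (M.nodeAt S t (M.tri i 0))
      rwa [image_image] at h1
    refine convexHull_min ?_ himg
    rintro _ ⟨a, rfl⟩
    refine Fin.cases ?_ (fun b => ?_) a
    · refine ⟨0, ⟨fun b => le_rfl, by simp⟩, ?_⟩
      simp [chart]
    · refine ⟨EuclideanSpace.single b 1, ⟨fun b' => ?_, ?_⟩, ?_⟩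
      · rw [PiLp.single_apply]
        split_ifs <;> norm_num
      · simp
      · simp [chart, edgeMap_apply, edge]
  · rintro _ ⟨w, hw, rfl⟩
    obtain ⟨h0, h1, h2, i', h3⟩ := M.isBary_chart S t i hw
    rw [chart, edgeMap_apply]
    have h := (convex_convexHull ℝ (range fun a => M.nodeAt S t (M.tri i a))).sum_mem
      (t := Finset.univ) (w := (Fin.cons (1 - ∑ b, w b) w : Fin 3 → ℝ))
      (z := fun a => M.nodeAt S t (M.tri i a)) (fun a _ => by
        refine Fin.cases ?_ (fun b => ?_) a
        · simpa using hw.2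
        · simpa using hw.1 b) (by simp [Fin.sum_univ_succ])
      (fun a _ => subset_convexHull ℝ _ (mem_range_self a))
    have e : M.nodeAt S t (M.tri i 0) + ∑ b, w b • M.edge S t i b =
        ∑ a : Fin 3, (Fin.cons (1 - ∑ b, w b) w : Fin 3 → ℝ) a • M.nodeAt S t (M.tri i a) := by
      simp [Fin.sum_univ_succ, edge, smul_sub, sub_smul, add_smul]
      abel
    rw [e]
    exact h

theorem cell_subset_surface (t : ℝ) (i : Fin M.numTriangles) : M.cell S t i ⊆ M.surface S t :=
  subset_iUnion (M.cell S t) i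

variable {M S} {θ : ℝ}

theorem IsAdmissible.basisFun_chart (hM : M.IsAdmissible S θ) {t : ℝ} (ht : t ∈ Icc 0 S.T)
    (i : Fin M.numTriangles) {w : Plane} (hw : w ∈ refTriangle) :
    M.basisFun S t (M.chart S t i w) = M.weights i w := by
  have h : ∃ w', M.IsBary S t (M.chart S t i w) w' := ⟨_, M.isBary_chart S t i hw⟩
  rw [basisFun, dif_pos h]
  exact IsBary.unique hM ht h.choose_spec (M.isBary_chart S t i hw)

variable (M) in
/-- The finite element function with the nodal values `v` on the `i`-th triangle, in terms of the
parameters; it does not depend on time. -/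
noncomputable def localFun (i : Fin M.numTriangles) (v : Fin M.numNodes → ℝ) (w : Plane) : ℝ :=
  v (M.tri i 0) + ∑ b : Fin 2, w b * (v (M.tri i b.succ) - v (M.tri i 0))

theorem IsAdmissible.feFun_chart (hM : M.IsAdmissible S θ) {t : ℝ} (ht : t ∈ Icc 0 S.T)
    (i : Fin M.numTriangles) (v : Fin M.numNodes → ℝ) {w : Plane} (hw : w ∈ refTriangle) :
    M.feFun S t v (M.chart S t i w) = M.localFun i v w := by
  rw [feFun, hM.basisFun_chart ht i hw, sum_weights_mul]
  rfl

theorem IsAdmissible.flowH_chart (hM : M.IsAdmissible S θ) {s : ℝ} (hs : s ∈ Icc 0 S.T) (t : ℝ)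
    (i : Fin M.numTriangles) {w : Plane} (hw : w ∈ refTriangle) :
    M.flowH S s t (M.chart S s i w) = M.chart S t i w := by
  rw [flowH, hM.basisFun_chart hs i hw, sum_weights_smul, chart, edgeMap_apply]
  rfl

theorem IsAdmissible.injective_edgeMap (hM : M.IsAdmissible S θ) {t : ℝ} (ht : t ∈ Icc 0 S.T)
    (i : Fin M.numTriangles) : Function.Injective (M.edgeMap S t i) := by
  have h' := (affineIndependent_iff_linearIndependent_vsub ℝ _ (0 : Fin 3)).1
    (hM.affineIndependent t ht i)
  have hli : LinearIndependent ℝ (M.edge S t i) :=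
    h'.comp (fun b : Fin 2 => (⟨b.succ, Fin.succ_ne_zero b⟩ : {a : Fin 3 // a ≠ 0}))
      (fun b b' hb => Fin.succ_injective _ (congrArg Subtype.val hb))
  refine (injective_iff_map_eq_zero _).2 fun w hw => ?_
  rw [edgeMap_apply] at hw
  ext b
  exact Fintype.linearIndependent_iff.1 hli _ hw b

end Mesh
namespace Mesh

/-! ### Transport of the triangles -/

variable {M : Mesh} {S : EvolvingSurface} {θ : ℝ}

/-- The constant of transversality of the edges of a triangle with angles at least `θ`. -/
noncomputable def angleConst (θ : ℝ) : ℝ := √(2 / (1 - Real.cos θ))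

theorem IsAdmissible.sum_abs_mul_norm_edge_le (hM : M.IsAdmissible S θ) (hθ : 0 < θ) {t : ℝ}
    (ht : t ∈ Icc 0 S.T) (i : Fin M.numTriangles) (w : Fin 2 → ℝ) :
    ∑ b, |w b| * ‖M.edge S t i b‖ ≤ angleConst θ * ‖∑ b, w b • M.edge S t i b‖ := by
  have h0 := hM.angle_ge t ht i 1 0 2 (by decide) (by decide) (by decide)
  have h1 := hM.angle_ge t ht i 0 1 2 (by decide) (by decide) (by decide)
  have h2 := EuclideanGeometry.angle_nonneg (M.nodeAt S t (M.tri i 1)) (M.nodeAt S t (M.tri i 2))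
    (M.nodeAt S t (M.tri i 0))
  have hne : M.nodeAt S t (M.tri i 1) ≠ M.nodeAt S t (M.tri i 0) :=
    (hM.affineIndependent t ht i).injective.ne (by decide)
  have hsum := EuclideanGeometry.angle_add_angle_add_angle_eq_pi (M.nodeAt S t (M.tri i 2)) hne
  rw [EuclideanGeometry.angle_comm (M.nodeAt S t (M.tri i 2))] at hsum
  rw [Fin.sum_univ_two, Fin.sum_univ_two]
  refine norm_add_norm_le_of_angle hθ h0 ?_ (w 0) (w 1)
  change EuclideanGeometry.angle (M.nodeAt S t (M.tri i 1)) (M.nodeAt S t (M.tri i 0))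
    (M.nodeAt S t (M.tri i 2)) ≤ _
  linarith

theorem IsAdmissible.norm_edgeMap_le (hM : M.IsAdmissible S θ) (hθ : 0 < θ) {K B : ℝ}
    (hF : S.FlowBounds K B) (i : Fin M.numTriangles) {s t : ℝ} (hs : s ∈ Icc 0 S.T)
    (ht : t ∈ Icc 0 S.T) (w : Plane) :
    ‖M.edgeMap S t i w‖ ≤ Real.exp (K * angleConst θ * |t - s|) * ‖M.edgeMap S s i w‖ := by
  have hsub : ‖M.edgeMap S t i w - M.edgeMap S s i w‖ ≤
      K * angleConst θ * |t - s| * ‖M.edgeMap S s i w‖ := by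
    rw [edgeMap_apply, edgeMap_apply, ← Finset.sum_sub_distrib]
    have h1 := mul_le_mul_of_nonneg_left (hM.sum_abs_mul_norm_edge_le hθ hs i w)
      (mul_nonneg hF.K_nonneg (abs_nonneg (t - s)))
    refine (norm_sum_le _ _).trans (le_trans ?_ (h1.trans_eq (by ring)))
    rw [Finset.mul_sum]
    refine Finset.sum_le_sum fun b _ => ?_
    rw [← smul_sub, norm_smul, Real.norm_eq_abs]
    have h2 := hF.variation _ (hM.node_mem (M.tri i b.succ)) _ (hM.node_mem (M.tri i 0)) s hs t ht
    have h3 := mul_le_mul_of_nonneg_left h2 (abs_nonneg (w b))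
    exact h3.trans_eq (by rw [edge, nodeAt, nodeAt]; ring)
  have h1 := norm_le_norm_add_norm_sub' (M.edgeMap S t i w) (M.edgeMap S s i w)
  have h2 := mul_le_mul_of_nonneg_right (Real.add_one_le_exp (K * angleConst θ * |t - s|))
    (norm_nonneg (M.edgeMap S s i w))
  linarith

theorem IsAdmissible.norm_chart_sub_le (hM : M.IsAdmissible S θ) {K B : ℝ}
    (hF : S.FlowBounds K B) (i : Fin M.numTriangles) {s t : ℝ} (hs : s ∈ Icc 0 S.T)
    (ht : t ∈ Icc 0 S.T) {w : Plane} (hw : w ∈ refTriangle) :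
    ‖M.chart S t i w - M.chart S s i w‖ ≤ B * |t - s| := by
  obtain ⟨h0, h1, h2, -⟩ := M.isBary_chart S t i hw
  obtain ⟨-, -, h3, -⟩ := M.isBary_chart S s i hw
  rw [← h2, ← h3, ← Finset.sum_sub_distrib]
  refine (norm_sum_le _ _).trans ?_
  calc _ ≤ ∑ j, M.weights i w j * (B * |t - s|) := by
        refine Finset.sum_le_sum fun j _ => ?_
        rw [← smul_sub, norm_smul, Real.norm_of_nonneg (h0 j)]
        exact mul_le_mul_of_nonneg_left (hF.speed _ (hM.node_mem j) s hs t ht) (h0 j)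
    _ = B * |t - s| := by rw [← Finset.sum_mul, h1, one_mul]

theorem isCompact_cell (t : ℝ) (i : Fin M.numTriangles) : IsCompact (M.cell S t i) := by
  rw [cell_eq_image]
  exact isCompact_refTriangle.image (M.continuous_chart S t i)

/-- Bounds, uniform in time, for the motion of the triangles of a mesh: the edges grow or shrink at
most at the exponential rate `c`, points of fixed barycentric coordinates have speed at most `B`,
and the normal projection is expanding on each triangle up to a factor two. -/
structure TransportBounds (M : Mesh) (S : EvolvingSurface) (c B : ℝ) : Prop where
  c_nonneg : 0 ≤ c
  B_nonneg : 0 ≤ B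
  growth : ∀ i, ∀ s ∈ Icc 0 S.T, ∀ t ∈ Icc 0 S.T, ∀ w,
    ‖M.edgeMap S t i w‖ ≤ Real.exp (c * |t - s|) * ‖M.edgeMap S s i w‖
  speed : ∀ i, ∀ s ∈ Icc 0 S.T, ∀ t ∈ Icc 0 S.T, ∀ w ∈ refTriangle,
    ‖M.chart S t i w - M.chart S s i w‖ ≤ B * |t - s|
  expanding : ∀ t ∈ Icc 0 S.T, ∀ i, ∀ x ∈ M.cell S t i, ∀ y ∈ M.cell S t i,
    ‖x - y‖ ≤ 2 * ‖S.proj t x - S.proj t y‖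

theorem exists_transportBounds (S : EvolvingSurface) {θ : ℝ} (hθ : 0 < θ) :
    ∃ c B h₀ : ℝ, 0 < h₀ ∧ ∀ M : Mesh, M.IsAdmissible S θ → M.meshSize S ≤ h₀ →
      M.TransportBounds S c B := by
  obtain ⟨K, B, hF⟩ := S.exists_flowBounds
  have hκ : 0 ≤ angleConst θ := Real.sqrt_nonneg _
  obtain ⟨h₁, hh₁, hproj⟩ := S.exists_proj_expanding (angleConst θ) hκ
  have hc : 0 ≤ K * angleConst θ := mul_nonneg hF.K_nonneg hκ
  refine ⟨K * angleConst θ, B, Real.exp (-(K * angleConst θ * S.T)) * h₁, by positivity,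
    fun M hM hh => ⟨hc, hF.B_nonneg, fun i s hs t ht w => hM.norm_edgeMap_le hθ hF i hs ht w,
      fun i s hs t ht w hw => hM.norm_chart_sub_le hF i hs ht hw, fun t ht i => ?_⟩⟩
  refine hproj t ht (M.cell S t i) (fun a => M.nodeAt S t (M.tri i a)) (convex_convexHull ℝ _)
    (fun a => subset_convexHull ℝ _ (mem_range_self a))
    (fun a => mem_image_of_mem _ (hM.node_mem _)) ?_ ?_
  · rw [cell_eq_image]
    rintro _ ⟨w, hw, rfl⟩ _ ⟨w', hw', rfl⟩
    have h1 := hM.norm_edgeMap_le hθ hF i S.zero_mem ht (w - w')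
    rw [← chart_sub_chart, ← chart_sub_chart, ← dist_eq_norm (M.chart S 0 i w)] at h1
    have h2 : dist (M.chart S 0 i w) (M.chart S 0 i w') ≤ M.meshSize S := by
      refine (Metric.dist_le_diam_of_mem (isCompact_cell 0 i).isBounded ?_ ?_).trans
        (le_ciSup (f := fun i => Metric.diam (M.cell S 0 i)) (finite_range _).bddAbove i)
      · rw [cell_eq_image]; exact mem_image_of_mem _ hw
      · rw [cell_eq_image]; exact mem_image_of_mem _ hw'
    have h3 : |t - 0| ≤ S.T := by rw [sub_zero, abs_of_nonneg ht.1]; exact ht.2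
    calc _ ≤ _ := h1
      _ ≤ Real.exp (K * angleConst θ * S.T) * (Real.exp (-(K * angleConst θ * S.T)) * h₁) := by
          gcongr
          exact h2.trans hh
      _ = h₁ := by rw [← mul_assoc, ← Real.exp_add, add_neg_cancel, Real.exp_zero, one_mul]
  · rw [cell_eq_image]
    rintro _ ⟨w, hw, rfl⟩ _ ⟨w', hw', rfl⟩
    have e : M.chart S t i w - M.chart S t i w' = ∑ b, (w - w') b • M.edge S t i b := by
      rw [chart_sub_chart, edgeMap_apply]
    refine ⟨(w - w' : Plane), e, ?_⟩
    rw [e]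
    exact hM.sum_abs_mul_norm_edge_le hθ ht i (w - w' : Plane)

theorem cellGrad_eq_edgeMap (t : ℝ) (i : Fin M.numTriangles) (v : Fin M.numNodes → ℝ) :
    ∃ w : Plane, M.cellGrad S t i v = M.edgeMap S t i w :=
  ⟨WithLp.toLp 2 _, by rw [edgeMap_apply]; rfl⟩

theorem IsAdmissible.inner_edgeMap_cellGrad (hM : M.IsAdmissible S θ) {t : ℝ} (ht : t ∈ Icc 0 S.T)
    (i : Fin M.numTriangles) (v : Fin M.numNodes → ℝ) (w : Plane) :
    inner ℝ (M.edgeMap S t i w) (M.cellGrad S t i v) =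
      ∑ b, w b * (v (M.tri i b.succ) - v (M.tri i 0)) := by
  rw [edgeMap_apply, sum_inner]
  refine Finset.sum_congr rfl fun b _ => ?_
  rw [real_inner_smul_left, M.inner_edge_cellGrad S (hM.affineIndependent t ht i)]

/-- Gradients grow at most at the rate of the edges: the gradient is dual to the edge map. -/
theorem TransportBounds.norm_cellGrad_le {c B : ℝ} (hB : M.TransportBounds S c B)
    (hM : M.IsAdmissible S θ) (i : Fin M.numTriangles) {s t : ℝ} (hs : s ∈ Icc 0 S.T)
    (ht : t ∈ Icc 0 S.T) (v : Fin M.numNodes → ℝ) :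
    ‖M.cellGrad S t i v‖ ≤ Real.exp (c * |t - s|) * ‖M.cellGrad S s i v‖ := by
  obtain ⟨w, hw⟩ := M.cellGrad_eq_edgeMap (S := S) t i v
  have h1 : ‖M.cellGrad S t i v‖ ^ 2 = inner ℝ (M.edgeMap S s i w) (M.cellGrad S s i v) := by
    rw [← real_inner_self_eq_norm_sq, hM.inner_edgeMap_cellGrad hs]
    nth_rewrite 1 [hw]
    rw [hM.inner_edgeMap_cellGrad ht]
  have h2 := real_inner_le_norm (M.edgeMap S s i w) (M.cellGrad S s i v)
  have h3 := mul_le_mul_of_nonneg_right (hB.growth i t ht s hs w)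
    (norm_nonneg (M.cellGrad S s i v))
  rw [← hw, abs_sub_comm] at h3
  rcases (norm_nonneg (M.cellGrad S t i v)).eq_or_lt with h0 | h0
  · rw [← h0]; positivity
  · refine le_of_mul_le_mul_left ?_ h0
    nlinarith

/-! ### Integration over the polyhedral surface -/

theorem euclideanHausdorffMeasure_image_chart (t : ℝ) (i : Fin M.numTriangles) (A : Set Plane) :
    μHE[2] (M.chart S t i '' A) = ENNReal.ofReal (M.jac S t i) * volume A := by
  have h := (M.edgeMap S t i).euclideanHausdorffMeasure_image_eq_normDet_mul_volume A
  rw [finrank_euclideanSpace_fin] at h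
  rw [jac, ← h, ← (isometry_add_left (M.nodeAt S t (M.tri i 0))).euclideanHausdorffMeasure_image
    (M.edgeMap S t i '' A), image_image]
  rfl

theorem IsAdmissible.injective_chart (hM : M.IsAdmissible S θ) {t : ℝ} (ht : t ∈ Icc 0 S.T)
    (i : Fin M.numTriangles) : Function.Injective (M.chart S t i) := fun _ _ h =>
  hM.injective_edgeMap ht i (add_left_cancel h)

theorem IsAdmissible.measurableEmbedding_chart (hM : M.IsAdmissible S θ) {t : ℝ}
    (ht : t ∈ Icc 0 S.T) (i : Fin M.numTriangles) : MeasurableEmbedding (M.chart S t i) :=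
  (M.continuous_chart S t i).measurableEmbedding (hM.injective_chart ht i)

theorem IsAdmissible.jac_pos (hM : M.IsAdmissible S θ) {t : ℝ} (ht : t ∈ Icc 0 S.T)
    (i : Fin M.numTriangles) : 0 < M.jac S t i :=
  (M.jac_nonneg S t i).lt_of_ne'
    (((M.edgeMap S t i).normDet_ne_zero_tfae.out 0 4).2 (hM.injective_edgeMap ht i))

theorem TransportBounds.jac_le {c B : ℝ} (hB : M.TransportBounds S c B)
    (i : Fin M.numTriangles) {s t : ℝ} (hs : s ∈ Icc 0 S.T) (ht : t ∈ Icc 0 S.T) :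
    M.jac S t i ≤ Real.exp (2 * c * |t - s|) * M.jac S s i := by
  have h := euclideanHausdorffMeasure_image_le_of_dist_le (f := M.chart S t i)
    (g := M.chart S s i) (A := Metric.ball 0 1) (C := Real.exp (c * |t - s|)) 2
    (fun x _ y _ => by
      rw [dist_eq_norm, dist_eq_norm, chart_sub_chart, chart_sub_chart]
      exact hB.growth i s hs t ht _)
  rw [euclideanHausdorffMeasure_image_chart, euclideanHausdorffMeasure_image_chart, ← mul_assoc,
    ← ENNReal.ofReal_pow (Real.exp_pos _).le, ← ENNReal.ofReal_mul (by positivity)] at h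
  have h' := (ENNReal.mul_le_mul_iff_left (Metric.measure_ball_pos volume (0 : Plane)
    one_pos).ne' measure_ball_lt_top.ne).1 h
  rw [ENNReal.ofReal_le_ofReal_iff (mul_nonneg (by positivity) (M.jac_nonneg S s i)),
    ← Real.exp_nat_mul] at h'
  convert h' using 3
  push_cast
  ring

theorem IsAdmissible.surfaceMeasure_cell (hM : M.IsAdmissible S θ) {t : ℝ} (ht : t ∈ Icc 0 S.T)
    (i : Fin M.numTriangles) : surfaceMeasure (M.cell S t i) =
      ENNReal.ofReal (M.jac S t i) • (volume.restrict refTriangle).map (M.chart S t i) := by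
  refine Measure.ext fun A hA => ?_
  rw [surfaceMeasure, Measure.restrict_apply hA, Measure.smul_apply,
    (hM.measurableEmbedding_chart ht i).map_apply, smul_eq_mul, cell_eq_image,
    Measure.restrict_apply ((M.continuous_chart S t i).measurable hA), inter_comm,
    image_inter_preimage .. |>.symm, euclideanHausdorffMeasure_image_chart, inter_comm]

/-- The vanishing set of a barycentric coordinate is a line, hence a null set. -/
theorem volume_setOf_bary_eq_zero (a : Fin 3) :
    volume {w : Plane | (Fin.cons (1 - ∑ b, w b) w : Fin 3 → ℝ) a = 0} = 0 := by
  obtain ⟨ℓ, r, u, hu, h⟩ : ∃ (ℓ : Plane →ₗ[ℝ] ℝ) (r : ℝ) (u : Plane), ℓ u ≠ 0 ∧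
      ∀ w : Plane, (Fin.cons (1 - ∑ b, w b) w : Fin 3 → ℝ) a = r - ℓ w := by
    refine Fin.cases ?_ (fun b => ?_) a
    · refine ⟨∑ b, EuclideanSpace.projₗ b, 1, EuclideanSpace.single 0 1, ?_, fun w => ?_⟩
      · simp
      · simp
    · refine ⟨-EuclideanSpace.projₗ b, 0, EuclideanSpace.single b 1, ?_, fun w => ?_⟩
      · simp
      · simp
  simp only [h]
  rcases {w : Plane | r - ℓ w = 0}.eq_empty_or_nonempty with h0 | ⟨p, hp⟩
  · rw [h0, measure_empty]
  · refine measure_mono_null (t := (AffineSubspace.mk' p (LinearMap.ker ℓ) : Set Plane)) ?_ ?_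
    · intro w hw
      have hw' : r - ℓ w = 0 := hw
      have hp' : r - ℓ p = 0 := hp
      rw [SetLike.mem_coe, AffineSubspace.mem_mk', vsub_eq_sub, LinearMap.mem_ker, map_sub]
      linarith
    · refine Measure.addHaar_affineSubspace _ _ fun htop => hu ?_
      have := congrArg AffineSubspace.direction htop
      rw [AffineSubspace.direction_mk', AffineSubspace.direction_top] at this
      exact LinearMap.mem_ker.1 (this ▸ Submodule.mem_top)

theorem IsAdmissible.injective_tri (hM : M.IsAdmissible S θ) (i : Fin M.numTriangles) :
    Function.Injective (M.tri i) := fun a b hab =>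
  (hM.affineIndependent 0 S.zero_mem i).injective (by simp [hab])

/-- Two distinct triangles overlap in a set of measure zero: one of the barycentric coordinates
vanishes on it. -/
theorem IsAdmissible.aedisjoint_cell (hM : M.IsAdmissible S θ) {t : ℝ} (ht : t ∈ Icc 0 S.T)
    {i i' : Fin M.numTriangles} (hi : i ≠ i') :
    AEDisjoint (μHE[2] : Measure Space) (M.cell S t i) (M.cell S t i') := by
  obtain ⟨a, ha⟩ : ∃ a, M.tri i a ∉ range (M.tri i') := by
    by_contra! hcon
    refine hi (hM.tri_distinct i i' ?_)
    refine eq_of_subset_of_ncard_le (range_subset_iff.2 hcon) ?_ (finite_range _)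
    rw [← image_univ, ← image_univ, ncard_image_of_injective _ (hM.injective_tri i),
      ncard_image_of_injective _ (hM.injective_tri i')]
  have hsub : M.cell S t i ∩ M.cell S t i' ⊆
      M.chart S t i '' {w : Plane | (Fin.cons (1 - ∑ b, w b) w : Fin 3 → ℝ) a = 0} := by
    rw [cell_eq_image, cell_eq_image]
    rintro _ ⟨⟨w, hw, rfl⟩, ⟨w', hw', hww⟩⟩
    refine ⟨w, ?_, rfl⟩
    have h1 := M.isBary_chart S t i' hw'
    rw [hww] at h1
    have h2 := congrFun (IsBary.unique hM ht (M.isBary_chart S t i hw) h1) (M.tri i a)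
    have h3 : M.weights i' w' (M.tri i a) = 0 :=
      Finset.sum_eq_zero fun b _ => if_neg fun hb => ha ⟨b, hb⟩
    rw [h3, weights, Finset.sum_eq_single a (fun b _ hb => if_neg ((hM.injective_tri i).ne hb))
      (by simp), if_pos rfl] at h2
    exact h2
  refine measure_mono_null hsub ?_
  rw [euclideanHausdorffMeasure_image_chart, volume_setOf_bary_eq_zero, mul_zero]

theorem IsAdmissible.surfaceMeasure_surface (hM : M.IsAdmissible S θ) {t : ℝ}
    (ht : t ∈ Icc 0 S.T) : surfaceMeasure (M.surface S t) =
      ∑ i, ENNReal.ofReal (M.jac S t i) • (volume.restrict refTriangle).map (M.chart S t i) := by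
  rw [surfaceMeasure, surface, Measure.restrict_iUnion_ae
    (fun i i' hi => hM.aedisjoint_cell ht hi)
    (fun i => (isCompact_cell t i).isClosed.measurableSet.nullMeasurableSet), Measure.sum_fintype]
  exact Finset.sum_congr rfl fun i _ => hM.surfaceMeasure_cell ht i

theorem IsAdmissible.integral_cell (hM : M.IsAdmissible S θ) {t : ℝ} (ht : t ∈ Icc 0 S.T)
    (i : Fin M.numTriangles) (F : Space → ℝ) :
    ∫ x, F x ∂surfaceMeasure (M.cell S t i) =
      M.jac S t i * ∫ w in refTriangle, F (M.chart S t i w) := by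
  rw [hM.surfaceMeasure_cell ht, integral_smul_measure,
    (hM.measurableEmbedding_chart ht i).integral_map, ENNReal.toReal_ofReal (M.jac_nonneg S t i),
    smul_eq_mul]

theorem IsAdmissible.integral_surface (hM : M.IsAdmissible S θ) {t : ℝ} (ht : t ∈ Icc 0 S.T)
    {F : Space → ℝ} (hF : ∀ i, IntegrableOn (fun w => F (M.chart S t i w)) refTriangle) :
    ∫ x, F x ∂surfaceMeasure (M.surface S t) =
      ∑ i, M.jac S t i * ∫ w in refTriangle, F (M.chart S t i w) := by
  rw [hM.surfaceMeasure_surface ht, integral_finsetSum_measure fun i _ => ?_]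
  · refine Finset.sum_congr rfl fun i _ => ?_
    rw [← hM.integral_cell ht, hM.surfaceMeasure_cell ht]
  · exact (((hM.measurableEmbedding_chart ht i).integrable_map_iff).2 (hF i)).smul_measure
      ENNReal.ofReal_ne_top

theorem IsAdmissible.lintegral_surface (hM : M.IsAdmissible S θ) {t : ℝ} (ht : t ∈ Icc 0 S.T)
    (F : Space → ℝ≥0∞) :
    ∫⁻ x, F x ∂surfaceMeasure (M.surface S t) =
      ∑ i, ENNReal.ofReal (M.jac S t i) * ∫⁻ w in refTriangle, F (M.chart S t i w) := by
  rw [hM.surfaceMeasure_surface ht, lintegral_finsetSum_measure]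
  refine Finset.sum_congr rfl fun i _ => ?_
  rw [lintegral_smul_measure, (hM.measurableEmbedding_chart ht i).lintegral_map, smul_eq_mul]

end Mesh
namespace Mesh

/-! ### The bilinear forms of the finite element problems -/

variable {M : Mesh} {S : EvolvingSurface} {θ : ℝ}

theorem continuous_localFun (i : Fin M.numTriangles) (v : Fin M.numNodes → ℝ) :
    Continuous (M.localFun i v) := by
  unfold localFun
  fun_prop

theorem localFun_add (i : Fin M.numTriangles) (u v : Fin M.numNodes → ℝ) (w : Plane) :
    M.localFun i (u + v) w = M.localFun i u w + M.localFun i v w := by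
  simp only [localFun, Pi.add_apply, Fin.sum_univ_two]
  ring

theorem localFun_smul (i : Fin M.numTriangles) (r : ℝ) (v : Fin M.numNodes → ℝ) (w : Plane) :
    M.localFun i (r • v) w = r * M.localFun i v w := by
  simp only [localFun, Pi.smul_apply, smul_eq_mul, Fin.sum_univ_two]
  ring

theorem integrableOn_cell {ρ : Plane → ℝ} (hρ : ContinuousOn ρ refTriangle)
    (i : Fin M.numTriangles) (r : ℝ) (u v : Fin M.numNodes → ℝ) :
    IntegrableOn (fun w => r + ρ w * M.localFun i u w * M.localFun i v w) refTriangle :=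
  (continuousOn_const.add ((hρ.mul (continuous_localFun i u).continuousOn).mul
    (continuous_localFun i v).continuousOn)).integrableOn_compact isCompact_refTriangle

/-- A form composed of contributions of the triangles, each with an area element `J`, a gradient
part given by `D`, and a weight `ρ`. -/
theorem exists_nodalForm (J : Fin M.numTriangles → ℝ)
    (D : Fin M.numTriangles → (Fin M.numNodes → ℝ) →ₗ[ℝ] Space)
    (ρ : Fin M.numTriangles → Plane → ℝ) (hρ : ∀ i, ContinuousOn (ρ i) refTriangle) :
    ∃ B : NodalForm (Fin M.numNodes), ∀ u v, B u v = ∑ i, J i * ∫ w in refTriangle,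
      (inner ℝ (D i u) (D i v) + ρ i w * M.localFun i u w * M.localFun i v w) := by
  set F : (Fin M.numNodes → ℝ) → (Fin M.numNodes → ℝ) → ℝ := fun u v =>
    ∑ i, J i * ∫ w in refTriangle,
      (inner ℝ (D i u) (D i v) + ρ i w * M.localFun i u w * M.localFun i v w) with hF
  have hadd : ∀ u u' v, F (u + u') v = F u v + F u' v := by
    intro u u' v
    rw [hF]
    simp only
    rw [← Finset.sum_add_distrib]
    refine Finset.sum_congr rfl fun i _ => ?_
    rw [← mul_add, ← integral_add (integrableOn_cell (hρ i) i _ u v)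
      (integrableOn_cell (hρ i) i _ u' v)]
    congr 2
    funext w
    rw [map_add, inner_add_left, localFun_add]
    ring
  have hsmul : ∀ (r : ℝ) u v, F (r • u) v = r • F u v := by
    intro r u v
    rw [hF]
    simp only
    rw [smul_eq_mul, Finset.mul_sum]
    refine Finset.sum_congr rfl fun i _ => ?_
    rw [mul_left_comm, ← integral_const_mul r]
    congr 2
    funext w
    rw [map_smul, real_inner_smul_left, localFun_smul]
    ring
  have hcomm : ∀ u v, F u v = F v u := by
    intro u v
    refine Finset.sum_congr rfl fun i _ => ?_
    congr 2
    funext w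
    rw [real_inner_comm]
    ring
  exact ⟨LinearMap.mk₂ ℝ F hadd hsmul
    (fun u v v' => by rw [hcomm u, hadd, hcomm v, hcomm v'])
    (fun r u v => by rw [hcomm u, hsmul, hcomm v]), fun u v => rfl⟩

/-- If the area elements, the gradients and the weights grow at most at the rates `2c`, `c` and `κ`,
then the form grows at most at the rate `4c + κ`. -/
theorem evolvingForm_of_cells {T c κ : ℝ} (hT : 0 < T) (hc : 0 ≤ c) (hκ : 0 ≤ κ)
    {J : ℝ → Fin M.numTriangles → ℝ} {D : ℝ → Fin M.numTriangles → (Fin M.numNodes → ℝ) → Space}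
    {ρ : ℝ → Fin M.numTriangles → Plane → ℝ} (hJ0 : ∀ t ∈ Icc 0 T, ∀ i, 0 ≤ J t i)
    (hρ : ∀ t ∈ Icc 0 T, ∀ i, ContinuousOn (ρ t i) refTriangle)
    (hρ0 : ∀ t ∈ Icc 0 T, ∀ i, ∀ w ∈ refTriangle, 0 ≤ ρ t i w)
    (hJ : ∀ i, ∀ s ∈ Icc 0 T, ∀ t ∈ Icc 0 T, J t i ≤ Real.exp (2 * c * |t - s|) * J s i)
    (hD : ∀ i, ∀ s ∈ Icc 0 T, ∀ t ∈ Icc 0 T, ∀ u,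
      ‖D t i u‖ ≤ Real.exp (c * |t - s|) * ‖D s i u‖)
    (hgr : ∀ i, ∀ s ∈ Icc 0 T, ∀ t ∈ Icc 0 T, ∀ w ∈ refTriangle,
      ρ t i w ≤ Real.exp (κ * |t - s|) * ρ s i w)
    {B : ℝ → NodalForm (Fin M.numNodes)}
    (hB : ∀ t ∈ Icc 0 T, ∀ u v, B t u v = ∑ i, J t i * ∫ w in refTriangle,
      (inner ℝ (D t i u) (D t i v) + ρ t i w * M.localFun i u w * M.localFun i v w)) :
    EvolvingForm T (4 * c + κ) B where
  T_pos := hT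
  c_nonneg := by positivity
  symm t ht u v := by
    rw [hB t ht, hB t ht]
    refine Finset.sum_congr rfl fun i _ => ?_
    congr 2
    funext w
    rw [real_inner_comm]
    ring
  nonneg t ht u := by
    rw [hB t ht]
    refine Finset.sum_nonneg fun i _ => mul_nonneg (hJ0 t ht i) ?_
    refine setIntegral_nonneg isCompact_refTriangle.measurableSet fun w hw => ?_
    rw [mul_assoc]
    exact add_nonneg real_inner_self_nonneg (mul_nonneg (hρ0 t ht i w hw) (mul_self_nonneg _))
  growth s hs t ht u := by
    rw [hB t ht, hB s hs, Finset.mul_sum]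
    refine Finset.sum_le_sum fun i _ => ?_
    have hint : ∫ w in refTriangle,
        (inner ℝ (D t i u) (D t i u) + ρ t i w * M.localFun i u w * M.localFun i u w) ≤
        Real.exp ((2 * c + κ) * |t - s|) * ∫ w in refTriangle,
          (inner ℝ (D s i u) (D s i u) + ρ s i w * M.localFun i u w * M.localFun i u w) := by
      rw [← integral_const_mul]
      refine setIntegral_mono_on (integrableOn_cell (hρ t ht i) i _ u u)
        ((integrableOn_cell (hρ s hs i) i _ u u).const_mul _)
        isCompact_refTriangle.measurableSet fun w hw => ?_
      rw [real_inner_self_eq_norm_sq, real_inner_self_eq_norm_sq, mul_assoc, mul_assoc, mul_add]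
      have h1 : ‖D t i u‖ ^ 2 ≤ Real.exp ((2 * c + κ) * |t - s|) * ‖D s i u‖ ^ 2 := by
        calc _ ≤ (Real.exp (c * |t - s|) * ‖D s i u‖) ^ 2 := by
              gcongr
              exact hD i s hs t ht u
          _ = Real.exp (2 * c * |t - s|) * ‖D s i u‖ ^ 2 := by
              rw [mul_pow, ← Real.exp_nat_mul]
              push_cast
              ring_nf
          _ ≤ _ := by
              gcongr
              linarith
      have h2 : ρ t i w ≤ Real.exp ((2 * c + κ) * |t - s|) * ρ s i w := by
        refine (hgr i s hs t ht w hw).trans ?_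
        have := hρ0 s hs i w hw
        gcongr
        linarith
      have h3 := mul_le_mul_of_nonneg_right h2 (mul_self_nonneg (M.localFun i u w))
      linarith
    have hnn : 0 ≤ ∫ w in refTriangle,
        (inner ℝ (D t i u) (D t i u) + ρ t i w * M.localFun i u w * M.localFun i u w) := by
      refine setIntegral_nonneg isCompact_refTriangle.measurableSet fun w hw => ?_
      rw [mul_assoc]
      exact add_nonneg real_inner_self_nonneg (mul_nonneg (hρ0 t ht i w hw) (mul_self_nonneg _))
    have hJs := hJ0 s hs i
    calc _ ≤ (Real.exp (2 * c * |t - s|) * J s i) * _ := mul_le_mul (hJ i s hs t ht) hint hnn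
          (by positivity)
      _ = _ := by
          rw [show (4 * c + κ) * |t - s| = 2 * c * |t - s| + (2 * c + κ) * |t - s| by ring,
            Real.exp_add]
          ring

variable (M S) in
/-- The gradient on the `i`-th triangle as a linear map of the nodal values. -/
noncomputable def gradMap (t : ℝ) (i : Fin M.numTriangles) :
    (Fin M.numNodes → ℝ) →ₗ[ℝ] Space where
  toFun := M.cellGrad S t i
  map_add' u v := by
    have e : (fun b : Fin 2 => (u + v) (M.tri i b.succ) - (u + v) (M.tri i 0)) =
        (fun b => u (M.tri i b.succ) - u (M.tri i 0)) +
          fun b => v (M.tri i b.succ) - v (M.tri i 0) := by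
      funext b
      simp only [Pi.add_apply]
      ring
    unfold cellGrad
    rw [e, Matrix.mulVec_add]
    simp only [Pi.add_apply, add_smul, Finset.sum_add_distrib]
  map_smul' r v := by
    have e : (fun b : Fin 2 => (r • v) (M.tri i b.succ) - (r • v) (M.tri i 0)) =
        r • fun b => v (M.tri i b.succ) - v (M.tri i 0) := by
      funext b
      simp only [Pi.smul_apply, smul_eq_mul]
      ring
    unfold cellGrad
    rw [e, Matrix.mulVec_smul]
    simp only [Pi.smul_apply, Finset.smul_sum, smul_assoc, RingHom.id_apply]

theorem IsAdmissible.massForm_eq (hM : M.IsAdmissible S θ) {t : ℝ} (ht : t ∈ Icc 0 S.T)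
    (u v : Fin M.numNodes → ℝ) : M.massForm S t u v =
      ∑ i, M.jac S t i * ∫ w in refTriangle, M.localFun i u w * M.localFun i v w := by
  have e : ∀ i, EqOn (fun w => M.feFun S t u (M.chart S t i w) * M.feFun S t v (M.chart S t i w))
      (fun w => M.localFun i u w * M.localFun i v w) refTriangle := fun i w hw => by
    simp only [hM.feFun_chart ht i _ hw]
  rw [massForm, hM.integral_surface ht fun i => ?_]
  · exact Finset.sum_congr rfl fun i _ => congrArg _
      (setIntegral_congr_fun isCompact_refTriangle.measurableSet (e i))
  · exact (((continuous_localFun i u).mul (continuous_localFun i v)).continuousOn.congr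
      (e i)).integrableOn_compact isCompact_refTriangle

theorem IsAdmissible.energyForm_eq (hM : M.IsAdmissible S θ) (lam : Space × ℝ → ℝ) {t : ℝ}
    (ht : t ∈ Icc 0 S.T) (u v : Fin M.numNodes → ℝ) : M.energyForm S lam t u v =
      ∑ i, M.jac S t i * ∫ w in refTriangle, (inner ℝ (M.gradMap S t i u) (M.gradMap S t i v) +
        lam (M.chart S t i w, t) * M.localFun i u w * M.localFun i v w) := by
  refine Finset.sum_congr rfl fun i _ => ?_
  rw [hM.integral_cell ht]
  refine congrArg _ (setIntegral_congr_fun isCompact_refTriangle.measurableSet fun w hw => ?_)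
  simp only [hM.feFun_chart ht i _ hw]
  rfl

theorem chart_mem_cell (t : ℝ) (i : Fin M.numTriangles) {w : Plane} (hw : w ∈ refTriangle) :
    M.chart S t i w ∈ M.cell S t i := by
  rw [cell_eq_image]
  exact mem_image_of_mem _ hw

theorem chart_mem_spaceTime {t : ℝ} (ht : t ∈ Icc 0 S.T) (i : Fin M.numTriangles) {w : Plane}
    (hw : w ∈ refTriangle) : (M.chart S t i w, t) ∈ M.spaceTime S :=
  ⟨ht, M.cell_subset_surface S t i (chart_mem_cell t i hw)⟩

theorem continuousOn_comp_chart {lam : Space × ℝ → ℝ} (hlam : ContinuousOn lam (M.spaceTime S))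
    {t : ℝ} (ht : t ∈ Icc 0 S.T) (i : Fin M.numTriangles) :
    ContinuousOn (fun w => lam (M.chart S t i w, t)) refTriangle :=
  hlam.comp (((M.continuous_chart S t i).prodMk continuous_const).continuousOn)
    fun _ hw => chart_mem_spaceTime ht i hw

/-- The mass form has weight one and no gradient part; `κ` may be chosen at will, so that the mass
and the energy form can share a growth rate. -/
theorem TransportBounds.exists_massForm {c B κ : ℝ} (hB : M.TransportBounds S c B)
    (hM : M.IsAdmissible S θ) (hκ : 0 ≤ κ) : ∃ m : ℝ → NodalForm (Fin M.numNodes),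
      (∀ t ∈ Icc 0 S.T, ∀ u v, m t u v = M.massForm S t u v) ∧
        EvolvingForm S.T (4 * c + κ) m := by
  choose m hm using fun t : ℝ => M.exists_nodalForm (M.jac S t) 0 (fun _ _ => 1)
    (fun _ => continuousOn_const)
  refine ⟨m, fun t ht u v => ?_, ?_⟩
  · rw [hm, hM.massForm_eq ht]
    simp
  · refine evolvingForm_of_cells (J := M.jac S) (D := fun _ _ => 0) (ρ := fun _ _ _ => 1)
      S.T_pos hB.c_nonneg hκ (fun t _ i => M.jac_nonneg S t i) (fun _ _ _ => continuousOn_const)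
      (fun _ _ _ _ _ => zero_le_one) (fun i s hs t ht => hB.jac_le i hs ht) ?_ ?_
      (fun t _ u v => hm t u v)
    · intro i s _ t _ u
      simp
    · intro i s _ t _ w _
      rw [mul_one]
      exact Real.one_le_exp (by positivity)

theorem TransportBounds.exists_energyForm {c B : ℝ} {L : ℝ≥0} (hB : M.TransportBounds S c B)
    (hM : M.IsAdmissible S θ) {lam : Space × ℝ → ℝ} (h1 : ∀ q ∈ M.spaceTime S, 1 ≤ lam q)
    (hL : LipschitzOnWith L lam (M.spaceTime S)) : ∃ a : ℝ → NodalForm (Fin M.numNodes),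
      (∀ t ∈ Icc 0 S.T, ∀ u v, a t u v = M.energyForm S lam t u v) ∧
        EvolvingForm S.T (4 * c + L * (B + 1)) a := by
  have hB0 := hB.B_nonneg
  have hex : ∀ t : ℝ, ∃ A : NodalForm (Fin M.numNodes), t ∈ Icc 0 S.T → ∀ u v, A u v =
      ∑ i, M.jac S t i * ∫ w in refTriangle, (inner ℝ (M.gradMap S t i u) (M.gradMap S t i v) +
        lam (M.chart S t i w, t) * M.localFun i u w * M.localFun i v w) := by
    intro t
    by_cases ht : t ∈ Icc 0 S.T
    · obtain ⟨A, hA⟩ := M.exists_nodalForm (M.jac S t) (M.gradMap S t)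
        (fun i w => lam (M.chart S t i w, t)) (continuousOn_comp_chart hL.continuousOn ht)
      exact ⟨A, fun _ => hA⟩
    · exact ⟨0, fun h => absurd h ht⟩
  choose a ha using hex
  refine ⟨a, fun t ht u v => by rw [ha t ht, hM.energyForm_eq lam ht], ?_⟩
  refine evolvingForm_of_cells (J := M.jac S) (D := fun t i u => M.gradMap S t i u)
    (ρ := fun t i w => lam (M.chart S t i w, t))
    S.T_pos hB.c_nonneg (by positivity) (fun t _ i => M.jac_nonneg S t i)
    (fun t ht => continuousOn_comp_chart hL.continuousOn ht)
    (fun t ht i w hw => zero_le_one.trans (h1 _ (chart_mem_spaceTime ht i hw)))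
    (fun i s hs t ht => hB.jac_le i hs ht)
    (fun i s hs t ht u => hB.norm_cellGrad_le hM i hs ht u) ?_ ha
  intro i s hs t ht w hw
  have hd := hL.dist_le_mul _ (chart_mem_spaceTime ht i hw) _ (chart_mem_spaceTime hs i hw)
  have hd2 : dist (M.chart S t i w, t) (M.chart S s i w, s) ≤ (B + 1) * |t - s| := by
    rw [Prod.dist_eq, dist_eq_norm, Real.dist_eq]
    have := hB.speed i s hs t ht w hw
    have h0 := abs_nonneg (t - s)
    exact max_le (by linarith) (by nlinarith)
  have h3 := h1 _ (chart_mem_spaceTime hs i hw)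
  rw [Real.dist_eq] at hd
  have h4 := (le_abs_self _).trans (hd.trans (mul_le_mul_of_nonneg_left hd2 L.2))
  have h5 := Real.add_one_le_exp ((L : ℝ) * (B + 1) * |t - s|)
  have h6 : 0 ≤ (L : ℝ) * (B + 1) * |t - s| := by positivity
  have h7 : (L : ℝ) * ((B + 1) * |t - s|) = L * (B + 1) * |t - s| := by ring
  nlinarith

theorem IsAdmissible.energyForm_le_energyForm (hM : M.IsAdmissible S θ) {lam lam' : Space × ℝ → ℝ}
    (hc : ContinuousOn lam (M.spaceTime S)) (hc' : ContinuousOn lam' (M.spaceTime S))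
    (h : ∀ q ∈ M.spaceTime S, lam q ≤ lam' q) {t : ℝ} (ht : t ∈ Icc 0 S.T)
    (u : Fin M.numNodes → ℝ) : M.energyForm S lam t u u ≤ M.energyForm S lam' t u u := by
  rw [hM.energyForm_eq lam ht, hM.energyForm_eq lam' ht]
  refine Finset.sum_le_sum fun i _ => mul_le_mul_of_nonneg_left ?_ (M.jac_nonneg S t i)
  refine setIntegral_mono_on (integrableOn_cell (continuousOn_comp_chart hc ht i) i _ u u)
    (integrableOn_cell (continuousOn_comp_chart hc' ht i) i _ u u)
    isCompact_refTriangle.measurableSet fun w hw => ?_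
  rw [mul_assoc, mul_assoc]
  have := mul_le_mul_of_nonneg_right (h _ (chart_mem_spaceTime ht i hw))
    (mul_self_nonneg (M.localFun i u w))
  linarith

theorem IsAdmissible.massForm_le_energyForm (hM : M.IsAdmissible S θ) {lam : Space × ℝ → ℝ}
    (hc : ContinuousOn lam (M.spaceTime S)) (h : ∀ q ∈ M.spaceTime S, 1 ≤ lam q) {t : ℝ}
    (ht : t ∈ Icc 0 S.T) (u : Fin M.numNodes → ℝ) :
    M.massForm S t u u ≤ M.energyForm S lam t u u := by
  rw [hM.energyForm_eq lam ht, hM.massForm_eq ht]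
  refine Finset.sum_le_sum fun i _ => mul_le_mul_of_nonneg_left ?_ (M.jac_nonneg S t i)
  refine setIntegral_mono_on (((continuous_localFun i u).mul
    (continuous_localFun i u)).continuousOn.integrableOn_compact isCompact_refTriangle)
    (integrableOn_cell (continuousOn_comp_chart hc ht i) i _ u u)
    isCompact_refTriangle.measurableSet fun w hw => ?_
  have h1 := mul_le_mul_of_nonneg_right (h _ (chart_mem_spaceTime ht i hw))
    (mul_self_nonneg (M.localFun i u w))
  have h2 : 0 ≤ inner ℝ (M.gradMap S t i u) (M.gradMap S t i u) := real_inner_self_nonneg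
  rw [mul_assoc]
  linarith

end Mesh

/-! ### Change of variables under the normal projection -/

theorem eLpNorm_two_sq {α : Type*} [MeasurableSpace α] (μ : Measure α) (f : α → ℝ) :
    eLpNorm f 2 μ ^ 2 = ∫⁻ x, ‖f x‖ₑ ^ 2 ∂μ := by
  rw [eLpNorm_eq_lintegral_rpow_enorm_toReal (by norm_num) (by norm_num), ← ENNReal.rpow_natCast,
    ← ENNReal.rpow_mul]
  simp

/-- A homeomorphism that is expanding, up to the factor `C`, on each set of a finite cover
decreases two-dimensional integrals at most by the factor `C²`. The integrand need not be
measurable. -/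
theorem lintegral_comp_homeomorph_le {A B : Set Space} (hA : MeasurableSet A)
    (hB : MeasurableSet B) (e : A ≃ₜ B) {n : ℕ} {K : Fin n → Set A}
    (hK : ∀ i, MeasurableSet (K i)) (hcov : ∀ x, ∃ i, x ∈ K i) {C : ℝ}
    (hC : ∀ i, ∀ x ∈ K i, ∀ y ∈ K i,
      dist (x : Space) y ≤ C * dist (e x : Space) (e y : Space))
    {g : Space → Space} (hg : ∀ x : A, (e x : Space) = g x) (F : Space → ℝ≥0∞) :
    ∫⁻ x in A, F (g x) ∂μHE[2] ≤ ENNReal.ofReal C ^ 2 * ∫⁻ y in B, F y ∂μHE[2] := by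
  set μA : Measure A := (μHE[2] : Measure Space).comap (↑) with hμA
  set μB : Measure B := (μHE[2] : Measure Space).comap (↑) with hμB
  -- make the cover disjoint
  set D : Fin n → Set A := fun i => K i \ ⋃ j, ⋃ _ : j < i, K j with hD
  have hDm : ∀ i, MeasurableSet (D i) := fun i =>
    (hK i).diff (MeasurableSet.iUnion fun j => MeasurableSet.iUnion fun _ => hK j)
  have hDlt : ∀ i j, i < j → Disjoint (D i) (D j) := fun i j hij =>
    disjoint_left.2 fun x hx hx' => hx'.2 (mem_iUnion₂.2 ⟨i, hij, hx.1⟩)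
  have hDd : Pairwise (fun i j => Disjoint (D i) (D j)) := fun i j hij =>
    hij.lt_or_gt.elim (hDlt i j) fun h => (hDlt j i h).symm
  have hDu : ∀ x, ∃ i, x ∈ D i := by
    intro x
    obtain ⟨i, hi, hmin⟩ := WellFounded.has_min (wellFounded_lt (α := Fin n)) {i | x ∈ K i}
      (hcov x)
    refine ⟨i, hi, fun hx => ?_⟩
    obtain ⟨j, hj, hxj⟩ := mem_iUnion₂.1 hx
    exact hmin j hxj hj
  have hmap : μA.map e ≤ (ENNReal.ofReal C ^ 2) • μB := by
    refine Measure.le_intro fun E hE _ => ?_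
    rw [Measure.map_apply e.continuous.measurable hE, Measure.smul_apply, smul_eq_mul]
    have hEm : MeasurableSet (e ⁻¹' E) := e.continuous.measurable hE
    have hsplit : e ⁻¹' E = ⋃ i, e ⁻¹' E ∩ D i := by
      rw [← inter_iUnion, eq_univ_of_forall fun x => mem_iUnion.2 (hDu x), inter_univ]
    have hle : ∀ i, μA (e ⁻¹' E ∩ D i) ≤
        ENNReal.ofReal C ^ 2 * μB (e '' (e ⁻¹' E ∩ D i)) := by
      intro i
      rw [hμA, hμB, comap_subtype_coe_apply hA, comap_subtype_coe_apply hB, image_image]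
      exact euclideanHausdorffMeasure_image_le_of_dist_le (f := ((↑) : A → Space))
        (g := fun x => (e x : Space)) 2 fun x hx y hy => hC i x hx.2.1 y hy.2.1
    have himg : ⋃ i, e '' (e ⁻¹' E ∩ D i) ⊆ E :=
      iUnion_subset fun i => by rintro _ ⟨x, hx, rfl⟩; exact hx.1
    calc μA (e ⁻¹' E) ≤ ∑ i, μA (e ⁻¹' E ∩ D i) := by
          rw [hsplit]
          refine (measure_iUnion_le _).trans_eq ?_
          rw [tsum_fintype, ← hsplit]
      _ ≤ ∑ i, ENNReal.ofReal C ^ 2 * μB (e '' (e ⁻¹' E ∩ D i)) :=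
          Finset.sum_le_sum fun i _ => hle i
      _ = ENNReal.ofReal C ^ 2 * μB (⋃ i, e '' (e ⁻¹' E ∩ D i)) := by
          rw [measure_iUnion, tsum_fintype, Finset.mul_sum]
          · intro i j hij
            exact (disjoint_image_iff e.injective).2
              ((hDd hij).mono inter_subset_right inter_subset_right)
          · exact fun i => e.toMeasurableEquiv.measurableEmbedding.measurableSet_image.2
              (hEm.inter (hDm i))
      _ ≤ _ := by gcongr
  calc ∫⁻ x in A, F (g x) ∂μHE[2] = ∫⁻ x : A, F (e x) ∂μA := by
        rw [← lintegral_subtype_comap hA]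
        simp only [hg]
        rfl
    _ = ∫⁻ y : B, F y ∂(μA.map e) :=
        (lintegral_map_equiv (fun y : B => F y) e.toMeasurableEquiv).symm
    _ ≤ ∫⁻ y : B, F y ∂((ENNReal.ofReal C ^ 2) • μB) := lintegral_mono' hmap le_rfl
    _ = _ := by rw [lintegral_smul_measure, lintegral_subtype_comap hB, smul_eq_mul]

namespace EvolvingSurface

variable {S : EvolvingSurface}

theorem FlowBounds.norm_sub_le {K B : ℝ} (hF : S.FlowBounds K B) {z z' : Space}
    (hz : z ∈ S.initialSurface) (hz' : z' ∈ S.initialSurface) {t : ℝ} (ht : t ∈ Icc 0 S.T) :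
    ‖z - z'‖ ≤ Real.exp (K * S.T) * ‖S.flow 0 t z - S.flow 0 t z'‖ := by
  have h := hF.growth z hz z' hz' t ht 0 S.zero_mem
  rw [S.flow_self 0 S.zero_mem, S.flow_self 0 S.zero_mem, zero_sub, abs_neg, abs_of_nonneg ht.1]
    at h
  refine h.trans ?_
  have := hF.K_nonneg
  have := ht.2
  gcongr

theorem FlowBounds.norm_flow_sub_le {K B : ℝ} (hF : S.FlowBounds K B) {z z' : Space}
    (hz : z ∈ S.initialSurface) (hz' : z' ∈ S.initialSurface) {t : ℝ} (ht : t ∈ Icc 0 S.T) :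
    ‖S.flow 0 t z - S.flow 0 t z'‖ ≤ Real.exp (K * S.T) * ‖z - z'‖ := by
  have h := hF.growth z hz z' hz' 0 S.zero_mem t ht
  rw [S.flow_self 0 S.zero_mem, S.flow_self 0 S.zero_mem, sub_zero, abs_of_nonneg ht.1] at h
  refine h.trans ?_
  have := hF.K_nonneg
  have := ht.2
  gcongr

theorem isCompact_surface {t : ℝ} (ht : t ∈ Icc 0 S.T) : IsCompact (S.surface t) := by
  obtain ⟨K, B, hF⟩ := S.exists_flowBounds
  refine S.isCompact_initialSurface.image_of_continuousOn
    (LipschitzOnWith.of_dist_le' (K := Real.exp (K * S.T)) fun z hz z' hz' => ?_).continuousOn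
  rw [dist_eq_norm, dist_eq_norm]
  exact hF.norm_flow_sub_le hz hz' ht

end EvolvingSurface

namespace Mesh

variable {M : Mesh} {S : EvolvingSurface} {θ : ℝ}

theorem IsAdmissible.proj_mem_surface (hM : M.IsAdmissible S θ) {t : ℝ} (ht : t ∈ Icc 0 S.T)
    {x : Space} (hx : x ∈ M.surface S t) : S.proj t x ∈ S.surface t := by
  obtain ⟨e, he⟩ := hM.proj_homeomorph t ht
  rw [← he ⟨x, hx⟩]
  exact (e ⟨x, hx⟩).2

theorem isCompact_surface (t : ℝ) : IsCompact (M.surface S t) :=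
  isCompact_iUnion fun i => isCompact_cell t i

theorem TransportBounds.lintegral_proj_le {c B : ℝ} (hB : M.TransportBounds S c B)
    (hM : M.IsAdmissible S θ) {t : ℝ} (ht : t ∈ Icc 0 S.T) (F : Space → ℝ≥0∞) :
    ∫⁻ x, F (S.proj t x) ∂surfaceMeasure (M.surface S t) ≤
      4 * ∫⁻ y, F y ∂surfaceMeasure (S.surface t) := by
  obtain ⟨e, he⟩ := hM.proj_homeomorph t ht
  have h := lintegral_comp_homeomorph_le (isCompact_surface t).isClosed.measurableSet
    (S.isCompact_surface ht).isClosed.measurableSet e (K := fun i => Subtype.val ⁻¹' M.cell S t i)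
    (fun i => (isCompact_cell t i).isClosed.measurableSet.preimage measurable_subtype_coe)
    (fun ⟨_, hx⟩ => let ⟨i, hi⟩ := mem_iUnion.1 hx; ⟨i, hi⟩) (C := 2) (fun i x hx y hy => by
      rw [dist_eq_norm, dist_eq_norm, he, he]
      exact hB.expanding t ht i x hx y hy) he F
  refine h.trans_eq ?_
  congr 1
  norm_num

/-! ### Measurability of the data in the parameters of a triangle -/

theorem continuousOn_chart (i : Fin M.numTriangles) :
    ContinuousOn (fun q : ℝ × Plane => M.chart S q.1 i q.2) (Icc 0 S.T ×ˢ univ) := by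
  have hnode : ∀ j, ContinuousOn (fun q : ℝ × Plane => M.nodeAt S q.1 j) (Icc 0 S.T ×ˢ univ) :=
    fun j => (S.flow_continuousOn (M.node j)).comp continuousOn_fst fun q hq => hq.1
  simp only [chart, edgeMap_apply]
  have hcoord : ∀ b : Fin 2, Continuous fun q : ℝ × Plane => q.2 b := fun b => by fun_prop
  exact (hnode _).add (continuousOn_finsetSum _ fun b _ =>
    (hcoord b).continuousOn.smul ((hnode _).sub (hnode _)))

theorem IsAdmissible.continuousOn_proj_chart (hM : M.IsAdmissible S θ) (i : Fin M.numTriangles) :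
    ContinuousOn (fun q : ℝ × Plane => S.proj q.1 (M.chart S q.1 i q.2))
      (Icc 0 S.T ×ˢ refTriangle) := by
  have hx : ContinuousOn (fun q : ℝ × Plane => (M.chart S q.1 i q.2, q.1))
      (Icc 0 S.T ×ˢ refTriangle) :=
    ((continuousOn_chart i).mono (prod_mono subset_rfl (subset_univ _))).prodMk continuousOn_fst
  have hmem : MapsTo (fun q : ℝ × Plane => (M.chart S q.1 i q.2, q.1))
      (Icc 0 S.T ×ˢ refTriangle) S.tube := fun q hq =>
    ⟨hq.1, hM.mem_tube q.1 hq.1 _ (M.cell_subset_surface S q.1 i (chart_mem_cell q.1 i hq.2))⟩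
  have h1 := S.contDiffOn_d.continuousOn.comp hx hmem
  have h2 := S.contDiffOn_spatialDeriv.continuousOn.comp hx hmem
  have h3 := (InnerProductSpace.toDual ℝ Space).symm.continuous.comp_continuousOn h2
  refine ((hx.fst).sub (h1.smul h3)).congr fun q hq => ?_
  exact S.proj_eq (hmem hq)

/-- `Γ₀` has finite area, as the image of the polyhedral surface under the normal projection, which
is locally Lipschitz. -/
theorem IsAdmissible.isFiniteMeasure_initialSurface (hM : M.IsAdmissible S θ) :
    IsFiniteMeasure (surfaceMeasure S.initialSurface) := by
  have h0 := S.zero_mem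
  obtain ⟨e, he⟩ := hM.proj_homeomorph 0 h0
  have himg : S.initialSurface ⊆ S.proj 0 '' M.surface S 0 := by
    intro z hz
    have hz' : z ∈ S.surface 0 := ⟨z, hz, S.flow_self 0 h0 z⟩
    refine ⟨e.symm ⟨z, hz'⟩, (e.symm ⟨z, hz'⟩).2, ?_⟩
    rw [← he, e.apply_symm_apply]
  obtain ⟨O, hO, hOeq⟩ := S.exists_isOpen_tube
  have hslice : ∀ x, (x, (0 : ℝ)) ∈ O → (x, (0 : ℝ)) ∈ S.tube := fun x hx => by
    rw [hOeq]; exact ⟨⟨mem_univ _, h0⟩, hx⟩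
  have hU : IsOpen {x : Space | (x, (0 : ℝ)) ∈ O} := hO.preimage (by fun_prop)
  have hcd : ContDiffOn ℝ 1 (S.proj 0) {x : Space | (x, (0 : ℝ)) ∈ O} := by
    have hin : ContDiffOn ℝ 1 (fun x : Space => (x, (0 : ℝ))) {x : Space | (x, (0 : ℝ)) ∈ O} :=
      (contDiff_id.prodMk contDiff_const).contDiffOn
    have h1 := (S.contDiffOn_d.of_le one_le_two).comp hin hslice
    have h2 := S.contDiffOn_spatialDeriv.comp hin hslice
    have h3 := (InnerProductSpace.toDual ℝ Space).symm.contDiff (n := 1) |>.comp_contDiffOn h2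
    exact (contDiffOn_id.sub (h1.smul h3)).congr fun x hx => S.proj_eq (hslice x hx)
  have hloc : LocallyLipschitzOn (M.surface S 0) (S.proj 0) := by
    intro x hx
    have hxO : (x, (0 : ℝ)) ∈ O := by
      have : (x, (0 : ℝ)) ∈ S.tube := ⟨h0, hM.mem_tube 0 h0 x hx⟩
      rw [hOeq] at this
      exact this.2
    obtain ⟨K, t, ht, hK⟩ := (hcd.contDiffAt (hU.mem_nhds hxO)).exists_lipschitzOnWith
    exact ⟨K, t, mem_nhdsWithin_of_mem_nhds ht, hK⟩
  obtain ⟨L, hL⟩ := hloc.exists_lipschitzOnWith_of_compact (isCompact_surface 0)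
  have hle := euclideanHausdorffMeasure_image_le_of_dist_le (f := S.proj 0) (g := id)
    (A := M.surface S 0) (C := L) 2 fun x hx y hy => hL.dist_le_mul x hx y hy
  have hfin : μHE[2] (M.surface S 0) < ⊤ := by
    have h := hM.lintegral_surface h0 (fun _ => 1)
    rw [lintegral_one, surfaceMeasure, Measure.restrict_apply_univ] at h
    rw [h]
    refine ENNReal.sum_lt_top.2 fun i _ => ENNReal.mul_lt_top ENNReal.ofReal_lt_top ?_
    rw [lintegral_one, Measure.restrict_apply_univ]
    exact volume_refTriangle_ne_top.lt_top
  rw [image_id] at hle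
  refine isFiniteMeasure_restrict.2 (((measure_mono himg).trans hle).trans_lt ?_).ne
  exact ENNReal.mul_lt_top (ENNReal.pow_lt_top ENNReal.ofReal_lt_top) hfin

/-- The pull-back of `f` to the parameters of a triangle is measurable in space-time. It is the
composition of the pull-back of `f` to `Γ₀` with a continuous map, whose inverses on the time
slices are Lipschitz, so that preimages of null sets are null sets. -/
theorem TransportBounds.aestronglyMeasurable_data {c B : ℝ} (hB : M.TransportBounds S c B)
    (hM : M.IsAdmissible S θ) {f : ℝ → Space → ℝ} (hf : S.MemL2 f) (i : Fin M.numTriangles) :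
    AEStronglyMeasurable (fun q : ℝ × Plane => f q.1 (S.proj q.1 (M.chart S q.1 i q.2)))
      ((volume.restrict (Icc 0 S.T)).prod (volume.restrict refTriangle)) := by
  obtain ⟨K, B', hF⟩ := S.exists_flowBounds
  obtain ⟨z₀, hz₀⟩ := S.initialSurface_nonempty
  set Q : Set (ℝ × Plane) := Icc 0 S.T ×ˢ refTriangle with hQ
  have hQm : MeasurableSet Q := measurableSet_Icc.prod isCompact_refTriangle.measurableSet
  set P : ℝ × Plane → Space := fun q => S.proj q.1 (M.chart S q.1 i q.2) with hP
  -- the label in `Γ₀` of the projected point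
  set Z : ℝ × Plane → Space :=
    fun q => Function.invFunOn (S.flow 0 q.1) S.initialSurface (P q) with hZ
  have hPmem : ∀ q ∈ Q, P q ∈ S.flow 0 q.1 '' S.initialSurface := fun q hq =>
    hM.proj_mem_surface hq.1 (M.cell_subset_surface S q.1 i (chart_mem_cell q.1 i hq.2))
  have hZmem : ∀ q ∈ Q, Z q ∈ S.initialSurface := fun q hq =>
    Function.invFunOn_mem (hPmem q hq)
  have hZeq : ∀ q ∈ Q, S.flow 0 q.1 (Z q) = P q := fun q hq =>
    Function.invFunOn_eq (hPmem q hq)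
  have hZc : ContinuousOn Z Q := by
    intro q hq
    have hPc := hM.continuousOn_proj_chart i q hq
    refine tendsto_iff_dist_tendsto_zero.2 ?_
    refine squeeze_zero' (g := fun q' => Real.exp (K * S.T) *
      (dist (P q') (P q) + B' * |q.1 - q'.1|)) (Filter.Eventually.of_forall fun _ => dist_nonneg)
      ?_ ?_
    · filter_upwards [self_mem_nhdsWithin] with q' hq'
      rw [dist_eq_norm]
      refine (hF.norm_sub_le (hZmem q' hq') (hZmem q hq) hq.1).trans ?_
      refine mul_le_mul_of_nonneg_left ?_ (Real.exp_pos _).le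
      have h1 := hF.speed (Z q') (hZmem q' hq') q'.1 hq'.1 q.1 hq.1
      rw [hZeq q' hq'] at h1
      rw [hZeq q hq, dist_eq_norm]
      have h2 := norm_sub_le_norm_sub_add_norm_sub (S.flow 0 q.1 (Z q')) (P q') (P q)
      linarith
    · have h1 : Filter.Tendsto (fun q' => dist (P q') (P q)) (nhdsWithin q Q) (nhds 0) :=
        tendsto_iff_dist_tendsto_zero.1 hPc
      have h2 : Filter.Tendsto (fun q' : ℝ × Plane => B' * |q.1 - q'.1|) (nhdsWithin q Q)
          (nhds (B' * |q.1 - q.1|)) :=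
        (Continuous.tendsto (by fun_prop) q).mono_left nhdsWithin_le_nhds
      have h3 := (h1.add h2).const_mul (Real.exp (K * S.T))
      simpa using h3
  classical
  set Ψ : ℝ × Plane → ℝ × Space := Q.piecewise (fun q => (q.1, Z q)) (fun _ => (0, z₀)) with hΨ
  have hΨQ : ∀ q ∈ Q, Ψ q = (q.1, Z q) := fun q hq => piecewise_eq_of_mem _ _ _ hq
  have hΨm : Measurable Ψ := (continuousOn_fst.prodMk hZc).measurable_piecewise
    continuousOn_const hQm
  have hac : ((volume.restrict (Icc 0 S.T)).prod (volume.restrict refTriangle)).map Ψ ≪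
      (volume.restrict (Icc 0 S.T)).prod (surfaceMeasure S.initialSurface) := by
    refine Measure.AbsolutelyContinuous.mk fun N hN hN0 => ?_
    have := hM.isFiniteMeasure_initialSurface
    rw [Measure.map_apply hΨm hN]
    refine Measure.measure_prod_null_of_ae_null (hΨm hN) ?_
    filter_upwards [Measure.measure_ae_null_of_prod_null hN0, ae_restrict_mem measurableSet_Icc]
      with t hNt ht
    rw [Pi.zero_apply, surfaceMeasure,
      Measure.restrict_apply (measurable_prodMk_left hN)] at hNt
    rw [Pi.zero_apply, Measure.restrict_apply (measurable_prodMk_left (hΨm hN))]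
    set A : Set Plane := Prod.mk t ⁻¹' (Ψ ⁻¹' N) ∩ refTriangle with hA
    have hle := euclideanHausdorffMeasure_image_le_of_dist_le (f := M.chart S t i)
      (g := fun w => Z (t, w)) (A := A) (C := 2 * Real.exp (K * S.T)) 2 ?_
    · have himg : (fun w => Z (t, w)) '' A ⊆ Prod.mk t ⁻¹' N ∩ S.initialSurface := by
        rintro _ ⟨w, ⟨hw, hwr⟩, rfl⟩
        refine ⟨?_, hZmem (t, w) ⟨ht, hwr⟩⟩
        have := hΨQ (t, w) ⟨ht, hwr⟩
        rw [mem_preimage, mem_preimage, this] at hw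
        exact hw
      rw [measure_mono_null himg hNt, mul_zero, nonpos_iff_eq_zero,
        euclideanHausdorffMeasure_image_chart, mul_eq_zero, ENNReal.ofReal_eq_zero] at hle
      exact hle.resolve_left (not_le.2 (hM.jac_pos ht i))
    · intro w hw w' hw'
      have h1 := hB.expanding t ht i _ (chart_mem_cell t i hw.2) _ (chart_mem_cell t i hw'.2)
      have h2 : ‖P (t, w) - P (t, w')‖ ≤ Real.exp (K * S.T) * ‖Z (t, w) - Z (t, w')‖ := by
        rw [← hZeq (t, w) ⟨ht, hw.2⟩, ← hZeq (t, w') ⟨ht, hw'.2⟩]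
        exact hF.norm_flow_sub_le (hZmem (t, w) ⟨ht, hw.2⟩) (hZmem (t, w') ⟨ht, hw'.2⟩) ht
      rw [dist_eq_norm, dist_eq_norm]
      refine h1.trans ?_
      rw [mul_assoc]
      exact mul_le_mul_of_nonneg_left h2 zero_le_two
  have := (hf.1.mono_ac hac).comp_measurable hΨm
  refine this.congr ?_
  rw [Measure.prod_restrict]
  filter_upwards [ae_restrict_mem hQm] with q hq
  simp only [Function.comp_apply, hΨQ q hq, hZeq q hq]
  rfl

end Mesh

/-! ### The load functional -/

theorem abs_integral_mul_le {α : Type*} [MeasurableSpace α] {μ : Measure α} {p q : α → ℝ}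
    (hp : MemLp p 2 μ) (hq : MemLp q 2 μ) :
    |∫ x, p x * q x ∂μ| ≤ √(∫ x, p x ^ 2 ∂μ) * √(∫ x, q x ^ 2 ∂μ) := by
  have h2 : ENNReal.ofReal 2 = 2 := by norm_num
  have h := integral_mul_norm_le_Lp_mul_Lq (μ := μ) (f := p) (g := q)
    Real.HolderConjugate.two_two (by rwa [h2]) (by rwa [h2])
  simp only [Real.norm_eq_abs, Real.rpow_two, sq_abs, ← Real.sqrt_eq_rpow] at h
  refine (abs_integral_le_integral_abs).trans ?_
  simpa only [abs_mul] using h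

theorem sum_mul_abs_integral_le {ι α : Type*} [MeasurableSpace α] {μ : Measure α} (s : Finset ι)
    {J : ι → ℝ} (hJ : ∀ i, 0 ≤ J i) {p q : ι → α → ℝ} (hp : ∀ i, MemLp (p i) 2 μ)
    (hq : ∀ i, MemLp (q i) 2 μ) :
    ∑ i ∈ s, J i * |∫ x, p i x * q i x ∂μ| ≤
      √(∑ i ∈ s, J i * ∫ x, p i x ^ 2 ∂μ) * √(∑ i ∈ s, J i * ∫ x, q i x ^ 2 ∂μ) := by
  have hsq : ∀ {r : α → ℝ}, 0 ≤ ∫ x, r x ^ 2 ∂μ := fun {r} =>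
    integral_nonneg fun x => sq_nonneg (r x)
  refine le_trans (Finset.sum_le_sum fun i _ => ?_) (Real.sum_sqrt_mul_sqrt_le s
    (fun i => mul_nonneg (hJ i) (hsq (r := p i))) (fun i => mul_nonneg (hJ i) (hsq (r := q i))))
  rw [Real.sqrt_mul (hJ i), Real.sqrt_mul (hJ i), mul_mul_mul_comm, Real.mul_self_sqrt (hJ i)]
  exact mul_le_mul_of_nonneg_left (abs_integral_mul_le (hp i) (hq i)) (hJ i)

namespace Mesh

variable {M : Mesh} {S : EvolvingSurface} {θ : ℝ}

variable (M S) in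
/-- The data `f` at the projection of the point with parameter `w` of the `i`-th triangle. -/
noncomputable def cellData (f : ℝ → Space → ℝ) (i : Fin M.numTriangles) (t : ℝ) (w : Plane) : ℝ :=
  f t (S.proj t (M.chart S t i w))

variable (M S) in
/-- The load at time `t`, integrated over the surface at time `s`. -/
noncomputable def load (f : ℝ → Space → ℝ) (s t : ℝ) (φ : Fin M.numNodes → ℝ) : ℝ :=
  ∑ i, M.jac S s i * ∫ w in refTriangle, M.cellData S f i t w * M.localFun i φ w

variable (M S) in
/-- The `L²`-norm of the data on the polyhedral surface at time `t`. -/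
noncomputable def loadNorm (f : ℝ → Space → ℝ) (t : ℝ) : ℝ :=
  √(∑ i, M.jac S t i * ∫ w in refTriangle, M.cellData S f i t w ^ 2)

theorem loadNorm_sq (f : ℝ → Space → ℝ) (t : ℝ) : M.loadNorm S f t ^ 2 =
    ∑ i, M.jac S t i * ∫ w in refTriangle, M.cellData S f i t w ^ 2 :=
  Real.sq_sqrt (Finset.sum_nonneg fun i _ => mul_nonneg (M.jac_nonneg S t i)
    (integral_nonneg fun _ => sq_nonneg _))

theorem lintegral_sq_ne_top_of_evolvingNorm_ne_top {T : ℝ} {Γ : ℝ → Set Space}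
    {u : ℝ → Space → ℝ} (h : evolvingNorm T Γ u ≠ ⊤) :
    ∫⁻ t in Icc 0 T, eLpNorm (u t) 2 (surfaceMeasure (Γ t)) ^ 2 ≠ ⊤ := by
  intro htop
  rw [evolvingNorm, htop, ENNReal.top_rpow_of_pos (by norm_num)] at h
  exact h rfl

theorem evolvingNorm_sq (T : ℝ) (Γ : ℝ → Set Space) (u : ℝ → Space → ℝ) :
    evolvingNorm T Γ u ^ 2 = ∫⁻ t in Icc 0 T, eLpNorm (u t) 2 (surfaceMeasure (Γ t)) ^ 2 := by
  rw [evolvingNorm, ← ENNReal.rpow_natCast, ← ENNReal.rpow_mul]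
  simp

theorem memLp_localFun (i : Fin M.numTriangles) (φ : Fin M.numNodes → ℝ) :
    MemLp (M.localFun i φ) 2 (volume.restrict refTriangle) := by
  rw [memLp_two_iff_integrable_sq (continuous_localFun i φ).aestronglyMeasurable]
  exact ((continuous_localFun i φ).pow 2).continuousOn.integrableOn_compact isCompact_refTriangle

namespace TransportBounds

variable {c B : ℝ} (hB : M.TransportBounds S c B) (hM : M.IsAdmissible S θ)
include hB

theorem abs_jac_sub_le (i : Fin M.numTriangles) {s t : ℝ} (hs : s ∈ Icc 0 S.T)
    (ht : t ∈ Icc 0 S.T) :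
    |M.jac S s i - M.jac S t i| ≤ (Real.exp (2 * c * |t - s|) - 1) * M.jac S t i := by
  refine abs_sub_le_of_exp_growth (M.jac_nonneg S t i) ?_ (hB.jac_le i hs ht)
  have := hB.jac_le i ht hs
  rwa [abs_sub_comm] at this

theorem continuousOn_jac (i : Fin M.numTriangles) :
    ContinuousOn (fun t => M.jac S t i) (Icc 0 S.T) := by
  intro t ht
  refine tendsto_iff_dist_tendsto_zero.2 (squeeze_zero'
    (g := fun s => (Real.exp (2 * c * |t - s|) - 1) * M.jac S t i)
    (Filter.Eventually.of_forall fun _ => dist_nonneg) ?_ ?_)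
  · filter_upwards [self_mem_nhdsWithin] with s hs
    rw [Real.dist_eq]
    exact hB.abs_jac_sub_le i hs ht
  · have : Continuous fun s => (Real.exp (2 * c * |t - s|) - 1) * M.jac S t i := by fun_prop
    have h := (this.tendsto t).mono_left (nhdsWithin_le_nhds (s := Icc 0 S.T))
    simpa using h

include hM

theorem sum_lintegral_cellData_le (f : ℝ → Space → ℝ) {t : ℝ} (ht : t ∈ Icc 0 S.T) :
    ∑ i, ENNReal.ofReal (M.jac S t i) * ∫⁻ w in refTriangle, ‖M.cellData S f i t w‖ₑ ^ 2 ≤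
      4 * eLpNorm (f t) 2 (surfaceMeasure (S.surface t)) ^ 2 := by
  have h := hB.lintegral_proj_le hM ht (fun y => ‖f t y‖ₑ ^ 2)
  rw [hM.lintegral_surface ht] at h
  rw [eLpNorm_two_sq]
  exact h

theorem memLp_cellData {f : ℝ → Space → ℝ} (hf : S.MemL2 f)
    (hfin : evolvingNorm S.T S.surface f ≠ ⊤) (i : Fin M.numTriangles) :
    MemLp (fun q : ℝ × Plane => M.cellData S f i q.1 q.2) 2
      ((volume.restrict (Icc 0 S.T)).prod (volume.restrict refTriangle)) := by
  have hmeas : AEStronglyMeasurable (fun q : ℝ × Plane => M.cellData S f i q.1 q.2)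
      ((volume.restrict (Icc 0 S.T)).prod (volume.restrict refTriangle)) :=
    hB.aestronglyMeasurable_data hM hf i
  refine ⟨hmeas, ?_⟩
  rw [eLpNorm_lt_top_iff_lintegral_rpow_enorm_lt_top (by norm_num) (by norm_num)]
  simp only [ENNReal.toReal_ofNat, ENNReal.rpow_ofNat]
  rw [lintegral_prod _ (hmeas.enorm.pow_const 2)]
  set j : ℝ := Real.exp (-(2 * c * S.T)) * M.jac S 0 i with hj
  have hj0 : 0 < j := mul_pos (Real.exp_pos _) (hM.jac_pos S.zero_mem i)
  have hjle : ∀ t ∈ Icc 0 S.T, j ≤ M.jac S t i := by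
    intro t ht
    have h1 := hB.jac_le i ht S.zero_mem
    have h2 : Real.exp (2 * c * |0 - t|) ≤ Real.exp (2 * c * S.T) := by
      have := hB.c_nonneg
      rw [zero_sub, abs_neg, abs_of_nonneg ht.1]
      have := ht.2
      gcongr
    have h3 := h1.trans (mul_le_mul_of_nonneg_right h2 (M.jac_nonneg S t i))
    rw [hj, Real.exp_neg, inv_mul_le_iff₀ (Real.exp_pos _)]
    exact h3
  have hle : ∀ t ∈ Icc 0 S.T, ENNReal.ofReal j * ∫⁻ w in refTriangle,
      ‖M.cellData S f i t w‖ₑ ^ 2 ≤ 4 * eLpNorm (f t) 2 (surfaceMeasure (S.surface t)) ^ 2 := by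
    intro t ht
    refine le_trans ?_ (hB.sum_lintegral_cellData_le hM f ht)
    refine le_trans ?_ (Finset.single_le_sum (f := fun i => ENNReal.ofReal (M.jac S t i) *
      ∫⁻ w in refTriangle, ‖M.cellData S f i t w‖ₑ ^ 2) (fun _ _ => zero_le) (Finset.mem_univ i))
    have := ENNReal.ofReal_le_ofReal (hjle t ht)
    gcongr
  have h4 : ENNReal.ofReal j * ∫⁻ t in Icc 0 S.T, ∫⁻ w in refTriangle,
      ‖M.cellData S f i t w‖ₑ ^ 2 ≤
      4 * ∫⁻ t in Icc 0 S.T, eLpNorm (f t) 2 (surfaceMeasure (S.surface t)) ^ 2 := by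
    rw [← lintegral_const_mul' _ _ ENNReal.ofReal_ne_top,
      ← lintegral_const_mul' _ _ (by norm_num)]
    exact setLIntegral_mono' measurableSet_Icc hle
  refine ENNReal.lt_top_of_mul_ne_top_right (ne_top_of_le_ne_top (ENNReal.mul_ne_top (by norm_num)
    (lintegral_sq_ne_top_of_evolvingNorm_ne_top hfin)) h4) ?_
  exact (ENNReal.ofReal_pos.2 hj0).ne'

theorem ae_memLp_cellData {f : ℝ → Space → ℝ} (hf : S.MemL2 f)
    (hfin : evolvingNorm S.T S.surface f ≠ ⊤) : ∀ᵐ t ∂volume.restrict (Icc 0 S.T),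
      ∀ i, MemLp (M.cellData S f i t) 2 (volume.restrict refTriangle) := by
  refine ae_all_iff.2 fun i => ?_
  have h := hB.memLp_cellData hM hf hfin i
  filter_upwards [h.1.prodMk_left, h.integrable_sq.prod_right_ae] with t h1 h2
  exact (memLp_two_iff_integrable_sq h1).2 h2

theorem integrableOn_cellData_mul {f : ℝ → Space → ℝ} (hf : S.MemL2 f)
    (hfin : evolvingNorm S.T S.surface f ≠ ⊤) (i : Fin M.numTriangles)
    (φ : Fin M.numNodes → ℝ) : IntegrableOn
      (fun t => ∫ w in refTriangle, M.cellData S f i t w * M.localFun i φ w) (Icc 0 S.T) := by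
  have hq : MemLp (fun q : ℝ × Plane => M.localFun i φ q.2) 2
      ((volume.restrict (Icc 0 S.T)).prod (volume.restrict refTriangle)) := by
    have hc : Continuous fun q : ℝ × Plane => M.localFun i φ q.2 :=
      (continuous_localFun i φ).comp continuous_snd
    rw [memLp_two_iff_integrable_sq hc.aestronglyMeasurable, Measure.prod_restrict]
    exact (hc.pow 2).continuousOn.integrableOn_compact (isCompact_Icc.prod isCompact_refTriangle)
  exact ((hB.memLp_cellData hM hf hfin i).integrable_mul hq).integral_prod_left

theorem integrableOn_loadNorm_sq {f : ℝ → Space → ℝ} (hf : S.MemL2 f)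
    (hfin : evolvingNorm S.T S.surface f ≠ ⊤) :
    IntegrableOn (fun t => M.loadNorm S f t ^ 2) (Icc 0 S.T) := by
  simp only [loadNorm_sq]
  refine integrable_finsetSum _ fun i _ => ?_
  exact IntegrableOn.continuousOn_mul (hB.continuousOn_jac i)
    (hB.memLp_cellData hM hf hfin i).integrable_sq.integral_prod_left isCompact_Icc

/-- The data define a load for the mass form. -/
theorem evolvingLoad {f : ℝ → Space → ℝ} (hf : S.MemL2 f)
    (hfin : evolvingNorm S.T S.surface f ≠ ⊤) {c' : ℝ} (hc' : 2 * c ≤ c')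
    {m : ℝ → NodalForm (Fin M.numNodes)}
    (hm : ∀ t ∈ Icc 0 S.T, ∀ u v, m t u v = M.massForm S t u v) :
    EvolvingLoad S.T c' m (M.load S f) (M.loadNorm S f) := by
  have hcs : ∀ᵐ t ∂volume.restrict (Icc 0 S.T), ∀ φ : Fin M.numNodes → ℝ,
      ∑ i, M.jac S t i * |∫ w in refTriangle, M.cellData S f i t w * M.localFun i φ w| ≤
        M.loadNorm S f t * √(m t φ φ) := by
    filter_upwards [hB.ae_memLp_cellData hM hf hfin, ae_restrict_mem measurableSet_Icc]
      with t h ht φ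
    refine (sum_mul_abs_integral_le _ (M.jac_nonneg S t) h
      (fun i => memLp_localFun i φ)).trans_eq ?_
    rw [hm t ht, hM.massForm_eq ht, loadNorm]
    simp only [sq]
  refine ⟨fun t => Real.sqrt_nonneg _, hB.integrableOn_loadNorm_sq hM hf hfin,
    fun s _ φ => ?_, fun φ => ?_, ?_, ?_⟩
  · exact integrable_finsetSum _ fun i _ =>
      (hB.integrableOn_cellData_mul hM hf hfin i φ).const_mul _
  · exact integrable_finsetSum _ fun i _ => IntegrableOn.continuousOn_mul (hB.continuousOn_jac i)
      (hB.integrableOn_cellData_mul hM hf hfin i φ) isCompact_Icc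
  · filter_upwards [hcs] with t h φ
    refine le_trans ?_ (h φ)
    refine (Finset.abs_sum_le_sum_abs _ _).trans_eq (Finset.sum_congr rfl fun i _ => ?_)
    rw [abs_mul, abs_of_nonneg (M.jac_nonneg S t i)]
  · filter_upwards [hcs, ae_restrict_mem measurableSet_Icc] with t h ht s hs φ
    have he : 0 ≤ Real.exp (c' * |t - s|) - 1 := by
      have h0 : 0 ≤ c' := (mul_nonneg zero_le_two hB.c_nonneg).trans hc'
      linarith [Real.one_le_exp (mul_nonneg h0 (abs_nonneg (t - s)))]
    refine le_trans ?_ (mul_le_mul_of_nonneg_left (h φ) he)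
    rw [load, load, ← Finset.sum_sub_distrib, Finset.mul_sum]
    refine (Finset.abs_sum_le_sum_abs _ _).trans (Finset.sum_le_sum fun i _ => ?_)
    rw [← sub_mul, abs_mul, ← mul_assoc]
    refine mul_le_mul_of_nonneg_right ((hB.abs_jac_sub_le i hs ht).trans ?_) (abs_nonneg _)
    have := M.jac_nonneg S t i
    gcongr

theorem ofReal_integral_loadNorm_sq_le {f : ℝ → Space → ℝ} (hf : S.MemL2 f)
    (hfin : evolvingNorm S.T S.surface f ≠ ⊤) :
    ENNReal.ofReal (∫ t in (0 : ℝ)..S.T, M.loadNorm S f t ^ 2) ≤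
      4 * evolvingNorm S.T S.surface f ^ 2 := by
  rw [intervalIntegral.integral_of_le S.T_pos.le, ← integral_Icc_eq_integral_Ioc,
    ofReal_integral_eq_lintegral_ofReal (hB.integrableOn_loadNorm_sq hM hf hfin)
      (Filter.Eventually.of_forall fun _ => sq_nonneg _),
    evolvingNorm_sq, ← lintegral_const_mul' _ _ (by norm_num)]
  refine lintegral_mono_ae ?_
  filter_upwards [hB.ae_memLp_cellData hM hf hfin, ae_restrict_mem measurableSet_Icc] with t h ht
  refine le_trans (le_of_eq ?_) (hB.sum_lintegral_cellData_le hM f ht)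
  rw [loadNorm_sq, ENNReal.ofReal_sum_of_nonneg fun i _ => mul_nonneg (M.jac_nonneg S t i)
    (integral_nonneg fun _ => sq_nonneg _)]
  refine Finset.sum_congr rfl fun i _ => ?_
  rw [ENNReal.ofReal_mul (M.jac_nonneg S t i), ofReal_integral_eq_lintegral_ofReal
    (h i).integrable_sq (Filter.Eventually.of_forall fun _ => sq_nonneg _)]
  simp only [← Real.enorm_of_nonneg (sq_nonneg _), enorm_pow]

theorem ae_integral_flowH_eq_load {f : ℝ → Space → ℝ} (hf : S.MemL2 f)
    (hfin : evolvingNorm S.T S.surface f ≠ ⊤) : ∀ᵐ t ∂volume.restrict (Icc 0 S.T),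
      ∀ s ∈ Icc 0 S.T, ∀ φ : Fin M.numNodes → ℝ,
        ∫ x, Mesh.invLift S f t (M.flowH S s t x) * M.feFun S s φ x
          ∂surfaceMeasure (M.surface S s) = M.load S f s t φ := by
  filter_upwards [hB.ae_memLp_cellData hM hf hfin] with t h s hs φ
  have e : ∀ i, EqOn (fun w => Mesh.invLift S f t (M.flowH S s t (M.chart S s i w)) *
      M.feFun S s φ (M.chart S s i w)) (fun w => M.cellData S f i t w * M.localFun i φ w)
      refTriangle := fun i w hw => by
    simp only [hM.feFun_chart hs i _ hw, hM.flowH_chart hs t i hw]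
    rfl
  have hm := isCompact_refTriangle.measurableSet
  rw [hM.integral_surface hs fun i => ?_]
  · exact Finset.sum_congr rfl fun i _ => congrArg _ (setIntegral_congr_fun hm (e i))
  · exact (integrableOn_congr_fun (e i) hm).2 ((h i).integrable_mul (memLp_localFun i φ))

theorem ae_integral_eq_load {f : ℝ → Space → ℝ} (hf : S.MemL2 f)
    (hfin : evolvingNorm S.T S.surface f ≠ ⊤) : ∀ᵐ t ∂volume.restrict (Icc 0 S.T),
      ∀ φ : Fin M.numNodes → ℝ, ∫ x, Mesh.invLift S f t x * M.feFun S t φ x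
        ∂surfaceMeasure (M.surface S t) = M.load S f t t φ := by
  filter_upwards [hB.ae_memLp_cellData hM hf hfin, ae_restrict_mem measurableSet_Icc]
    with t h ht φ
  have e : ∀ i, EqOn (fun w => Mesh.invLift S f t (M.chart S t i w) *
      M.feFun S t φ (M.chart S t i w)) (fun w => M.cellData S f i t w * M.localFun i φ w)
      refTriangle := fun i w hw => by
    simp only [hM.feFun_chart ht i _ hw]
    rfl
  have hm := isCompact_refTriangle.measurableSet
  rw [hM.integral_surface ht fun i => ?_]
  · exact Finset.sum_congr rfl fun i _ => congrArg _ (setIntegral_congr_fun hm (e i))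
  · exact (integrableOn_congr_fun (e i) hm).2 ((h i).integrable_mul (memLp_localFun i φ))

end TransportBounds
end Mesh

/-! ### Norms of finite element functions -/

namespace Mesh

variable {M : Mesh} {S : EvolvingSurface} {θ : ℝ}

theorem IsAdmissible.eLpNorm_feFun_sq (hM : M.IsAdmissible S θ) {t : ℝ} (ht : t ∈ Icc 0 S.T)
    (v : Fin M.numNodes → ℝ) : eLpNorm (M.feFun S t v) 2 (surfaceMeasure (M.surface S t)) ^ 2 =
      ENNReal.ofReal (M.massForm S t v v) := by
  rw [eLpNorm_two_sq, hM.lintegral_surface ht, hM.massForm_eq ht]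
  simp only [← sq]
  rw [ENNReal.ofReal_sum_of_nonneg fun i _ => mul_nonneg (M.jac_nonneg S t i)
    (integral_nonneg fun _ => sq_nonneg _)]
  refine Finset.sum_congr rfl fun i _ => ?_
  rw [ENNReal.ofReal_mul (M.jac_nonneg S t i), ofReal_integral_eq_lintegral_ofReal
    (memLp_localFun i v).integrable_sq (Filter.Eventually.of_forall fun _ => sq_nonneg _)]
  congr 1
  refine setLIntegral_congr_fun isCompact_refTriangle.measurableSet fun w hw => ?_
  simp only [hM.feFun_chart ht i v hw, ← Real.enorm_of_nonneg (sq_nonneg _), enorm_pow]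

theorem IsAdmissible.evolvingNorm_feFun_sq (hM : M.IsAdmissible S θ)
    (v : ℝ → Fin M.numNodes → ℝ) :
    evolvingNorm S.T (M.surface S) (fun t => M.feFun S t (v t)) ^ 2 =
      ∫⁻ t in Icc 0 S.T, ENNReal.ofReal (M.massForm S t (v t) (v t)) := by
  rw [evolvingNorm_sq]
  exact setLIntegral_congr_fun measurableSet_Icc fun t ht => hM.eLpNorm_feFun_sq ht (v t)

theorem feFun_sub (t : ℝ) (u v : Fin M.numNodes → ℝ) (x : Space) :
    M.feFun S t u x - M.feFun S t v x = M.feFun S t (u - v) x := by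
  simp only [feFun, Pi.sub_apply, sub_mul, Finset.sum_sub_distrib]

theorem timeStep_pos {N : ℕ} (hN : 0 < N) : 0 < timeStep S N :=
  div_pos S.T_pos (Nat.cast_pos.2 hN)

theorem mul_timeStep {N : ℕ} (hN : 0 < N) : N * timeStep S N = S.T :=
  mul_div_cancel₀ _ (Nat.cast_pos.2 hN).ne'

end Mesh

theorem setLIntegral_Ioc_le_sum {k : ℝ} (hk : 0 ≤ k) {F : ℝ → ℝ≥0∞} {δ : ℕ → ℝ≥0∞} (N : ℕ)
    (h : ∀ n < N, ∀ t ∈ Ioc (n * k) ((n + 1 : ℕ) * k), F t ≤ δ n) :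
    ∫⁻ t in Ioc 0 (N * k), F t ≤ ∑ n ∈ Finset.range N, ENNReal.ofReal k * δ n := by
  induction N with
  | zero => simp
  | succ N ih =>
    rw [Finset.sum_range_succ, ← Ioc_union_Ioc_eq_Ioc (b := (N : ℝ) * k) (by positivity)
      (grid_le hk N)]
    refine (lintegral_union_le _ _ _).trans (add_le_add (ih fun n hn => h n (by omega)) ?_)
    refine (setLIntegral_mono' measurableSet_Ioc (h N (by omega))).trans_eq ?_
    rw [setLIntegral_const, Real.volume_Ioc, grid_sub, mul_comm]

/-- As the integral of a non-integrable function is zero, no integrability is needed. -/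
theorem ofReal_integral_le_lintegral {α : Type*} [MeasurableSpace α] {μ : Measure α} {g : α → ℝ}
    (hg : 0 ≤ᵐ[μ] g) : ENNReal.ofReal (∫ x, g x ∂μ) ≤ ∫⁻ x, ENNReal.ofReal (g x) ∂μ := by
  by_cases hi : Integrable g μ
  · exact (ofReal_integral_eq_lintegral_ofReal hi hg).le
  · rw [integral_undef hi, ENNReal.ofReal_zero]
    exact zero_le

namespace Mesh

variable {M : Mesh} {S : EvolvingSurface} {θ : ℝ}

/-! ### The solutions in terms of nodal values -/

namespace TransportBounds

variable {c B : ℝ} (hB : M.TransportBounds S c B) (hM : M.IsAdmissible S θ)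
include hB hM

theorem isSemidiscreteSolution {f : ℝ → Space → ℝ} (hf : S.MemL2 f)
    (hfin : evolvingNorm S.T S.surface f ≠ ⊤) {lam : Space × ℝ → ℝ}
    {m a : ℝ → NodalForm (Fin M.numNodes)}
    (hm : ∀ t ∈ Icc 0 S.T, ∀ u v, m t u v = M.massForm S t u v)
    (ha : ∀ t ∈ Icc 0 S.T, ∀ u v, a t u v = M.energyForm S lam t u v)
    {y₀ : Fin M.numNodes → ℝ} {y y' : ℝ → Fin M.numNodes → ℝ}
    (hy : M.SolvesSemidiscrete S lam (Mesh.invLift S f) y₀ y y') :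
    IsSemidiscreteSolution S.T m a (M.load S f) y y' := by
  obtain ⟨h1, -, h3⟩ := hy
  have hload : ∀ᵐ t ∂volume.restrict (Ioo 0 S.T), ∀ φ : Fin M.numNodes → ℝ,
      ∫ x, Mesh.invLift S f t x * M.feFun S t φ x ∂surfaceMeasure (M.surface S t) =
        M.load S f t t φ :=
    ae_restrict_of_ae_restrict_of_subset Ioo_subset_Icc_self (hB.ae_integral_eq_load hM hf hfin)
  have key : ∀ φ φ' : ℝ → Fin M.numNodes → ℝ, M.IsH1 S φ φ' →
      ∀ᵐ t ∂volume.restrict (Ioo 0 S.T), ∃ D : ℝ,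
        HasDerivAt (fun τ => m τ (y τ) (φ τ)) D t ∧
          D + a t (y t) (φ t) = m t (φ' t) (y t) + M.load S f t t (φ t) := by
    intro φ φ' hφ
    filter_upwards [h3 φ φ' hφ, hload, ae_restrict_mem measurableSet_Ioo] with t ⟨D, hD, hE⟩ hl ht
    have ht' := Ioo_subset_Icc_self ht
    refine ⟨D, hD.congr_of_eventuallyEq ?_, ?_⟩
    · filter_upwards [Ioo_mem_nhds ht.1 ht.2] with τ hτ
      exact hm τ (Ioo_subset_Icc_self hτ) _ _
    · rw [ha t ht', hm t ht', hE, hl]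
  refine ⟨fun i => (h1 i).1, fun i => (h1 i).2, fun φ => ?_, key y y' h1⟩
  have hconst : M.IsH1 S (fun _ => φ) (fun _ => 0) := fun j => ⟨by simp, by simp⟩
  filter_upwards [key _ _ hconst] with t ⟨D, hD, hE⟩
  rw [map_zero, LinearMap.zero_apply, zero_add] at hE
  rwa [← hE, add_sub_cancel_right]

theorem isEulerSolution {f : ℝ → Space → ℝ} (hf : S.MemL2 f)
    (hfin : evolvingNorm S.T S.surface f ≠ ⊤) {lam : Space × ℝ → ℝ}
    {m a : ℝ → NodalForm (Fin M.numNodes)}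
    (hm : ∀ t ∈ Icc 0 S.T, ∀ u v, m t u v = M.massForm S t u v)
    (ha : ∀ t ∈ Icc 0 S.T, ∀ u v, a t u v = M.energyForm S lam t u v)
    {y₀ : Fin M.numNodes → ℝ} {N : ℕ} (hN : 0 < N)
    {rem : ℕ → (Fin M.numNodes → ℝ) →ₗ[ℝ] (Fin M.numNodes → ℝ) →ₗ[ℝ] ℝ}
    {Y : ℕ → Fin M.numNodes → ℝ}
    (hY : M.SolvesFullyDiscrete S lam (Mesh.invLift S f) y₀ N rem Y) :
    IsEulerSolution (timeStep S N) N m a (fun n ψ φ => rem n ψ φ) (M.load S f) Y := by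
  intro n hn φ
  have hk := (timeStep_pos (S := S) hN).le
  have hs := grid_mem hk (mul_timeStep (S := S) hN) hn.le
  have ht := grid_mem hk (mul_timeStep (S := S) hN) (Nat.succ_le_of_lt hn)
  have h := hY.2 n hn φ
  rw [← Nat.cast_succ] at h
  rw [ha _ ht, hm _ ht, hm _ hs]
  refine h.trans (intervalIntegral.integral_congr_ae ?_)
  rw [uIoc_of_le (grid_le hk n), ← ae_restrict_iff' measurableSet_Ioc]
  have hae := ae_grid hk (mul_timeStep (S := S) hN) hn (hB.ae_integral_flowH_eq_load hM hf hfin)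
  filter_upwards [ae_restrict_of_ae_restrict_of_subset Ioc_subset_Icc_self hae] with t h1
  exact h1 _ ht φ

end TransportBounds
end Mesh
end EvolvingFEM

open EvolvingFEM in
theorem theoremL (S : EvolvingSurface) (θ Λ cr : ℝ) (L : NNReal) (hθ : 0 < θ) (hcr : 0 ≤ cr) :
    ∃ C : ℝ, 0 < C ∧ ∃ h₀ : ℝ, 0 < h₀ ∧ ∀ M : Mesh, M.IsAdmissible S θ → M.meshSize S ≤ h₀ →
      ∀ lam : Space × ℝ → ℝ, (∀ q ∈ M.spaceTime S, 1 ≤ lam q ∧ lam q ≤ Λ) →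
        LipschitzOnWith L lam (M.spaceTime S) →
      ∀ N : ℕ, 0 < N → cr * Mesh.timeStep S N ≤ 1 / 2 →
      ∀ rem : ℕ → (Fin M.numNodes → ℝ) →ₗ[ℝ] (Fin M.numNodes → ℝ) →ₗ[ℝ] ℝ,
        (∀ n, 1 ≤ n → n ≤ N → ∀ ψ φ, |rem n ψ φ| ≤ cr * Mesh.timeStep S N *
          M.h1Norm S (n * Mesh.timeStep S N) ψ * M.h1Norm S (n * Mesh.timeStep S N) φ) →
      ∀ f : ℝ → Space → ℝ, S.MemL2 f →
      ∀ (y₀ : Fin M.numNodes → ℝ) (y y' : ℝ → Fin M.numNodes → ℝ) (Y : ℕ → Fin M.numNodes → ℝ),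
        M.SolvesSemidiscrete S lam (Mesh.invLift S f) y₀ y y' →
        M.SolvesFullyDiscrete S lam (Mesh.invLift S f) y₀ N rem Y →
        evolvingNorm S.T (M.surface S) (fun t x => M.feFun S t (y t) x - M.stepFun S N Y t x) ≤
          ENNReal.ofReal (C * Mesh.timeStep S N) *
            (evolvingNorm S.T (M.surface S) (fun t => M.feFun S t (y' t)) +
              evolvingNorm S.T S.surface f +
              MeasureTheory.eLpNorm (M.feFun S 0 y₀) 2 (surfaceMeasure (M.surface S 0))) := by
  obtain ⟨c, B, h₀, hh₀, hTB⟩ := Mesh.exists_transportBounds S hθ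
  set c' : ℝ := 4 * c + L * (B + 1) with hc'
  set E : ℝ := eulerConst S.T c' cr with hE
  have hE0 : 0 < E := eulerConst_pos _ _ _
  refine ⟨2 * √E, by positivity, h₀, hh₀, ?_⟩
  intro M hM hh lam hlam hL N hN hkr rem hrem f hf y₀ y y' Y hy hY
  have hB := hTB M hM hh
  have hk := Mesh.timeStep_pos (S := S) hN
  have hNk := Mesh.mul_timeStep (S := S) hN
  have hy₀ := hy.2.1
  have hY₀ := hY.1
  set k := Mesh.timeStep S N with hkdef
  -- without this case distinction the finiteness of the norm would have to be derived from `hf`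
  by_cases hfin : evolvingNorm S.T S.surface f = ⊤
  · rw [hfin, add_top, top_add, ENNReal.mul_top (ENNReal.ofReal_pos.2 (by positivity)).ne']
    exact le_top
  have hB0 := hB.B_nonneg
  have hc0 := hB.c_nonneg
  have hlam1 : ∀ q ∈ M.spaceTime S, 1 ≤ lam q := fun q hq => (hlam q hq).1
  obtain ⟨m, hm, hmE⟩ := hB.exists_massForm hM (κ := L * (B + 1)) (by positivity)
  obtain ⟨a, ha, haE⟩ := hB.exists_energyForm hM hlam1 hL
  have hma : ∀ t ∈ Icc 0 S.T, ∀ u, m t u u ≤ a t u u := fun t ht u => by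
    rw [hm t ht, ha t ht]
    exact hM.massForm_le_energyForm hL.continuousOn hlam1 ht u
  have hh1 : ∀ t ∈ Icc 0 S.T, ∀ u, M.h1Norm S t u ≤ √(a t u u) := fun t ht u => by
    rw [ha t ht]
    exact Real.sqrt_le_sqrt
      (hM.energyForm_le_energyForm continuousOn_const hL.continuousOn hlam1 ht u)
  have hremA : ∀ n, 1 ≤ n → n ≤ N → ∀ ψ φ, |rem n ψ φ| ≤
      cr * k * √(a (n * k) ψ ψ) * √(a (n * k) φ φ) := by
    intro n hn hnN ψ φ
    have ht := grid_mem hk.le hNk hnN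
    refine (hrem n hn hnN ψ φ).trans ?_
    have h1 := hh1 _ ht ψ
    have h2 := hh1 _ ht φ
    have h3 : 0 ≤ M.h1Norm S (n * k) φ := Real.sqrt_nonneg _
    gcongr
  obtain ⟨δ, hδ0, hδ, hsum⟩ := euler_error hmE haE hma
    (hB.evolvingLoad hM hf hfin (c' := c') (by have : 0 ≤ L * (B + 1) := by positivity
                                               linarith) hm) hk hNk hcr hkr hremA
    (hB.isEulerSolution hM hf hfin hm ha hN hY) (hB.isSemidiscreteSolution hM hf hfin hm ha hy)
    (hY₀.trans hy₀.symm)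
  set Z := evolvingNorm S.T (M.surface S) (fun t => M.feFun S t (y' t)) with hZ
  set Fn := evolvingNorm S.T S.surface f with hFn
  set I := eLpNorm (M.feFun S 0 y₀) 2 (surfaceMeasure (M.surface S 0)) with hI
  -- the error is at most `δ n` in the `n`-th time interval
  have hleft : evolvingNorm S.T (M.surface S)
      (fun t x => M.feFun S t (y t) x - M.stepFun S N Y t x) ^ 2 ≤
        ENNReal.ofReal (∑ n ∈ Finset.range N, k * δ n) := by
    have e : (fun t x => M.feFun S t (y t) x - M.stepFun S N Y t x) =
        fun t => M.feFun S t (y t - Y ⌈t / k⌉₊) := by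
      funext t x
      exact Mesh.feFun_sub t _ _ x
    rw [e, hM.evolvingNorm_feFun_sq, ← restrict_Ioc_eq_restrict_Icc, ← hNk]
    refine (setLIntegral_Ioc_le_sum hk.le (δ := fun n => ENNReal.ofReal (δ n)) N
      fun n hn t ht => ?_).trans_eq ?_
    · have hceil : ⌈t / k⌉₊ = n + 1 := by
        rw [Nat.ceil_eq_iff (by omega), div_le_iff₀ hk, lt_div_iff₀ hk]
        exact ⟨by simpa using ht.1, ht.2⟩
      have htI : t ∈ Icc 0 S.T := ⟨(grid_mem hk.le hNk hn.le).1.trans ht.1.le,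
        ht.2.trans (grid_mem hk.le hNk (Nat.succ_le_of_lt hn)).2⟩
      rw [hceil, ← hm t htI]
      exact ENNReal.ofReal_le_ofReal (hδ n hn t (Ioc_subset_Icc_self ht))
    · rw [ENNReal.ofReal_sum_of_nonneg fun n hn =>
        mul_nonneg hk.le (hδ0 n (Finset.mem_range.1 hn))]
      exact Finset.sum_congr rfl fun n _ => (ENNReal.ofReal_mul hk.le).symm
  -- the terms of the right-hand side; the factor `4` with `f` comes from the projection
  have hZle : ENNReal.ofReal (∫ t in (0 : ℝ)..S.T, m t (y' t) (y' t)) ≤ Z ^ 2 := by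
    rw [hZ, hM.evolvingNorm_feFun_sq, intervalIntegral.integral_of_le S.T_pos.le,
      ← integral_Icc_eq_integral_Ioc]
    refine (ofReal_integral_le_lintegral ?_).trans_eq
      (setLIntegral_congr_fun measurableSet_Icc fun t ht => by rw [hm t ht])
    filter_upwards [ae_restrict_mem measurableSet_Icc] with t ht
    exact hmE.nonneg t ht _
  have hIeq : ENNReal.ofReal (m 0 (y 0) (y 0)) = I ^ 2 := by
    rw [hI, hM.eLpNorm_feFun_sq S.zero_mem, hm 0 S.zero_mem, hy₀]
  have hFle := hB.ofReal_integral_loadNorm_sq_le hM hf hfin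
  have hsq : (ENNReal.ofReal (2 * √E * k) * (Z + Fn + I)) ^ 2 =
      ENNReal.ofReal (E * k ^ 2) * (2 * (Z + Fn + I)) ^ 2 := by
    rw [mul_pow, mul_pow, ← ENNReal.ofReal_pow (by positivity), ← mul_assoc]
    congr 1
    have hC : (2 * √E * k) ^ 2 = E * k ^ 2 * 2 ^ 2 := by
      rw [mul_pow, mul_pow, Real.sq_sqrt hE0.le]
      ring
    rw [hC, ENNReal.ofReal_mul (by positivity), ENNReal.ofReal_pow (by norm_num),
      ENNReal.ofReal_ofNat]
  rw [← ENNReal.pow_le_pow_left_iff two_ne_zero, hsq]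
  refine hleft.trans ((ENNReal.ofReal_le_ofReal hsum).trans ?_)
  rw [ENNReal.ofReal_mul (by positivity)]
  gcongr
  calc _ ≤ Z ^ 2 + 4 * Fn ^ 2 + I ^ 2 := by
        refine ENNReal.ofReal_add_le.trans (add_le_add (ENNReal.ofReal_add_le.trans
          (add_le_add hZle hFle)) hIeq.le)
    _ ≤ Z ^ 2 + 4 * Fn ^ 2 + I ^ 2 +
        (3 * Z ^ 2 + 3 * I ^ 2 + 8 * (Z * Fn) + 8 * (Z * I) + 8 * (Fn * I)) := le_self_add
    _ = (2 * (Z + Fn + I)) ^ 2 := by ring
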